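/- **Setting.** Let $\pi:Y\to X$ be a fibred manifold (a surjective smooth submersion; $X,Y$ Hausdorff, second countable) with $\dim X=n+1\ge 1$ and fibre dimension $m\ge 0$, with fibred coordinates $(x^\lambda,y^i)$. Put $\omega=dx^1\wedge\dots\wedge dx^{n+1}$, $\omega_\lambda=\partial_\lambda\rfloor\omega$. Let $\Pi=\bigwedge^{n+1}T^*X\otimes_Y V^*Y\otimes_Y TX$ be the Legendre bundle over $Y$, with canonical coordinates $(x^\lambda,y^i,p^\lambda_i)$, ${p'}^\lambda_i=\det(\partial x'/\partial x)^{-1}\,\frac{\partial y^j}{\partial y'^i}\frac{\partial x'^\lambda}{\partial x^\mu}\,p^\mu_j$, zero section $\widehat 0$, generalized Liouville form $\theta=-p^\lambda_i\,dy^i\wedge\omega\otimes\partial_\lambda$ and multisymplectic form $\Omega=dp^\lambda_i\wedge dy^i\wedge\omega\otimes\partial_\lambda$, and write $\partial^i_\lambda=\partial/\partial p^\lambda_i$. A (local) jet field $\gamma=dx^\lambda\otimes(\partial_\lambda+\gamma^i_{(\lambda)}\partial_i+\gamma^\mu_{i\lambda}\partial^i_\mu)$ on $\Pi\to X$ is *Hamiltonian*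 if $\gamma\rfloor\Omega$ is closed; if it is defined on all of $\Pi$ it is called a connection. A smooth $(n+1)$-form $H$ on $\Pi$ is a *multimomentum Hamiltonian form* if on a neighbourhood of each point of $\Pi$ there is a Hamiltonian jet field $\gamma$ with $\gamma\rfloor\Omega=dH$ ($\gamma$ is then *associated* with $H$). A *horizontal density* is a smooth form $\widetilde H=\widetilde{\mathcal H}\,\omega$ on $\Pi$. An equation between forms holds *locally modulo closed forms* if each point of $\Pi$ has an open neighbourhood on which both sides differ by a closed form; horizontal densities whose existence is asserted in it are then defined on that neighbourhood. For a connection $\Gamma=dx^\lambda\otimes(\partial_\lambda+\Gamma^i_\lambda\partial_i)$ on $Y\to X$ let $\widehat\Gamma$ be its pullback to $\Pi$ and $H_\Gamma=\widehat\Gamma\rfloor\theta$. **Statement.** 1. If $H$ is a multimomentum Hamiltonian form and $\widetilde H$ a horizontal density, then $H-\widetilde H$ is a multimomentum Hamiltonian form. Conversely, the difference of two multimomentum Hamiltonian forms is, locally modulo closed forms, a horizontal density. 2. Connections $\Gamma$ on $Y\to X$ exist. For every such $\Gamma$, in all canonical coordinates $$H_\Gamma=p^\lambda_i\,dy^i\wedge\omega_\lambda-p^\lambda_i\Gamma^i_\lambda\,\omega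 ,$$ and $H_\Gamma$ is a multimomentum Hamiltonian form; so multimomentum Hamiltonian forms exist. If $K$ is a symmetric linear connection on $TX$ and $\widetilde\Gamma$ is the lift of $\Gamma$, that is, the connection on $\Pi\to X$ with $$\widetilde\Gamma=dx^\lambda\otimes[\partial_\lambda+\Gamma^i_\lambda\partial_i+(-\partial_j\Gamma^i_\lambda p^\mu_i-K^\mu{}_{\nu\lambda}p^\nu_j+K^\alpha{}_{\alpha\lambda}p^\mu_j)\partial^j_\mu]$$ in all canonical coordinates, then $\widetilde\Gamma$ is a Hamiltonian connection associated with $H_\Gamma$. 3. Let $H$ be a multimomentum Hamiltonian form and $\Gamma$ a connection on $Y\to X$. Then, locally modulo closed forms, $$H=H_\Gamma-\widetilde H_\Gamma=p^\lambda_i\,dy^i\wedge\omega_\lambda-\mathcal H\,\omega$$ for a horizontal density $\widetilde H_\Gamma$. 4. For every multimomentum Hamiltonian form $H$ there is a unique connection $\Gamma_H$ on $Y\to X$ such that $(\Gamma_H)^i_\lambda=\gamma^i_{(\lambda)}\circ\widehat 0$ for each jet field $\gamma$ associated with $H$ on an open set (where this is defined). Locally modulo closed forms, $H=H_{\Gamma_H}-\widetilde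 H$ with a horizontal density $\widetilde H=\widetilde{\mathcal H}\omega$ such that $\partial^i_\lambda\widetilde{\mathcal H}\circ\widehat 0=0$. 5. No closed forms and no localization are needed for the forms that are actually of the shape $H=p^\lambda_i\,dy^i\wedge\omega_\lambda-\mathcal H\,\omega$ in all canonical coordinates: these are multimomentum Hamiltonian forms; they constitute a non-empty affine space whose direction is the vector space of all horizontal densities on $\Pi\to X$; for every connection $\Gamma$ on $Y\to X$ each of them is $H=H_\Gamma-\widetilde H_\Gamma$ on all of $\Pi$ with a unique horizontal density $\widetilde H_\Gamma$; its connection $\Gamma_H$ is given by $(\Gamma_H)^i_\lambda=\partial^i_\lambda\mathcal H\circ\widehat 0$; and $H=H_{\Gamma_H}-\widetilde H$ on all of $\Pi$ with a horizontal density $\widetilde H=\widetilde{\mathcal H}\omega$ such that $\partial^i_\lambda\widetilde{\mathcal H}\circ\widehat 0=0$. -/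

import Mathlib

open Set Manifold
open scoped Topology ContDiff Manifold

noncomputable section

/-- Model space of the base manifold `X`, with `dim X = n + 1 ≥ 1`. -/
abbrev BaseModel (n : ℕ) : Type := EuclideanSpace ℝ (Fin (n + 1))

/-- Model space of the fibres of `Y → X`. -/
abbrev FibModel (m : ℕ) : Type := EuclideanSpace ℝ (Fin m)

/-- Model space of the fibres of the Legendre bundle `Π → Y`: an element `p` has the components
`p^λ_i = (p e_i)_λ`. -/
abbrev MomModel (n m : ℕ) : Type := FibModel m →L[ℝ] BaseModel n

section FibredManifolds

variable (n m : ℕ) {X Y : Type*}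
  [TopologicalSpace X] [ChartedSpace (BaseModel n) X]
  [TopologicalSpace Y] [ChartedSpace (BaseModel n × FibModel m) Y]

/-- A fibred manifold: a surjective smooth submersion `π : Y → X`. -/
structure IsFibredManifold (π : Y → X) : Prop where
  surjective : Function.Surjective π
  submersion : IsSubmersion 𝓘(ℝ, BaseModel n × FibModel m) 𝓘(ℝ, BaseModel n) ∞ π

/-- Fibred coordinates `(x^λ, y^i)` of `Y`, compatible with the coordinates `x^λ` of `X`. -/
structure FibredChart (π : Y → X) where
  base : OpenPartialHomeomorph X (BaseModel n)
  total : OpenPartialHomeomorph Y (BaseModel n × FibModel m)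
  base_mem : base ∈ IsManifold.maximalAtlas 𝓘(ℝ, BaseModel n) ∞ X
  total_mem : total ∈ IsManifold.maximalAtlas 𝓘(ℝ, BaseModel n × FibModel m) ∞ Y
  mapsTo : ∀ y ∈ total.source, π y ∈ base.source
  fst_eq : ∀ y ∈ total.source, (total y).1 = base (π y)

variable {n m}

theorem contDiffOn_transition {H M : Type*} [NormedAddCommGroup H] [NormedSpace ℝ H]
    [TopologicalSpace M] [ChartedSpace H M] {e e' : OpenPartialHomeomorph M H}
    (he : e ∈ IsManifold.maximalAtlas 𝓘(ℝ, H) ∞ M)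
    (he' : e' ∈ IsManifold.maximalAtlas 𝓘(ℝ, H) ∞ M) :
    ContDiffOn ℝ ∞ (fun z => e' (e.symm z)) (e.symm ≫ₕ e').source := by
  have h := IsManifold.compatible_of_mem_maximalAtlas he he'
  rw [contDiffGroupoid, mem_groupoid_of_pregroupoid] at h
  have h1 := h.1
  simpa [contDiffPregroupoid, Function.comp_def] using h1

theorem trans_toOpenPartialHomeomorph_mem_maximalAtlas
    {H M : Type*} [NormedAddCommGroup H] [NormedSpace ℝ H]
    [TopologicalSpace M] [ChartedSpace H M] {e : OpenPartialHomeomorph M H}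
    (he : e ∈ IsManifold.maximalAtlas 𝓘(ℝ, H) ∞ M) (A : H ≃L[ℝ] H) :
    e ≫ₕ A.toHomeomorph.toOpenPartialHomeomorph ∈ IsManifold.maximalAtlas 𝓘(ℝ, H) ∞ M := by
  have hA : A.toHomeomorph.toOpenPartialHomeomorph ∈ contDiffGroupoid ∞ 𝓘(ℝ, H) := by
    rw [contDiffGroupoid, mem_groupoid_of_pregroupoid]
    constructor
    · simpa [contDiffPregroupoid] using A.contDiff.contDiffOn
    · simpa [contDiffPregroupoid] using A.symm.contDiff.contDiffOn
  rw [IsManifold.mem_maximalAtlas_iff, mem_maximalAtlas_iff] at he ⊢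
  intro e' he'
  obtain ⟨h1, h2⟩ := he e' he'
  constructor
  · rw [OpenPartialHomeomorph.trans_symm_eq_symm_trans_symm, OpenPartialHomeomorph.trans_assoc]
    exact StructureGroupoid.trans _ (StructureGroupoid.symm _ hA) h1
  · rw [← OpenPartialHomeomorph.trans_assoc]
    exact StructureGroupoid.trans _ h2 hA

theorem IsFibredManifold.exists_fibredChart
    {π : Y → X} (hπ : IsFibredManifold n m π) (y : Y) :
    ∃ c : FibredChart n m π, y ∈ c.total.source := by
  obtain ⟨F, _, _, h⟩ := hπ.submersion
  have h := h y
  let L := h.equiv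
  have : FiniteDimensional ℝ (BaseModel n × F) := L.toLinearEquiv.finiteDimensional
  have : FiniteDimensional ℝ F :=
    FiniteDimensional.of_surjective (LinearMap.snd ℝ (BaseModel n) F) Prod.snd_surjective
  have hd : Module.finrank ℝ F = Module.finrank ℝ (FibModel m) := by
    have := L.toLinearEquiv.finrank_eq
    simp only [Module.finrank_prod] at this
    omega
  let K : F ≃L[ℝ] FibModel m := ContinuousLinearEquiv.ofFinrankEq hd
  let A : (BaseModel n × FibModel m) ≃L[ℝ] (BaseModel n × FibModel m) :=
    L.trans ((ContinuousLinearEquiv.refl ℝ (BaseModel n)).prodCongr K)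
  refine ⟨⟨h.codChart, h.domChart ≫ₕ A.toHomeomorph.toOpenPartialHomeomorph,
    h.codChart_mem_maximalAtlas,
    trans_toOpenPartialHomeomorph_mem_maximalAtlas h.domChart_mem_maximalAtlas A, ?_, ?_⟩, ?_⟩
  · intro y' hy'
    simp only [OpenPartialHomeomorph.trans_source, Homeomorph.toOpenPartialHomeomorph_source,
      preimage_univ, inter_univ] at hy'
    exact h.mapsto_domChart_source_codChart_source hy'
  · intro y' hy'
    simp only [OpenPartialHomeomorph.trans_source, Homeomorph.toOpenPartialHomeomorph_source,
      preimage_univ, inter_univ] at hy'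
    have hm : h.domChart y' ∈
        (h.domChart.extend 𝓘(ℝ, BaseModel n × FibModel m)).target := by
      rw [OpenPartialHomeomorph.extend_target]
      simpa using h.domChart.map_source hy'
    have h1 := h.writtenInCharts hm
    simp only [Function.comp_apply, OpenPartialHomeomorph.extend_coe,
      OpenPartialHomeomorph.extend_coe_symm, modelWithCornersSelf_coe,
      modelWithCornersSelf_coe_symm, id_eq, h.domChart.left_inv hy'] at h1
    rw [h1]
    rfl
  · simpa using h.mem_domChart_source

/-- The Jacobian `∂x'/∂x` of the change of base coordinates from `e` to `e'` at the point `x`. -/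
def jac {H M : Type*} [NormedAddCommGroup H] [NormedSpace ℝ H] [TopologicalSpace M]
    (e e' : OpenPartialHomeomorph M H) (x : M) : H →L[ℝ] H :=
  fderiv ℝ (fun z => e' (e.symm z)) (e x)

section jac

variable {H M : Type*} [NormedAddCommGroup H] [NormedSpace ℝ H] [TopologicalSpace M]

theorem jac_self (e : OpenPartialHomeomorph M H) {x : M} (hx : x ∈ e.source) :
    jac e e x = ContinuousLinearMap.id ℝ H := by
  have h : (fun z => e (e.symm z)) =ᶠ[𝓝 (e x)] id := by
    filter_upwards [e.open_target.mem_nhds (e.map_source hx)] with z hz using e.right_inv hz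
  rw [jac, h.fderiv_eq, fderiv_id]

variable [ChartedSpace H M]

theorem differentiableAt_transition {e e' : OpenPartialHomeomorph M H}
    (he : e ∈ IsManifold.maximalAtlas 𝓘(ℝ, H) ∞ M)
    (he' : e' ∈ IsManifold.maximalAtlas 𝓘(ℝ, H) ∞ M) {x : M} (hx : x ∈ e.source)
    (hx' : x ∈ e'.source) : DifferentiableAt ℝ (fun z => e' (e.symm z)) (e x) := by
  refine ((contDiffOn_transition he he').contDiffAt
    ((e.symm ≫ₕ e').open_source.mem_nhds ?_)).differentiableAt (by simp)
  simp [hx, hx', e.map_source hx]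

theorem jac_comp {e e' e'' : OpenPartialHomeomorph M H}
    (he : e ∈ IsManifold.maximalAtlas 𝓘(ℝ, H) ∞ M)
    (he' : e' ∈ IsManifold.maximalAtlas 𝓘(ℝ, H) ∞ M)
    (he'' : e'' ∈ IsManifold.maximalAtlas 𝓘(ℝ, H) ∞ M) {x : M} (hx : x ∈ e.source)
    (hx' : x ∈ e'.source) (hx'' : x ∈ e''.source) :
    (jac e' e'' x).comp (jac e e' x) = jac e e'' x := by
  have h1 := differentiableAt_transition he he' hx hx'
  have h2 := differentiableAt_transition he' he'' hx' hx''
  have h3 : e' (e.symm (e x)) = e' x := by rw [e.left_inv hx]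
  have h4 : (fun z => e'' (e.symm z)) =ᶠ[𝓝 (e x)]
      (fun z => e'' (e'.symm z)) ∘ (fun z => e' (e.symm z)) := by
    have : (e.symm ≫ₕ e').source ∈ 𝓝 (e x) :=
      (e.symm ≫ₕ e').open_source.mem_nhds (by simp [hx, hx', e.map_source hx])
    filter_upwards [this] with z hz
    simp only [OpenPartialHomeomorph.trans_source, mem_inter_iff, mem_preimage] at hz
    simp [e'.left_inv hz.2]
  rw [jac, jac, jac, h4.fderiv_eq, fderiv_comp _ (by rw [h3]; exact h2) h1, h3]

theorem contDiffOn_jac {e e' : OpenPartialHomeomorph M H}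
    (he : e ∈ IsManifold.maximalAtlas 𝓘(ℝ, H) ∞ M)
    (he' : e' ∈ IsManifold.maximalAtlas 𝓘(ℝ, H) ∞ M) :
    ContMDiffOn 𝓘(ℝ, H) 𝓘(ℝ, H →L[ℝ] H) ∞ (jac e e') (e.source ∩ e'.source) := by
  have h1 : ContDiffOn ℝ ∞ (fderiv ℝ (fun z => e' (e.symm z))) (e.symm ≫ₕ e').source :=
    (contDiffOn_transition he he').fderiv_of_isOpen (e.symm ≫ₕ e').open_source (by simp)
  have h2 := (contMDiffOn_of_mem_maximalAtlas he).mono (inter_subset_left (t := e'.source))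
  refine h1.contMDiffOn.comp h2 ?_
  intro x hx
  simp [hx.1, hx.2, e.map_source hx.1]

end jac

theorem contDiff_continuousLinearMap_det (n : ℕ) :
    ContDiff ℝ ∞ (fun A : BaseModel n →L[ℝ] BaseModel n => A.det) := by
  have h : (fun A : BaseModel n →L[ℝ] BaseModel n => A.det) = fun A =>
      ∑ σ : Equiv.Perm (Fin (n + 1)), (Equiv.Perm.sign σ : ℤ) •
        ∏ i, (A (EuclideanSpace.single i 1)) (σ i) := by
    ext A
    rw [ContinuousLinearMap.det, ← LinearMap.det_toMatrix
      (EuclideanSpace.basisFun (Fin (n + 1)) ℝ).toBasis, Matrix.det_apply]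
    refine Finset.sum_congr rfl fun σ _ => ?_
    simp [LinearMap.toMatrix_apply, Units.smul_def]
  rw [h]
  refine ContDiff.sum fun σ _ => ?_
  refine ContDiff.const_smul _ (contDiff_prod fun i _ => ?_)
  fun_prop

namespace FibredChart

variable {π : Y → X}

/-- The Jacobian `∂x'/∂x` of the coordinates of `c'` with respect to those of `c`. -/
def baseJac (c c' : FibredChart n m π) (y : Y) : BaseModel n →L[ℝ] BaseModel n :=
  jac c.base c'.base (π y)

/-- The fibre Jacobian `∂y/∂y'` of the coordinates of `c` with respect to those of `c'`. -/
def fibJac (c c' : FibredChart n m π) (y : Y) : FibModel m →L[ℝ] FibModel m :=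
  (ContinuousLinearMap.snd ℝ (BaseModel n) (FibModel m)).comp
    ((jac c'.total c.total y).comp (ContinuousLinearMap.inr ℝ (BaseModel n) (FibModel m)))

/-- The transformation law of the momenta,
`p'^λ_i = det(∂x'/∂x)⁻¹ (∂y^j/∂y'^i) (∂x'^λ/∂x^μ) p^μ_j`. -/
def momChange (c c' : FibredChart n m π) (y : Y) : MomModel n m →L[ℝ] MomModel n m :=
  (baseJac c c' y).det⁻¹ •
    (ContinuousLinearMap.compL ℝ (FibModel m) (BaseModel n) (BaseModel n) (baseJac c c' y)).comp
      ((ContinuousLinearMap.compL ℝ (FibModel m) (FibModel m) (BaseModel n)).flip (fibJac c c' y))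

theorem momChange_apply (c c' : FibredChart n m π) (y : Y) (p : MomModel n m) :
    momChange c c' y p =
      (baseJac c c' y).det⁻¹ • (baseJac c c' y).comp (p.comp (fibJac c c' y)) := rfl

theorem baseJac_comp (c c' c'' : FibredChart n m π) {y : Y} (hy : y ∈ c.total.source)
    (hy' : y ∈ c'.total.source) (hy'' : y ∈ c''.total.source) :
    (baseJac c' c'' y).comp (baseJac c c' y) = baseJac c c'' y :=
  jac_comp c.base_mem c'.base_mem c''.base_mem (c.mapsTo y hy) (c'.mapsTo y hy') (c''.mapsTo y hy'')

theorem baseJac_self (c : FibredChart n m π) {y : Y} (hy : y ∈ c.total.source) :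
    baseJac c c y = ContinuousLinearMap.id ℝ _ :=
  jac_self _ (c.mapsTo y hy)

theorem fibJac_self (c : FibredChart n m π) {y : Y} (hy : y ∈ c.total.source) :
    fibJac c c y = ContinuousLinearMap.id ℝ _ := by
  rw [fibJac, jac_self _ hy]
  ext v : 1
  simp

theorem jac_total_inr_fst (c c' : FibredChart n m π) {y : Y} (hy : y ∈ c.total.source)
    (hy' : y ∈ c'.total.source) (v : FibModel m) :
    (jac c.total c'.total y (0, v)).1 = 0 := by
  have h1 := differentiableAt_transition c.total_mem c'.total_mem hy hy'
  have hb := differentiableAt_transition c.base_mem c'.base_mem (c.mapsTo y hy) (c'.mapsTo y hy')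
  have h2 : (fun z => (c'.total (c.total.symm z)).1) =ᶠ[𝓝 (c.total y)]
      (fun x => c'.base (c.base.symm x)) ∘ (fun z : BaseModel n × FibModel m => z.1) := by
    have : (c.total.symm ≫ₕ c'.total).source ∈ 𝓝 (c.total y) :=
      (c.total.symm ≫ₕ c'.total).open_source.mem_nhds (by simp [hy, hy', c.total.map_source hy])
    filter_upwards [this] with z hz
    simp only [OpenPartialHomeomorph.trans_source, mem_inter_iff, mem_preimage,
      OpenPartialHomeomorph.symm_source] at hz
    have hs := c.total.map_target hz.1
    have e1 : c.base (π (c.total.symm z)) = z.1 := by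
      rw [← c.fst_eq _ hs, c.total.right_inv hz.1]
    simp only [Function.comp_apply]
    rw [c'.fst_eq _ hz.2, ← e1, c.base.left_inv (c.mapsTo _ hs)]
  have h3 : fderiv ℝ (fun z => (c'.total (c.total.symm z)).1) (c.total y) =
      (ContinuousLinearMap.fst ℝ _ _).comp (jac c.total c'.total y) :=
    (h1.hasFDerivAt.fst).fderiv
  have h4 : (jac c.total c'.total y (0, v)).1 =
      fderiv ℝ (fun z => (c'.total (c.total.symm z)).1) (c.total y) (0, v) := by
    rw [h3]; rfl
  rw [h4, h2.fderiv_eq, fderiv_comp _ (by rw [c.fst_eq y hy]; exact hb) differentiableAt_fst,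
    fderiv_fst]
  simp

theorem fibJac_comp (c c' c'' : FibredChart n m π) {y : Y} (hy : y ∈ c.total.source)
    (hy' : y ∈ c'.total.source) (hy'' : y ∈ c''.total.source) :
    (fibJac c c' y).comp (fibJac c' c'' y) = fibJac c c'' y := by
  ext v : 1
  have h := jac_comp c''.total_mem c'.total_mem c.total_mem hy'' hy' hy
  have h0 : jac c''.total c'.total y (0, v) = (0, (jac c''.total c'.total y (0, v)).2) :=
    Prod.ext (jac_total_inr_fst c'' c' hy'' hy' v) rfl
  have h1 : jac c''.total c.total y (0, v) =
      jac c'.total c.total y (jac c''.total c'.total y (0, v)) := by rw [← h]; rfl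
  simp only [fibJac, ContinuousLinearMap.comp_apply, ContinuousLinearMap.inr_apply,
    ContinuousLinearMap.coe_snd']
  rw [h1, ← h0]

theorem det_baseJac_ne_zero (c c' : FibredChart n m π) {y : Y} (hy : y ∈ c.total.source)
    (hy' : y ∈ c'.total.source) : (baseJac c c' y).det ≠ 0 := by
  have h := baseJac_comp c c' c hy hy' hy
  rw [baseJac_self c hy] at h
  have h2 : (baseJac c' c y).det * (baseJac c c' y).det = 1 := by
    have h3 := congrArg ContinuousLinearMap.det h
    simpa [ContinuousLinearMap.det] using h3
  exact right_ne_zero_of_mul_eq_one h2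

theorem contMDiffOn_momChange (c c' : FibredChart n m π) :
    ContMDiffOn 𝓘(ℝ, BaseModel n × FibModel m) 𝓘(ℝ, MomModel n m →L[ℝ] MomModel n m) ∞
      (momChange c c') (c.total.source ∩ c'.total.source) := by
  have hA : ContMDiffOn 𝓘(ℝ, BaseModel n × FibModel m) 𝓘(ℝ, BaseModel n →L[ℝ] BaseModel n) ∞
      (baseJac c c') (c.total.source ∩ c'.total.source) := by
    have h1 : ContDiffOn ℝ ∞ (fderiv ℝ (fun z => c'.base (c.base.symm z)))
        (c.base.symm ≫ₕ c'.base).source :=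
      (contDiffOn_transition c.base_mem c'.base_mem).fderiv_of_isOpen
        (c.base.symm ≫ₕ c'.base).open_source (by simp)
    have h2 : ContMDiffOn 𝓘(ℝ, BaseModel n × FibModel m) 𝓘(ℝ, BaseModel n) ∞
        (fun y => (c.total y).1) (c.total.source ∩ c'.total.source) :=
      (contDiff_fst.contMDiff).comp_contMDiffOn
        ((contMDiffOn_of_mem_maximalAtlas c.total_mem).mono inter_subset_left)
    refine (h1.contMDiffOn.comp h2 ?_).congr ?_
    · intro y hy
      have := c.mapsTo y hy.1
      simp [c.fst_eq y hy.1, this, c'.mapsTo y hy.2, c.base.map_source this]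
    · intro y hy
      simp [baseJac, jac, c.fst_eq y hy.1]
  have hB : ContMDiffOn 𝓘(ℝ, BaseModel n × FibModel m) 𝓘(ℝ, FibModel m →L[ℝ] FibModel m) ∞
      (fibJac c c') (c.total.source ∩ c'.total.source) := by
    have h1 := contDiffOn_jac c'.total_mem c.total_mem
    rw [inter_comm] at h1
    exact (contMDiffOn_const.clm_comp (h1.clm_comp contMDiffOn_const))
  have hdet : ContMDiffOn 𝓘(ℝ, BaseModel n × FibModel m) 𝓘(ℝ, ℝ) ∞
      (fun y => (baseJac c c' y).det⁻¹) (c.total.source ∩ c'.total.source) := by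
    have h1 : ContDiffOn ℝ ∞ (fun A : BaseModel n →L[ℝ] BaseModel n => A.det⁻¹)
        {A | A.det ≠ 0} :=
      (contDiff_continuousLinearMap_det n).contDiffOn.inv fun A hA => hA
    exact h1.contMDiffOn.comp hA fun y hy => det_baseJac_ne_zero c c' hy.1 hy.2
  refine hdet.smul (ContMDiffOn.clm_comp ?_ ?_)
  · exact (ContinuousLinearMap.contDiff _).contMDiff.comp_contMDiffOn hA
  · exact (ContinuousLinearMap.contDiff _).contMDiff.comp_contMDiffOn hB

end FibredChart

/-- The Legendre bundle `Π = ⋀ⁿ⁺¹T*X ⊗ V*Y ⊗ TX → Y` (with `dim X = n + 1`), given by its linear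
fibre coordinates `p^λ_i` over the fibred charts of `Y` and by their transformation law. -/
def legendreCore {π : Y → X} (hπ : IsFibredManifold n m π) :
    VectorBundleCore ℝ Y (MomModel n m) (FibredChart n m π) where
  baseSet c := c.total.source
  isOpen_baseSet c := c.total.open_source
  indexAt y := (hπ.exists_fibredChart y).choose
  mem_baseSet_at y := (hπ.exists_fibredChart y).choose_spec
  coordChange := FibredChart.momChange
  coordChange_self c y hy p := by
    rw [FibredChart.momChange_apply, FibredChart.baseJac_self c hy, FibredChart.fibJac_self c hy]
    ext v
    simp [ContinuousLinearMap.det]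
  continuousOn_coordChange c c' := (FibredChart.contMDiffOn_momChange c c').continuousOn
  coordChange_comp c c' c'' y hy p := by
    obtain ⟨⟨h1, h2⟩, h3⟩ := hy
    simp only [FibredChart.momChange_apply]
    rw [← FibredChart.baseJac_comp c c' c'' h1 h2 h3, ← FibredChart.fibJac_comp c c' c'' h1 h2 h3]
    have hd : ((FibredChart.baseJac c' c'' y).comp (FibredChart.baseJac c c' y)).det =
        (FibredChart.baseJac c' c'' y).det * (FibredChart.baseJac c c' y).det := by
      simp [ContinuousLinearMap.det]
    rw [hd, mul_inv]
    ext v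
    simp [mul_assoc]

instance {π : Y → X} (hπ : IsFibredManifold n m π) :
    (legendreCore hπ).IsContMDiff 𝓘(ℝ, BaseModel n × FibModel m) ∞ where
  contMDiffOn_coordChange := FibredChart.contMDiffOn_momChange

/-- The total space of the Legendre bundle `Π → Y`. -/
abbrev LegendreBundle {π : Y → X} (hπ : IsFibredManifold n m π) : Type _ :=
  (legendreCore hπ).TotalSpace

/-- The composite projection `Π → Y → X`. -/
def legendreProj {π : Y → X} (hπ : IsFibredManifold n m π) : LegendreBundle hπ → X :=
  fun q => π q.proj

/-- The zero section of `Π → Y`. -/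
abbrev legendreZero {π : Y → X} (hπ : IsFibredManifold n m π) (y : Y) : LegendreBundle hπ :=
  Bundle.zeroSection (MomModel n m) (legendreCore hπ).Fiber y

/-- Model with corners of the manifold `Π`. -/
abbrev legendreI (n m : ℕ) := (𝓘(ℝ, BaseModel n × FibModel m)).prod 𝓘(ℝ, MomModel n m)

/-- The space of canonical coordinates `((x^λ, y^i), p^λ_i)`. -/
abbrev LegendreModel (n m : ℕ) : Type := (BaseModel n × FibModel m) × MomModel n m

/-- The canonical coordinates `(x^λ, y^i, p^λ_i)` of `Π` induced by fibred coordinates of `Y`. -/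
def canonicalChart {π : Y → X} (hπ : IsFibredManifold n m π) (c : FibredChart n m π) :
    OpenPartialHomeomorph (LegendreBundle hπ) (LegendreModel n m) :=
  ((legendreCore hπ).localTriv c).toOpenPartialHomeomorph ≫ₕ
    c.total.prod (OpenPartialHomeomorph.refl (MomModel n m))

/-- The coordinate domain of `U ⊆ Π` in the canonical coordinates of `c`. -/
def coordDomain {π : Y → X} (hπ : IsFibredManifold n m π) (c : FibredChart n m π)
    (U : Set (LegendreBundle hπ)) : Set (LegendreModel n m) :=
  (canonicalChart hπ c).target ∩ (canonicalChart hπ c).symm ⁻¹' U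

end FibredManifolds

/-! ### Forms in canonical coordinates -/

section CoordinateForms

variable {n m : ℕ}

/-- The base vector `e_λ`. -/
abbrev baseVec (l : Fin (n + 1)) : BaseModel n := EuclideanSpace.single l 1

/-- The fibre vector `e_i`. -/
abbrev fibVec (i : Fin m) : FibModel m := EuclideanSpace.single i 1

/-- The component `p^λ_i`. -/
def momCoeff (p : MomModel n m) (l : Fin (n + 1)) (i : Fin m) : ℝ := (p (fibVec i)) l

/-- The momentum `p` whose only non-zero component is `p^λ_i = 1`. -/
def momVec (l : Fin (n + 1)) (i : Fin m) : MomModel n m :=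
  (EuclideanSpace.proj (𝕜 := ℝ) i : FibModel m →L[ℝ] ℝ).smulRight (baseVec l)

/-- The vector `∂_λ`. -/
def partialX (l : Fin (n + 1)) : LegendreModel n m := ((baseVec l, 0), 0)

/-- The 1-form `dy^i`. -/
def dY (i : Fin m) : LegendreModel n m →L[ℝ] ℝ :=
  (EuclideanSpace.proj (𝕜 := ℝ) i : FibModel m →L[ℝ] ℝ).comp
    ((ContinuousLinearMap.snd ℝ (BaseModel n) (FibModel m)).comp
      (ContinuousLinearMap.fst ℝ (BaseModel n × FibModel m) (MomModel n m)))

/-- The 1-form `dp^λ_i`. -/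
def dP (l : Fin (n + 1)) (i : Fin m) : LegendreModel n m →L[ℝ] ℝ :=
  (EuclideanSpace.proj (𝕜 := ℝ) l : BaseModel n →L[ℝ] ℝ).comp
    ((ContinuousLinearMap.apply ℝ (BaseModel n) (fibVec i)).comp
      (ContinuousLinearMap.snd ℝ (BaseModel n × FibModel m) (MomModel n m)))

/-- The projection to the coordinates `x^λ`. -/
def projX : LegendreModel n m →ₗ[ℝ] (Fin (n + 1) → ℝ) where
  toFun w := fun l => w.1.1 l
  map_add' _ _ := rfl
  map_smul' _ _ := rfl

/-- The form `ω = dx^1 ∧ ⋯ ∧ dx^{n+1}`. -/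
def omegaX : LegendreModel n m [⋀^Fin (n + 1)]→L[ℝ] ℝ where
  toMultilinearMap :=
    ((Matrix.detRowAlternating (R := ℝ) (n := Fin (n + 1))).compLinearMap projX).toMultilinearMap
  map_eq_zero_of_eq' :=
    ((Matrix.detRowAlternating (R := ℝ) (n := Fin (n + 1))).compLinearMap projX).map_eq_zero_of_eq'
  cont := by
    refine Continuous.matrix_det (A := fun (v : Fin (n + 1) → LegendreModel n m) =>
      Matrix.of fun a b => (v a).1.1 b) ?_
    refine continuous_matrix fun a b => ?_
    simp only [Matrix.of_apply]
    fun_prop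

/-- The form `ω_λ = ∂_λ ⌋ ω`. -/
def omegaSub (l : Fin (n + 1)) : LegendreModel n m [⋀^Fin n]→L[ℝ] ℝ :=
  omegaX.curryLeft (partialX l)

/-- The exterior product `α ∧ β` of a 1-form and an `r`-form,
`(α ∧ β)(v_0, …, v_r) = ∑_k (-1)^k α(v_k) β(v_0, …, v̂_k, …, v_r)`. -/
def wedgeOne {r : ℕ} (α : LegendreModel n m →L[ℝ] ℝ) (β : LegendreModel n m [⋀^Fin r]→L[ℝ] ℝ) :
    LegendreModel n m [⋀^Fin (r + 1)]→L[ℝ] ℝ :=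
  ContinuousAlternatingMap.alternatizeUncurryFin (α.smulRight β)

/-- The forms `θ^λ` in the generalized Liouville form
`θ = θ^λ ⊗ ∂_λ = -p^λ_i dy^i ∧ ω ⊗ ∂_λ`. -/
def thetaComp (p : MomModel n m) (l : Fin (n + 1)) : LegendreModel n m [⋀^Fin (n + 2)]→L[ℝ] ℝ :=
  -∑ i, momCoeff p l i • wedgeOne (dY i) omegaX

/-- The forms `Ω^λ` in the multisymplectic form
`Ω = Ω^λ ⊗ ∂_λ = dp^λ_i ∧ dy^i ∧ ω ⊗ ∂_λ`. -/
def multisymplecticComp (l : Fin (n + 1)) : LegendreModel n m [⋀^Fin (n + 3)]→L[ℝ] ℝ :=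
  ∑ i, wedgeOne (dP l i) (wedgeOne (dY i) omegaX)

/-- The form `p^λ_i dy^i ∧ ω_λ` at the point with momentum `p`. -/
def momentumForm (p : MomModel n m) : LegendreModel n m [⋀^Fin (n + 1)]→L[ℝ] ℝ :=
  ∑ l, ∑ i, momCoeff p l i • wedgeOne (dY i) (omegaSub l)

end CoordinateForms

/-! ### Differential forms on the Legendre manifold -/

section LegendreForms

variable {n m : ℕ} {X Y : Type*}
  [TopologicalSpace X] [ChartedSpace (BaseModel n) X]
  [TopologicalSpace Y] [ChartedSpace (BaseModel n × FibModel m) Y]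
  {π : Y → X} (hπ : IsFibredManifold n m π)

/-- Exterior `r`-forms on the manifold `Π` (no smoothness required). -/
abbrev LegendreForm (r : ℕ) : Type _ :=
  ∀ q : LegendreBundle hπ, TangentSpace (legendreI n m) q [⋀^Fin r]→L[ℝ] ℝ

variable {hπ}

/-- The coordinate expression of a form in the canonical coordinates of `c`. -/
def LegendreForm.rep {r : ℕ} (H : LegendreForm hπ r) (c : FibredChart n m π)
    (w : LegendreModel n m) : LegendreModel n m [⋀^Fin r]→L[ℝ] ℝ :=
  (H ((canonicalChart hπ c).symm w)).compContinuousLinearMap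
    (mfderiv 𝓘(ℝ, LegendreModel n m) (legendreI n m) (canonicalChart hπ c).symm w)

/-- Smoothness of a form on `U`. -/
def IsSmoothFormOn {r : ℕ} (U : Set (LegendreBundle hπ)) (H : LegendreForm hπ r) : Prop :=
  ∀ c : FibredChart n m π, ContDiffOn ℝ ∞ (LegendreForm.rep H c) (coordDomain hπ c U)

/-- `dH = 0` on `U`. -/
def IsClosedFormOn {r : ℕ} (U : Set (LegendreBundle hπ)) (H : LegendreForm hπ r) : Prop :=
  ∀ c : FibredChart n m π, ∀ w ∈ coordDomain hπ c U, extDeriv (LegendreForm.rep H c) w = 0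

/-- Horizontal densities `D = 𝓓 ω` on `Π → X`, over `U`. -/
def IsHorizontalDensityOn (U : Set (LegendreBundle hπ)) (D : LegendreForm hπ (n + 1)) : Prop :=
  IsSmoothFormOn U D ∧ ∀ c : FibredChart n m π, ∃ h : LegendreModel n m → ℝ,
    ∀ w ∈ coordDomain hπ c U, LegendreForm.rep D c w = h w • omegaX

/-- The coefficient of `ω` in the coordinate expression of an `(n+1)`-form. -/
def LegendreForm.omegaCoeff (D : LegendreForm hπ (n + 1)) (c : FibredChart n m π)
    (w : LegendreModel n m) : ℝ :=
  LegendreForm.rep D c w partialX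

/-- Smooth forms of the shape `p^λ_i dy^i ∧ ω_λ - 𝓗 ω` over `U`. -/
def IsSplitFormOn (U : Set (LegendreBundle hπ)) (H : LegendreForm hπ (n + 1)) : Prop :=
  IsSmoothFormOn U H ∧ ∀ c : FibredChart n m π, ∃ h : LegendreModel n m → ℝ,
    ∀ w ∈ coordDomain hπ c U, LegendreForm.rep H c w = momentumForm w.2 - h w • omegaX

/-! ### Jet fields on `Π → X` and Hamiltonian forms -/

variable (hπ) in
/-- Assignments `q ↦ γ_q : T_xX → T_qΠ`, i.e. `γ = dx^λ ⊗ γ_λ`. -/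
abbrev LegendreJet : Type _ :=
  ∀ q : LegendreBundle hπ,
    TangentSpace 𝓘(ℝ, BaseModel n) (legendreProj hπ q) →L[ℝ] TangentSpace (legendreI n m) q

/-- The coordinate expression of
`γ_λ = ∂_λ + γ^i_(λ) ∂_i + γ^μ_{iλ} ∂^i_μ` in the canonical coordinates of `c`. -/
def LegendreJet.vec (γ : LegendreJet hπ) (c : FibredChart n m π) (w : LegendreModel n m)
    (l : Fin (n + 1)) : LegendreModel n m :=
  mfderiv (legendreI n m) 𝓘(ℝ, LegendreModel n m) (canonicalChart hπ c)
    ((canonicalChart hπ c).symm w) (γ ((canonicalChart hπ c).symm w)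
      (mfderiv 𝓘(ℝ, BaseModel n) 𝓘(ℝ, BaseModel n) c.base.symm w.1.1 (baseVec l)))

/-- Smooth jet fields on `Π → X` over `U`: sections of the jet bundle `J¹Π → Π`, represented by
horizontal tangent-valued 1-forms. Connections on `Π → X` are the jet fields over `univ`. -/
def IsJetFieldOn (U : Set (LegendreBundle hπ)) (γ : LegendreJet hπ) : Prop :=
  (∀ q ∈ U, (mfderiv (legendreI n m) 𝓘(ℝ, BaseModel n) (legendreProj hπ) q).comp (γ q) =
    ContinuousLinearMap.id ℝ _) ∧
  ∀ (c : FibredChart n m π) (l : Fin (n + 1)),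
    ContDiffOn ℝ ∞ (fun w => LegendreJet.vec γ c w l) (coordDomain hπ c U)

/-- The coordinate expression of `γ ⌋ Ω = γ_λ ⌋ Ω^λ`. -/
def LegendreJet.contractOmega (γ : LegendreJet hπ) (c : FibredChart n m π)
    (w : LegendreModel n m) : LegendreModel n m [⋀^Fin (n + 2)]→L[ℝ] ℝ :=
  ∑ l, (multisymplecticComp l).curryLeft (LegendreJet.vec γ c w l)

/-- Hamiltonian jet fields over `U`: the form `γ ⌋ Ω` is closed. -/
def IsHamiltonianJetFieldOn (U : Set (LegendreBundle hπ)) (γ : LegendreJet hπ) : Prop :=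
  IsJetFieldOn U γ ∧ ∀ c : FibredChart n m π, ∀ w ∈ coordDomain hπ c U,
    extDeriv (LegendreJet.contractOmega γ c) w = 0

/-- `γ` is a Hamiltonian jet field over `U` associated with `H`: `γ ⌋ Ω = dH` on `U`. -/
def IsAssociatedJetFieldOn (U : Set (LegendreBundle hπ)) (γ : LegendreJet hπ)
    (H : LegendreForm hπ (n + 1)) : Prop :=
  IsHamiltonianJetFieldOn U γ ∧ ∀ c : FibredChart n m π, ∀ w ∈ coordDomain hπ c U,
    LegendreJet.contractOmega γ c w = extDeriv (LegendreForm.rep H c) w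

/-- Multimomentum Hamiltonian forms. -/
def IsHamiltonianForm (H : LegendreForm hπ (n + 1)) : Prop :=
  IsSmoothFormOn univ H ∧ ∀ q : LegendreBundle hπ, ∃ U : Set (LegendreBundle hπ),
    IsOpen U ∧ q ∈ U ∧ ∃ γ : LegendreJet hπ, IsAssociatedJetFieldOn U γ H

/-! ### Connections on `Y → X` -/

variable (n m π) in
/-- Assignments `y ↦ Γ_y : T_xX → T_yY`. -/
abbrev ConnForm : Type _ :=
  ∀ y : Y, TangentSpace 𝓘(ℝ, BaseModel n) (π y) →L[ℝ]
    TangentSpace 𝓘(ℝ, BaseModel n × FibModel m) y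

/-- The coordinate coefficients `Γ^i_λ = (coeff e_λ)_i` at the point with coordinates `z = (x, y)`. -/
def ConnForm.coeff (Γ : ConnForm n m π) (c : FibredChart n m π) (z : BaseModel n × FibModel m) :
    BaseModel n →L[ℝ] FibModel m :=
  (ContinuousLinearMap.snd ℝ (BaseModel n) (FibModel m)).comp
    ((mfderiv 𝓘(ℝ, BaseModel n × FibModel m) 𝓘(ℝ, BaseModel n × FibModel m) c.total
      (c.total.symm z)).comp
      ((Γ (c.total.symm z)).comp
        (mfderiv 𝓘(ℝ, BaseModel n) 𝓘(ℝ, BaseModel n) c.base.symm z.1)))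

/-- Connections on `Y → X`: smooth splittings `Γ = dx^λ ⊗ (∂_λ + Γ^i_λ ∂_i)` of `TY → TX`. -/
def IsConnection (Γ : ConnForm n m π) : Prop :=
  (∀ y, (mfderiv 𝓘(ℝ, BaseModel n × FibModel m) 𝓘(ℝ, BaseModel n) π y).comp (Γ y) =
    ContinuousLinearMap.id ℝ _) ∧
  ∀ c : FibredChart n m π, ContDiffOn ℝ ∞ (ConnForm.coeff Γ c) c.total.target

/-- The coordinate expression of `Γ̂ ⌋ θ = (∂_λ + Γ^i_λ ∂_i) ⌋ θ^λ`. -/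
def ConnForm.contractTheta (Γ : ConnForm n m π) (c : FibredChart n m π) (w : LegendreModel n m) :
    LegendreModel n m [⋀^Fin (n + 1)]→L[ℝ] ℝ :=
  ∑ l, (thetaComp w.2 l).curryLeft ((baseVec l, ConnForm.coeff Γ c w.1 (baseVec l)), 0)

variable (hπ) in
/-- The form `H_Γ = Γ̂ ⌋ θ` on `Π`, computed at every point in some canonical chart around it. -/
def connHamiltonian (Γ : ConnForm n m π) : LegendreForm hπ (n + 1) := fun q =>
  (ConnForm.contractTheta Γ ((legendreCore hπ).indexAt q.proj)
    (canonicalChart hπ ((legendreCore hπ).indexAt q.proj) q)).compContinuousLinearMap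
    (mfderiv (legendreI n m) 𝓘(ℝ, LegendreModel n m)
      (canonicalChart hπ ((legendreCore hπ).indexAt q.proj)) q)

/-- The coefficients `K^α_{νλ}` of a linear connection on `TX`, `∇_{∂_λ} ∂_ν = K^α_{νλ} ∂_α`, in the
coordinates `b` at the point with coordinates `x`. -/
def christoffel [IsManifold 𝓘(ℝ, BaseModel n) ∞ X]
    (K : CovariantDerivative 𝓘(ℝ, BaseModel n) (BaseModel n)
      (fun x : X => TangentSpace 𝓘(ℝ, BaseModel n) x))
    (b : OpenPartialHomeomorph X (BaseModel n)) (x : BaseModel n) (α ν l : Fin (n + 1)) : ℝ :=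
  (show BaseModel n from
    mfderiv 𝓘(ℝ, BaseModel n) 𝓘(ℝ, BaseModel n) b (b.symm x)
      (K (fun x' => mfderiv 𝓘(ℝ, BaseModel n) 𝓘(ℝ, BaseModel n) b.symm (b x') (baseVec ν))
        (b.symm x) (mfderiv 𝓘(ℝ, BaseModel n) 𝓘(ℝ, BaseModel n) b.symm x (baseVec l)))) α

/-- `γ` is the lift of the connection `Γ` to `Π → X` by means of the linear connection `K`:
`γ_λ = ∂_λ + Γ^i_λ ∂_i + (-∂_jΓ^i_λ p^μ_i - K^μ_{νλ} p^ν_j + K^α_{αλ} p^μ_j) ∂^j_μ`. -/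
def IsConnectionLift [IsManifold 𝓘(ℝ, BaseModel n) ∞ X] (Γ : ConnForm n m π)
    (K : CovariantDerivative 𝓘(ℝ, BaseModel n) (BaseModel n)
      (fun x : X => TangentSpace 𝓘(ℝ, BaseModel n) x))
    (γ : LegendreJet hπ) : Prop :=
  IsJetFieldOn univ γ ∧
  ∀ c : FibredChart n m π, ∀ w ∈ coordDomain hπ c univ, ∀ l : Fin (n + 1),
    LegendreJet.vec γ c w l =
      ((baseVec l, ConnForm.coeff Γ c w.1 (baseVec l)),
        ∑ μ, ∑ j,
          (-(∑ i, (fderiv ℝ (ConnForm.coeff Γ c) w.1 (0, fibVec j) (baseVec l)) i *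
              momCoeff w.2 μ i)
            - (∑ ν, christoffel K c.base w.1.1 μ ν l * momCoeff w.2 ν j)
            + (∑ α, christoffel K c.base w.1.1 α α l) * momCoeff w.2 μ j) • momVec μ j)

/-- `Γ` is the connection on `Y → X` induced by `H`: it is the value at the zero section of `Π → Y`
of the momentum morphism of `H`, i.e. of the projection `J¹Π → J¹Y` of the jet fields associated
with `H`. -/
def IsInducedConnection (H : LegendreForm hπ (n + 1)) (Γ : ConnForm n m π) : Prop :=
  IsConnection Γ ∧
  ∀ (U : Set (LegendreBundle hπ)) (γ : LegendreJet hπ), IsOpen U → IsAssociatedJetFieldOn U γ H →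
    ∀ y : Y, legendreZero hπ y ∈ U →
      Γ y = (mfderiv (legendreI n m) 𝓘(ℝ, BaseModel n × FibModel m)
        (fun q : LegendreBundle hπ => q.proj) (legendreZero hπ y)).comp (γ (legendreZero hπ y))

/-- `∂^i_λ 𝓓 = 0` along the zero section of `Π → Y`, over `U`, for a density `D = 𝓓 ω`. -/
def HasCriticalZeroSectionOn (U : Set (LegendreBundle hπ)) (D : LegendreForm hπ (n + 1)) : Prop :=
  ∀ c : FibredChart n m π, ∀ z : BaseModel n × FibModel m, (z, 0) ∈ coordDomain hπ c U →
    ∀ (l : Fin (n + 1)) (i : Fin m),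
      fderiv ℝ (LegendreForm.omegaCoeff D c) (z, 0) (0, momVec l i) = 0

end LegendreForms

end

/-!
All of the statements come down to one coordinate identity. Write `V_λ` for the components
`∂_λ + γ^i_(λ) ∂_i + γ^μ_{iλ} ∂^i_μ` of a jet field. Then
`γ ⌋ Ω = dp^λ_i ∧ dy^i ∧ ω_λ + (γ^λ_{iλ} dy^i - γ^i_(λ) dp^λ_i) ∧ ω`
(`sum_curryLeft_multisymplecticComp`), where the first term does not depend on `γ`. Exterior
multiplication by `ω` kills exactly the multiples of the `dx^λ`, so `η ∧ ω` is determined by, and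
determines, the values of `η` on vertical vectors (`wedgeOne_omegaX_congr`,
`eq_of_wedgeOne_omegaX_eq`). Conversely every 1-form `η` agrees on vertical vectors with the one
built from a suitable jet field (`jetOfOneForm`). Hence a smooth form `H` is Hamiltonian if and only
if `dH = dp^λ_i ∧ dy^i ∧ ω_λ + η ∧ ω` locally, with a smooth `η`
(`IsHamiltonianForm.exists_extDeriv_eq`, `isHamiltonianForm_of_extDeriv_eq`). This shows at once that
densities may be subtracted, and that the forms `p^λ_i dy^i ∧ ω_λ - 𝓗 ω` are Hamiltonian.

If `H` and `H'` are Hamiltonian then `d(H - H') = η ∧ ω`. As this form is closed, `η` is closed along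
the fibres of `Π → X`, and a Poincaré lemma with parameters (`exists_vertical_potential`) produces a
function `f`, smooth in all coordinates, with the same vertical derivatives as `η`. Then
`d(f ω) = η ∧ ω`, so `H - H'` is `f ω` modulo closed forms (`IsHamiltonianForm.exists_density`).

The form `H_Γ` is `p^λ_i dy^i ∧ ω_λ - p^λ_i Γ^i_λ ω` in every chart because `θ^λ` transforms as a
vector on the base (`thetaComp_transition`); connections exist by a partition of unity
(`exists_isConnection`). With a symmetric `K` the terms of the lift of `Γ` that contain `K` cancel in
the trace `γ^λ_{iλ}`, and the remaining term is the fibre derivative of `p^λ_i Γ^i_λ`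
(`IsConnectionLift.isAssociatedJetFieldOn`); the symmetry of the coefficients of `K` is the vanishing
of its torsion on coordinate vector fields.

Finally the identity shows that `dH` determines the components `γ^i_(λ)` of every associated jet
field. Along the zero section these glue to the induced connection `Γ_H`
(`IsHamiltonianForm.exists_isInducedConnection`). Comparing the momentum derivatives of both sides of
`H = H_{Γ_H} - 𝓗̃ ω` gives `∂^i_λ 𝓗̃ = 0` there.
-/

noncomputable section

set_option maxSynthPendingDepth 4

/-! ### Exterior products on a normed space -/

section Wedge

open ContinuousAlternatingMap

variable {E : Type*} [NormedAddCommGroup E] [NormedSpace ℝ E] {r : ℕ}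

/-- The exterior product of a 1-form and an `r`-form on a normed space, as a bilinear map. -/
def wedgeL (E : Type*) [NormedAddCommGroup E] [NormedSpace ℝ E] (r : ℕ) :
    (E →L[ℝ] ℝ) →L[ℝ] (E [⋀^Fin r]→L[ℝ] ℝ) →L[ℝ] (E [⋀^Fin (r + 1)]→L[ℝ] ℝ) :=
  (ContinuousLinearMap.compL ℝ _ _ _ (alternatizeUncurryFinCLM ℝ E ℝ)).comp
    (ContinuousLinearMap.smulRightL ℝ E (E [⋀^Fin r]→L[ℝ] ℝ))

/-- The exterior product of a 1-form and an `r`-form on a normed space. -/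
def wedge (α : E →L[ℝ] ℝ) (β : E [⋀^Fin r]→L[ℝ] ℝ) : E [⋀^Fin (r + 1)]→L[ℝ] ℝ :=
  alternatizeUncurryFin (α.smulRight β)

theorem wedgeL_eq (α : E →L[ℝ] ℝ) (β : E [⋀^Fin r]→L[ℝ] ℝ) : wedgeL E r α β = wedge α β := rfl

theorem wedge_sub_left (α α' : E →L[ℝ] ℝ) (β : E [⋀^Fin r]→L[ℝ] ℝ) :
    wedge (α - α') β = wedge α β - wedge α' β := by
  simp only [← wedgeL_eq, _root_.map_sub, _root_.sub_apply]

theorem wedge_sum_left {ι : Type*} (s : Finset ι) (α : ι → E →L[ℝ] ℝ) (β : E [⋀^Fin r]→L[ℝ] ℝ) :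
    wedge (∑ i ∈ s, α i) β = ∑ i ∈ s, wedge (α i) β := by
  simp only [← wedgeL_eq, _root_.map_sum, _root_.sum_apply]

theorem wedge_smul_left (c : ℝ) (α : E →L[ℝ] ℝ) (β : E [⋀^Fin r]→L[ℝ] ℝ) :
    wedge (c • α) β = c • wedge α β := by
  simp only [← wedgeL_eq, _root_.map_smul, _root_.smul_apply]

theorem wedge_zero_right (α : E →L[ℝ] ℝ) : wedge α (0 : E [⋀^Fin r]→L[ℝ] ℝ) = 0 := by
  simp only [← wedgeL_eq, _root_.map_zero]

theorem wedge_smul_right (c : ℝ) (α : E →L[ℝ] ℝ) (β : E [⋀^Fin r]→L[ℝ] ℝ) :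
    wedge α (c • β) = c • wedge α β := by
  simp only [← wedgeL_eq, _root_.map_smul]

theorem wedge_sub_right (α : E →L[ℝ] ℝ) (β β' : E [⋀^Fin r]→L[ℝ] ℝ) :
    wedge α (β - β') = wedge α β - wedge α β' := by
  simp only [← wedgeL_eq, _root_.map_sub]

theorem wedge_apply (α : E →L[ℝ] ℝ) (β : E [⋀^Fin r]→L[ℝ] ℝ) (v : Fin (r + 1) → E) :
    wedge α β v = ∑ k : Fin (r + 1), (-1 : ℝ) ^ (k : ℕ) * (α (v k) * β (k.removeNth v)) := by
  rw [wedge, alternatizeUncurryFin_apply]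
  refine Finset.sum_congr rfl fun k _ => ?_
  simp

theorem wedge_compContinuousLinearMap (α : E →L[ℝ] ℝ) (β : E [⋀^Fin r]→L[ℝ] ℝ) (L : E →L[ℝ] E) :
    (wedge α β).compContinuousLinearMap L =
      wedge (α.comp L) (β.compContinuousLinearMap L) := by
  ext v
  simp only [compContinuousLinearMap_apply, wedge_apply]
  rfl

/-- Contraction with a vector is an antiderivation. -/
theorem curryLeft_wedge (α : E →L[ℝ] ℝ) (β : E [⋀^Fin (r + 1)]→L[ℝ] ℝ) (u : E) :
    (wedge α β).curryLeft u = α u • β - wedge α (β.curryLeft u) := by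
  ext v
  simp only [curryLeft_apply_apply, wedge_apply, ContinuousAlternatingMap.sub_apply,
    ContinuousAlternatingMap.smul_apply]
  rw [Fin.sum_univ_succ, sub_eq_add_neg, ← Finset.sum_neg_distrib]
  congr 1
  · simp [Matrix.vecCons, Fin.removeNth_zero]
  · refine Finset.sum_congr rfl fun k _ => ?_
    have h : k.succ.removeNth (Matrix.vecCons u v) = Matrix.vecCons u (k.removeNth v) := by
      funext j
      refine Fin.cases ?_ (fun j => ?_) j
      · simp [Fin.removeNth]
      · simp [Fin.removeNth]
    rw [h]
    simp [pow_succ]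

theorem wedge_wedge_comm (α α' : E →L[ℝ] ℝ) (β : E [⋀^Fin r]→L[ℝ] ℝ) :
    wedge α (wedge α' β) = -wedge α' (wedge α β) := by
  let B : E →L[ℝ] E →L[ℝ] E [⋀^Fin r]→L[ℝ] ℝ :=
    α.smulRight (α'.smulRight β) + α'.smulRight (α.smulRight β)
  have hB : ∀ x y, B x y = B y x := fun x y => by
    have h1 : ∀ x y, B x y = (α x * α' y + α' x * α y) • β := fun x y => by
      simp [B, smul_smul, add_smul]
    rw [h1, h1]
    congr 1
    ring
  have h := alternatizeUncurryFin_alternatizeUncurryFinCLM_comp_of_symmetric hB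
  have h2 : alternatizeUncurryFinCLM ℝ E ℝ ∘L B =
      α.smulRight (wedge α' β) + α'.smulRight (wedge α β) := by
    ext1 x
    simp [B, wedge]
  rw [h2, alternatizeUncurryFin_add] at h
  exact eq_neg_of_add_eq_zero_left h

theorem extDeriv_smul_const {g : E → ℝ} {x : E} (hg : DifferentiableAt ℝ g x)
    (β : E [⋀^Fin r]→L[ℝ] ℝ) :
    extDeriv (fun w => g w • β) x = wedge (fderiv ℝ g x) β := by
  rw [extDeriv, (hg.hasFDerivAt.smul_const β).fderiv, wedge]

theorem extDeriv_smul_form {g : E → ℝ} {β : E → E [⋀^Fin r]→L[ℝ] ℝ} {x : E}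
    (hg : DifferentiableAt ℝ g x) (hβ : DifferentiableAt ℝ β x) :
    extDeriv (fun w => g w • β w) x = wedge (fderiv ℝ g x) (β x) + g x • extDeriv β x := by
  rw [extDeriv, (hg.hasFDerivAt.fun_smul hβ.hasFDerivAt).fderiv, alternatizeUncurryFin_add,
    alternatizeUncurryFin_smul]
  exact add_comm (g x • extDeriv β x) _

theorem extDeriv_fun_sum {ι : Type*} {s : Finset ι} {β : ι → E → E [⋀^Fin r]→L[ℝ] ℝ} {x : E}
    (hβ : ∀ i ∈ s, DifferentiableAt ℝ (β i) x) :
    extDeriv (fun w => ∑ i ∈ s, β i w) x = ∑ i ∈ s, extDeriv (β i) x := by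
  simp only [extDeriv]
  rw [fderiv_fun_sum hβ, ← alternatizeUncurryFinCLM_apply, _root_.map_sum]
  rfl

theorem extDeriv_fun_sub {β β' : E → E [⋀^Fin r]→L[ℝ] ℝ} {x : E}
    (hβ : DifferentiableAt ℝ β x) (hβ' : DifferentiableAt ℝ β' x) :
    extDeriv (fun w => β w - β' w) x = extDeriv β x - extDeriv β' x := by
  simp only [extDeriv]
  rw [_root_.fderiv_fun_sub hβ hβ', ← alternatizeUncurryFinCLM_apply, _root_.map_sub]
  rfl

theorem map_finset_sum_curryLeft {ι : Type*} (s : Finset ι)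
    (β : ι → E [⋀^Fin (r + 1)]→L[ℝ] ℝ) (u : E) :
    (∑ i ∈ s, β i).curryLeft u = ∑ i ∈ s, (β i).curryLeft u := by
  ext v
  simp [ContinuousAlternatingMap.sum_apply]

theorem sum_compContinuousLinearMap {ι : Type*} (s : Finset ι)
    (β : ι → E [⋀^Fin r]→L[ℝ] ℝ) (L : E →L[ℝ] E) :
    (∑ i ∈ s, β i).compContinuousLinearMap L = ∑ i ∈ s, (β i).compContinuousLinearMap L := by
  ext v
  simp [ContinuousAlternatingMap.sum_apply]

end Wedge

/-! ### Exterior products with `ω` -/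

section ExteriorAlgebra

variable {n m r : ℕ}

theorem wedgeOne_eq_wedge (α : LegendreModel n m →L[ℝ] ℝ)
    (β : LegendreModel n m [⋀^Fin r]→L[ℝ] ℝ) : wedgeOne α β = wedge α β := rfl

theorem omegaX_apply (v : Fin (n + 1) → LegendreModel n m) :
    omegaX v = Matrix.det (Matrix.of fun a b => (v a).1.1 b) := rfl

theorem omegaX_partialX : omegaX (n := n) (m := m) partialX = 1 := by
  rw [omegaX_apply]
  convert Matrix.det_one (n := Fin (n + 1)) (R := ℝ)
  ext a b
  simp [partialX, Matrix.one_apply, PiLp.single_apply, eq_comm]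

theorem omegaX_congr {v v' : Fin (n + 1) → LegendreModel n m} (h : ∀ a, (v a).1.1 = (v' a).1.1) :
    omegaX v = omegaX v' := by
  simp [omegaX_apply, h]

theorem curryLeft_omegaX_congr {u u' : LegendreModel n m} (h : u.1.1 = u'.1.1) :
    omegaX.curryLeft u = omegaX.curryLeft u' := by
  ext v
  simp only [ContinuousAlternatingMap.curryLeft_apply_apply]
  refine omegaX_congr fun a => ?_
  refine Fin.cases ?_ (fun j => ?_) a
  · simpa using h
  · simp

theorem curryLeft_omegaX_of_vertical {u : LegendreModel n m} (h : u.1.1 = 0) :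
    omegaX.curryLeft u = 0 := by
  rw [curryLeft_omegaX_congr (u' := 0) h]
  simp

theorem omegaX_compContinuousLinearMap {L : LegendreModel n m →L[ℝ] LegendreModel n m}
    {J : BaseModel n →L[ℝ] BaseModel n} (h : ∀ w, (L w).1.1 = J w.1.1) :
    omegaX.compContinuousLinearMap L = J.det • omegaX := by
  ext v
  simp only [ContinuousAlternatingMap.compContinuousLinearMap_apply, omegaX_apply,
    ContinuousAlternatingMap.smul_apply, Function.comp_apply, h, smul_eq_mul]
  have hM : Matrix.of (fun a b => (J (v a).1.1) b) = Matrix.of (fun a b => (v a).1.1 b) *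
      (LinearMap.toMatrix (EuclideanSpace.basisFun (Fin (n + 1)) ℝ).toBasis
        (EuclideanSpace.basisFun (Fin (n + 1)) ℝ).toBasis (J : BaseModel n →ₗ[ℝ] BaseModel n)).transpose := by
    ext a b
    simp only [Matrix.of_apply, Matrix.mul_apply, Matrix.transpose_apply, LinearMap.toMatrix_apply]
    conv_lhs => rw [← (EuclideanSpace.basisFun (Fin (n + 1)) ℝ).sum_repr (v a).1.1]
    simp [_root_.map_sum]
  rw [hM, Matrix.det_mul, Matrix.det_transpose, LinearMap.det_toMatrix, mul_comm]

/-- `α ∧ ω` depends on the values of `α` on vertical vectors only: a form of degree `n + 2` in the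
`dx^λ` vanishes. -/
theorem wedgeOne_omegaX_eq_zero {α : LegendreModel n m →L[ℝ] ℝ}
    (h : ∀ u : LegendreModel n m, u.1.1 = 0 → α u = 0) : wedgeOne α omegaX = 0 := by
  let s : BaseModel n →ₗ[ℝ] LegendreModel n m :=
    (LinearMap.inl ℝ (BaseModel n × FibModel m) (MomModel n m)).comp
      (LinearMap.inl ℝ (BaseModel n) (FibModel m))
  have h1 : ∀ w : LegendreModel n m, α w = α (s w.1.1) := fun w => by
    rw [← sub_eq_zero, ← map_sub]
    exact h _ (by simp [s])
  ext v
  have h2 : wedgeOne α omegaX v = wedgeOne α omegaX fun a => s (v a).1.1 := by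
    simp only [wedgeOne_eq_wedge, wedge_apply]
    refine Finset.sum_congr rfl fun k _ => ?_
    rw [h1 (v k)]
    congr 2
  rw [h2]
  refine AlternatingMap.map_linearDependent (wedgeOne α omegaX).toAlternatingMap _ fun hli => ?_
  have h3 : LinearIndependent ℝ (fun a => (v a).1.1) := LinearIndependent.of_comp s hli
  have := h3.fintype_card_le_finrank
  simp at this

theorem wedgeOne_omegaX_congr {α α' : LegendreModel n m →L[ℝ] ℝ}
    (h : ∀ u : LegendreModel n m, u.1.1 = 0 → α u = α' u) :
    wedgeOne α omegaX = wedgeOne α' omegaX := by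
  have h1 : wedgeOne (α - α') omegaX = 0 :=
    wedgeOne_omegaX_eq_zero fun u hu => by rw [sub_apply, h u hu, sub_self]
  rw [wedgeOne_eq_wedge, wedge_sub_left] at h1
  exact sub_eq_zero.1 h1

/-- Modulo the `dx^λ`, a 1-form is determined by its exterior product with `ω`. -/
theorem eq_of_wedgeOne_omegaX_eq {α α' : LegendreModel n m →L[ℝ] ℝ}
    (h : wedgeOne α omegaX = wedgeOne α' omegaX) {u : LegendreModel n m} (hu : u.1.1 = 0) :
    α u = α' u := by
  have h1 : ∀ α : LegendreModel n m →L[ℝ] ℝ,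
      (wedgeOne α omegaX).curryLeft u partialX = α u := fun α => by
    rw [wedgeOne_eq_wedge, curryLeft_wedge, curryLeft_omegaX_of_vertical hu, wedge_zero_right, sub_zero,
      ContinuousAlternatingMap.smul_apply, omegaX_partialX, smul_eq_mul, mul_one]
  rw [← h1 α, h, h1]

end ExteriorAlgebra

/-! ### The canonical forms in coordinates -/

section CoordinateIdentities

variable {n m : ℕ}

theorem euclidean_sum_single {k : ℕ} (v : EuclideanSpace ℝ (Fin k)) :
    ∑ i, v i • EuclideanSpace.single i (1 : ℝ) = v := by
  simpa using (EuclideanSpace.basisFun (Fin k) ℝ).sum_repr v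

theorem mom_sum_momVec (p : MomModel n m) : ∑ l, ∑ i, momCoeff p l i • momVec l i = p := by
  refine ContinuousLinearMap.ext fun v => ?_
  conv_rhs => rw [← euclidean_sum_single v, map_sum]
  rw [Finset.sum_comm, sum_apply]
  refine Finset.sum_congr rfl fun i _ => ?_
  rw [map_smul, ← euclidean_sum_single (p (EuclideanSpace.single i 1)), sum_apply, Finset.smul_sum]
  refine Finset.sum_congr rfl fun l _ => ?_
  exact smul_comm (momCoeff p l i) (v i) (EuclideanSpace.single l (1 : ℝ))

theorem dY_apply (i : Fin m) (u : LegendreModel n m) : dY i u = u.1.2 i := rfl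

theorem dP_apply (l : Fin (n + 1)) (i : Fin m) (u : LegendreModel n m) :
    dP l i u = momCoeff u.2 l i := rfl

theorem momCoeff_momVec (l l' : Fin (n + 1)) (i i' : Fin m) :
    momCoeff (momVec l i) l' i' = if l' = l ∧ i' = i then 1 else 0 := by
  by_cases h : i' = i <;> by_cases h' : l' = l <;>
    simp [momCoeff, momVec, PiLp.single_apply, h, h']

theorem momCoeff_sum_momVec (a : Fin (n + 1) → Fin m → ℝ) (l : Fin (n + 1)) (i : Fin m) :
    momCoeff (∑ μ, ∑ j, a μ j • momVec μ j) l i = a l i := by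
  have h1 : ∀ p : MomModel n m, momCoeff p l i = (dP l i).comp
    (ContinuousLinearMap.inr ℝ (BaseModel n × FibModel m) (MomModel n m)) p := fun p => rfl
  have h2 : ∀ (a : ℝ) (p : MomModel n m), momCoeff (a • p) l i = a * momCoeff p l i :=
    fun _ _ => rfl
  rw [h1, map_sum, Finset.sum_eq_single l, map_sum, Finset.sum_eq_single i, ← h1, h2,
    momCoeff_momVec]
  · simp
  · intro j _ hj
    rw [← h1, h2, momCoeff_momVec, if_neg fun h => hj h.2.symm, mul_zero]
  · simp
  · intro μ _ hμ
    rw [map_sum]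
    refine Finset.sum_eq_zero fun j _ => ?_
    rw [← h1, h2, momCoeff_momVec, if_neg fun h => hμ h.1.symm, mul_zero]
  · simp

theorem momCoeff_zero (l : Fin (n + 1)) (i : Fin m) : momCoeff (0 : MomModel n m) l i = 0 := rfl

/-- The 1-form `a_λ p^λ_i dy^i` at the point with momentum `p`, for a covector `a` of the base. -/
def momOneForm (a : BaseModel n →L[ℝ] ℝ) (p : MomModel n m) : LegendreModel n m →L[ℝ] ℝ :=
  a.comp (p.comp ((ContinuousLinearMap.snd ℝ (BaseModel n) (FibModel m)).comp
    (ContinuousLinearMap.fst ℝ (BaseModel n × FibModel m) (MomModel n m))))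

theorem momOneForm_apply (a : BaseModel n →L[ℝ] ℝ) (p : MomModel n m) (u : LegendreModel n m) :
    momOneForm a p u = a (p u.1.2) := rfl

theorem thetaComp_eq (p : MomModel n m) (l : Fin (n + 1)) :
    thetaComp p l = -wedge (momOneForm (EuclideanSpace.proj l) p) omegaX := by
  have h : momOneForm (EuclideanSpace.proj l : BaseModel n →L[ℝ] ℝ) p =
      ∑ i, momCoeff p l i • dY i := by
    refine ContinuousLinearMap.ext fun u => ?_
    rw [momOneForm_apply, sum_apply]
    conv_lhs => rw [← euclidean_sum_single u.1.2, map_sum, map_sum]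
    refine Finset.sum_congr rfl fun i _ => ?_
    rw [map_smul, map_smul, smul_apply, dY_apply, smul_eq_mul, smul_eq_mul, mul_comm]
    rfl
  rw [thetaComp, h, wedge_sum_left]
  simp only [wedge_smul_left, wedgeOne_eq_wedge]

/-- The transformation law of the generalized Liouville form, in terms of the derivative `L` of a
change of canonical coordinates: `θ'^λ` pulls back to `(∂x'^λ/∂x^μ) θ^μ`. -/
theorem thetaComp_compContinuousLinearMap {L : LegendreModel n m →L[ℝ] LegendreModel n m}
    {J : BaseModel n →L[ℝ] BaseModel n} {F G : FibModel m →L[ℝ] FibModel m}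
    (hJ : ∀ w, (L w).1.1 = J w.1.1)
    (hG : ∀ w : LegendreModel n m, w.1.1 = 0 → (L w).1.2 = G w.1.2)
    (hFG : F.comp G = ContinuousLinearMap.id ℝ _) (hdet : J.det ≠ 0) (p : MomModel n m)
    (l : Fin (n + 1)) :
    (thetaComp (J.det⁻¹ • J.comp (p.comp F)) l).compContinuousLinearMap L =
      ∑ k, (J (baseVec k)) l • thetaComp p k := by
  have h1 : ∀ p : MomModel n m, ∑ k, (J (baseVec k)) l • thetaComp p k =
      -wedge (momOneForm ((EuclideanSpace.proj l).comp J) p) omegaX := fun p => by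
    have h2 : momOneForm ((EuclideanSpace.proj l : BaseModel n →L[ℝ] ℝ).comp J) p =
        ∑ k, (J (baseVec k)) l • momOneForm (EuclideanSpace.proj k) p := by
      refine ContinuousLinearMap.ext fun u => ?_
      rw [momOneForm_apply, sum_apply]
      conv_lhs => rw [← euclidean_sum_single (p u.1.2), map_sum]
      refine Finset.sum_congr rfl fun k _ => ?_
      rw [map_smul, smul_apply, momOneForm_apply, smul_eq_mul, smul_eq_mul, mul_comm]
      rfl
    rw [h2, wedge_sum_left, ← Finset.sum_neg_distrib]
    refine Finset.sum_congr rfl fun k _ => ?_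
    rw [thetaComp_eq, wedge_smul_left, smul_neg]
  have h0 : ∀ p : MomModel n m, (thetaComp p l).compContinuousLinearMap L =
      -(wedge (momOneForm (EuclideanSpace.proj l) p) omegaX).compContinuousLinearMap L :=
    fun p => by rw [thetaComp_eq]; rfl
  rw [h1, h0, wedge_compContinuousLinearMap, omegaX_compContinuousLinearMap hJ, wedge_smul_right,
    ← wedge_smul_left]
  congr 1
  refine wedgeOne_omegaX_congr fun u hu => ?_
  have h3 : F (G u.1.2) = u.1.2 := by
    rw [← ContinuousLinearMap.comp_apply, hFG]; rfl
  rw [smul_apply, ContinuousLinearMap.comp_apply, momOneForm_apply, hG u hu, momOneForm_apply]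
  simp only [smul_apply, ContinuousLinearMap.comp_apply, h3, map_smul, smul_eq_mul]
  rw [← mul_assoc, mul_inv_cancel₀ hdet, one_mul]

/-- The form `θ^λ` is semibasic over `Y`: momentum directions contract to zero. -/
theorem curryLeft_thetaComp_congr (p : MomModel n m) (l : Fin (n + 1)) {u u' : LegendreModel n m}
    (h : u.1 = u'.1) : (thetaComp p l).curryLeft u = (thetaComp p l).curryLeft u' := by
  have h1 : ∀ u, (thetaComp p l).curryLeft u =
      -(wedge (momOneForm (EuclideanSpace.proj l) p) omegaX).curryLeft u := fun u => by
    rw [thetaComp_eq]; rfl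
  rw [h1, h1, curryLeft_wedge, curryLeft_wedge, momOneForm_apply, momOneForm_apply,
    curryLeft_omegaX_congr (u' := u') (by rw [h]), h]

/-- For `V_λ = ∂_λ + Γ^i_λ ∂_i + …` the contraction of the Liouville form is
`p^λ_i dy^i ∧ ω_λ - p^λ_i Γ^i_λ ω`. -/
theorem sum_curryLeft_thetaComp (p : MomModel n m) (V : Fin (n + 1) → LegendreModel n m)
    (hV : ∀ l, (V l).1.1 = baseVec l) :
    ∑ l, (thetaComp p l).curryLeft (V l) =
      momentumForm p - (∑ l, ∑ i, momCoeff p l i * (V l).1.2 i) • omegaX := by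
  rw [momentumForm, Finset.sum_smul, ← Finset.sum_sub_distrib]
  refine Finset.sum_congr rfl fun l _ => ?_
  have h1 : (thetaComp p l).curryLeft (V l) =
      -(∑ i, momCoeff p l i • wedgeOne (dY i) omegaX).curryLeft (V l) := rfl
  rw [h1, map_finset_sum_curryLeft, Finset.sum_smul, ← Finset.sum_sub_distrib,
    ← Finset.sum_neg_distrib]
  refine Finset.sum_congr rfl fun i _ => ?_
  rw [ContinuousAlternatingMap.curryLeft_smul, smul_apply, wedgeOne_eq_wedge, curryLeft_wedge,
    curryLeft_omegaX_congr (u' := partialX l) (hV l), smul_sub, neg_sub, smul_smul]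
  rfl

/-- The constant part `dp^λ_i ∧ dy^i ∧ ω_λ` of `γ ⌋ Ω`. -/
def canonicalTwoPart (n m : ℕ) : LegendreModel n m [⋀^Fin (n + 2)]→L[ℝ] ℝ :=
  ∑ l, ∑ i, wedge (dP l i) (wedge (dY i) (omegaSub l))

/-- The 1-form `γ^λ_{iλ} dy^i - γ^i_(λ) dp^λ_i` built from the components of a jet field. -/
def contractionOneForm (V : Fin (n + 1) → LegendreModel n m) : LegendreModel n m →L[ℝ] ℝ :=
  ∑ l, ∑ i, (momCoeff (V l).2 l i • dY i - (V l).1.2 i • dP l i)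

/-- `γ ⌋ Ω = dp^λ_i ∧ dy^i ∧ ω_λ + (γ^λ_{iλ} dy^i - γ^i_(λ) dp^λ_i) ∧ ω`. -/
theorem sum_curryLeft_multisymplecticComp (V : Fin (n + 1) → LegendreModel n m)
    (hV : ∀ l, (V l).1.1 = baseVec l) :
    ∑ l, (multisymplecticComp l).curryLeft (V l) =
      canonicalTwoPart n m + wedge (contractionOneForm V) omegaX := by
  rw [canonicalTwoPart, contractionOneForm, wedge_sum_left, ← Finset.sum_add_distrib]
  refine Finset.sum_congr rfl fun l _ => ?_
  rw [wedge_sum_left, multisymplecticComp, map_finset_sum_curryLeft, ← Finset.sum_add_distrib]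
  refine Finset.sum_congr rfl fun i _ => ?_
  rw [wedgeOne_eq_wedge, wedgeOne_eq_wedge, curryLeft_wedge, curryLeft_wedge,
    curryLeft_omegaX_congr (u' := partialX l) (hV l), wedge_sub_left, wedge_smul_left,
    wedge_smul_left, wedge_sub_right, wedge_smul_right, ← omegaSub, dP_apply, dY_apply]
  abel

theorem contractionOneForm_fib (V : Fin (n + 1) → LegendreModel n m) (i : Fin m) :
    contractionOneForm V ((0, fibVec i), 0) = ∑ l, momCoeff (V l).2 l i := by
  simp only [contractionOneForm, sum_apply, sub_apply, smul_apply, dY_apply, dP_apply,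
    momCoeff_zero, smul_eq_mul, mul_zero, sub_zero, PiLp.single_apply]
  simp

theorem contractionOneForm_mom (V : Fin (n + 1) → LegendreModel n m) (l : Fin (n + 1))
    (i : Fin m) : contractionOneForm V (0, momVec l i) = -(V l).1.2 i := by
  simp only [contractionOneForm, sum_apply, sub_apply, smul_apply, dY_apply, dP_apply,
    smul_eq_mul, momCoeff_momVec]
  rw [Finset.sum_eq_single l, Finset.sum_eq_single i] <;> simp +contextual

/-- Two 1-forms agree on vertical vectors as soon as they agree on the vectors `∂_i` and
`∂^i_λ`. -/
theorem eq_on_vertical {α α' : LegendreModel n m →L[ℝ] ℝ}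
    (h1 : ∀ i, α ((0, fibVec i), 0) = α' ((0, fibVec i), 0))
    (h2 : ∀ l i, α (0, momVec l i) = α' (0, momVec l i)) {u : LegendreModel n m}
    (hu : u.1.1 = 0) : α u = α' u := by
  let Lf : FibModel m →ₗ[ℝ] LegendreModel n m :=
    (LinearMap.inl ℝ (BaseModel n × FibModel m) (MomModel n m)).comp
      (LinearMap.inr ℝ (BaseModel n) (FibModel m))
  let Lm : MomModel n m →ₗ[ℝ] LegendreModel n m :=
    LinearMap.inr ℝ (BaseModel n × FibModel m) (MomModel n m)
  have h : u = Lf u.1.2 + Lm u.2 := by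
    refine Prod.ext (Prod.ext ?_ ?_) ?_ <;> simp [Lf, Lm, hu]
  have hf : α (Lf u.1.2) = α' (Lf u.1.2) := by
    rw [← euclidean_sum_single u.1.2]
    simp only [map_sum, map_smul]
    exact Finset.sum_congr rfl fun i _ => congrArg _ (h1 i)
  have hm : α (Lm u.2) = α' (Lm u.2) := by
    rw [← mom_sum_momVec u.2]
    simp only [map_sum, map_smul]
    exact Finset.sum_congr rfl fun l _ => Finset.sum_congr rfl fun i _ => congrArg _ (h2 l i)
  rw [h, map_add, map_add, hf, hm]

theorem momentumForm_partialX (p : MomModel n m) : momentumForm p partialX = 0 := by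
  simp only [momentumForm, ContinuousAlternatingMap.sum_apply, ContinuousAlternatingMap.smul_apply,
    wedgeOne_eq_wedge, wedge_apply, dY_apply, partialX]
  simp

theorem hasFDerivAt_momCoeff (l : Fin (n + 1)) (i : Fin m) (w : LegendreModel n m) :
    HasFDerivAt (fun w : LegendreModel n m => momCoeff w.2 l i) (dP l i) w :=
  (dP l i).hasFDerivAt

theorem contDiff_momCoeff (l : Fin (n + 1)) (i : Fin m) :
    ContDiff ℝ ∞ (fun w : LegendreModel n m => momCoeff w.2 l i) :=
  (dP l i).contDiff

theorem contDiff_momentumForm :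
    ContDiff ℝ ∞ (fun w : LegendreModel n m => momentumForm w.2) :=
  ContDiff.sum fun l _ => ContDiff.sum fun i _ => (contDiff_momCoeff l i).smul contDiff_const

theorem extDeriv_momentumForm (w : LegendreModel n m) :
    extDeriv (fun w : LegendreModel n m => momentumForm w.2) w = canonicalTwoPart n m := by
  have hd : ∀ (l : Fin (n + 1)) (i : Fin m), DifferentiableAt ℝ
      (fun w : LegendreModel n m => momCoeff w.2 l i • wedgeOne (dY i) (omegaSub l)) w :=
    fun l i => (hasFDerivAt_momCoeff l i w).differentiableAt.smul_const _
  simp only [momentumForm]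
  rw [extDeriv_fun_sum fun l _ => DifferentiableAt.fun_sum fun i _ => hd l i, canonicalTwoPart]
  refine Finset.sum_congr rfl fun l _ => ?_
  rw [extDeriv_fun_sum fun i _ => hd l i]
  refine Finset.sum_congr rfl fun i _ => ?_
  rw [extDeriv_smul_const (hasFDerivAt_momCoeff l i w).differentiableAt,
    (hasFDerivAt_momCoeff l i w).fderiv]
  rfl

theorem extDeriv_splitForm {h : LegendreModel n m → ℝ} {w : LegendreModel n m}
    (hh : DifferentiableAt ℝ h w) :
    extDeriv (fun w : LegendreModel n m => momentumForm w.2 - h w • omegaX) w =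
      canonicalTwoPart n m - wedge (fderiv ℝ h w) omegaX := by
  rw [extDeriv_fun_sub (contDiff_momentumForm.contDiffAt.differentiableAt (by simp))
    (hh.smul_const _), extDeriv_momentumForm, extDeriv_smul_const hh]

theorem differentiableAt_thetaComp (l : Fin (n + 1)) (w : LegendreModel n m) :
    DifferentiableAt ℝ (fun w : LegendreModel n m => thetaComp w.2 l) w :=
  (DifferentiableAt.fun_sum fun i _ =>
    (hasFDerivAt_momCoeff l i w).differentiableAt.smul_const _).neg

/-- `dθ^λ = -Ω^λ`. -/
theorem extDeriv_thetaComp (l : Fin (n + 1)) (w : LegendreModel n m) :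
    extDeriv (fun w : LegendreModel n m => thetaComp w.2 l) w = -multisymplecticComp l := by
  have hd : ∀ i : Fin m, DifferentiableAt ℝ
      (fun w : LegendreModel n m => momCoeff w.2 l i • wedgeOne (n := n) (dY i) omegaX) w :=
    fun i => (hasFDerivAt_momCoeff l i w).differentiableAt.smul_const _
  have h1 : extDeriv (fun w : LegendreModel n m => thetaComp w.2 l) w =
      (-1 : ℝ) • extDeriv (fun w : LegendreModel n m =>
        ∑ i, momCoeff w.2 l i • wedgeOne (dY i) omegaX) w := by
    rw [← extDeriv_fun_smul]
    refine congrArg (fun f => extDeriv f w) (funext fun w => ?_)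
    rw [neg_smul, one_smul, thetaComp]
    rfl
  rw [h1, extDeriv_fun_sum fun i _ => hd i, multisymplecticComp, neg_smul, one_smul]
  congr 1
  refine Finset.sum_congr rfl fun i _ => ?_
  rw [extDeriv_smul_const (hasFDerivAt_momCoeff l i w).differentiableAt,
    (hasFDerivAt_momCoeff l i w).fderiv]
  rfl

/-- Functions of the base coordinates can be pulled out of the exterior derivative of `θ^λ`,
because `dx^μ ∧ θ^λ = 0`. -/
theorem extDeriv_smul_thetaComp {g : LegendreModel n m → ℝ} {w : LegendreModel n m}
    (hg : DifferentiableAt ℝ g w) (hv : ∀ u : LegendreModel n m, u.1.1 = 0 → fderiv ℝ g w u = 0)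
    (l : Fin (n + 1)) :
    extDeriv (fun w : LegendreModel n m => g w • thetaComp w.2 l) w =
      -(g w • multisymplecticComp l) := by
  have h0 : wedge (fderiv ℝ g w) (thetaComp w.2 l) = 0 := by
    have h1 : thetaComp w.2 l =
        (-1 : ℝ) • wedge (momOneForm (EuclideanSpace.proj l) w.2) omegaX := by
      rw [thetaComp_eq, neg_smul, one_smul]
    have h2 : wedge (fderiv ℝ g w) (omegaX (n := n) (m := m)) = 0 := wedgeOne_omegaX_eq_zero hv
    rw [h1, wedge_smul_right, wedge_wedge_comm, h2, wedge_zero_right, neg_zero, smul_zero]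
  rw [extDeriv_smul_form hg (differentiableAt_thetaComp l w), h0, extDeriv_thetaComp, zero_add,
    smul_neg]

end CoordinateIdentities

/-! ### Canonical charts and their transitions -/

section CanonicalCharts

variable {n m : ℕ} {X Y : Type*}
  [TopologicalSpace X] [ChartedSpace (BaseModel n) X]
  [TopologicalSpace Y] [ChartedSpace (BaseModel n × FibModel m) Y]
  {π : Y → X}

theorem mdifferentiable_of_mem_maximalAtlas {H M : Type*} [NormedAddCommGroup H]
    [NormedSpace ℝ H] [TopologicalSpace M] [ChartedSpace H M] {e : OpenPartialHomeomorph M H}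
    (he : e ∈ IsManifold.maximalAtlas 𝓘(ℝ, H) ∞ M) :
    e.MDifferentiable 𝓘(ℝ, H) 𝓘(ℝ, H) :=
  ⟨(contMDiffOn_of_mem_maximalAtlas he).mdifferentiableOn (by simp),
    (contMDiffOn_symm_of_mem_maximalAtlas he).mdifferentiableOn (by simp)⟩

variable (hπ : IsFibredManifold n m π) (c c' : FibredChart n m π)

theorem mem_canonicalChart_source (q : LegendreBundle hπ) :
    q ∈ (canonicalChart hπ c).source ↔ q.proj ∈ c.total.source := by
  simp only [canonicalChart, OpenPartialHomeomorph.trans_source, mem_inter_iff, mem_preimage,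
    OpenPartialHomeomorph.prod_source, OpenPartialHomeomorph.refl_source, mem_prod, mem_univ,
    and_true]
  exact and_iff_left_of_imp fun h => h

theorem mem_canonicalChart_target (w : LegendreModel n m) :
    w ∈ (canonicalChart hπ c).target ↔ w.1 ∈ c.total.target := by
  simp only [canonicalChart, OpenPartialHomeomorph.trans_target, mem_inter_iff, mem_preimage,
    OpenPartialHomeomorph.prod_target, OpenPartialHomeomorph.refl_target, mem_prod, mem_univ,
    and_true]
  exact and_iff_left_of_imp fun h => ⟨c.total.map_target h, trivial⟩

theorem canonicalChart_apply_fst (q : LegendreBundle hπ) :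
    (canonicalChart hπ c q).1 = c.total q.proj := rfl

theorem canonicalChart_symm_zero (z : BaseModel n × FibModel m) :
    (canonicalChart hπ c).symm (z, 0) = legendreZero hπ (c.total.symm z) := by
  have h : ∀ A : MomModel n m →L[ℝ] MomModel n m, A 0 = 0 := fun A => map_zero A
  exact congrArg (Bundle.TotalSpace.mk (c.total.symm z)) (h _)

/-- The change of canonical coordinates from `c` to `c'`. -/
def transition (w : LegendreModel n m) : LegendreModel n m :=
  canonicalChart hπ c' ((canonicalChart hπ c).symm w)

/-- The domain of the change of canonical coordinates from `c` to `c'`. -/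
def overlap : Set (LegendreModel n m) :=
  (canonicalChart hπ c).target ∩ (canonicalChart hπ c).symm ⁻¹' (canonicalChart hπ c').source

theorem isOpen_coordDomain {U : Set (LegendreBundle hπ)} (hU : IsOpen U) :
    IsOpen (coordDomain hπ c U) :=
  (canonicalChart hπ c).isOpen_inter_preimage_symm hU

theorem isOpen_overlap : IsOpen (overlap hπ c c') :=
  isOpen_coordDomain hπ c (canonicalChart hπ c').open_source

variable {hπ c c'}

theorem mem_overlap {w : LegendreModel n m} (hw : w ∈ overlap hπ c c') :
    w.1 ∈ c.total.target ∧ c.total.symm w.1 ∈ c.total.source ∧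
      c.total.symm w.1 ∈ c'.total.source :=
  ⟨(mem_canonicalChart_target hπ c w).1 hw.1,
    c.total.map_target ((mem_canonicalChart_target hπ c w).1 hw.1),
    (mem_canonicalChart_source hπ c' _).1 hw.2⟩

theorem transition_symm {w : LegendreModel n m} (hw : w ∈ overlap hπ c c') :
    (canonicalChart hπ c').symm (transition hπ c c' w) = (canonicalChart hπ c).symm w :=
  (canonicalChart hπ c').left_inv hw.2

theorem transition_mem_overlap {w : LegendreModel n m} (hw : w ∈ overlap hπ c c') :
    transition hπ c c' w ∈ overlap hπ c' c :=
  ⟨(canonicalChart hπ c').map_source hw.2, by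
    rw [mem_preimage, transition_symm hw]; exact (canonicalChart hπ c).map_target hw.1⟩

theorem transition_transition {w : LegendreModel n m} (hw : w ∈ overlap hπ c c') :
    transition hπ c' c (transition hπ c c' w) = w := by
  rw [transition, transition_symm hw]
  exact (canonicalChart hπ c).right_inv hw.1

theorem mem_coordDomain_iff {U : Set (LegendreBundle hπ)} {w : LegendreModel n m}
    (hw : w ∈ overlap hπ c c') :
    transition hπ c c' w ∈ coordDomain hπ c' U ↔ w ∈ coordDomain hπ c U := by
  simp only [coordDomain, mem_inter_iff, mem_preimage, transition_symm hw,
    (transition_mem_overlap hw).1, hw.1]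

theorem transition_fst (w : LegendreModel n m) :
    (transition hπ c c' w).1 = c'.total (c.total.symm w.1) := rfl

theorem transition_snd {w : LegendreModel n m} (hw : w ∈ overlap hπ c c') :
    (transition hπ c c' w).2 = FibredChart.momChange c c' (c.total.symm w.1) w.2 := by
  obtain ⟨-, h2, h3⟩ := mem_overlap hw
  exact (legendreCore hπ).coordChange_comp c ((legendreCore hπ).indexAt (c.total.symm w.1)) c'
    (c.total.symm w.1) ⟨⟨h2, (legendreCore hπ).mem_baseSet_at _⟩, h3⟩ w.2

/-- The base components of a change of fibred coordinates depend on the base coordinates only. -/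
theorem jac_total_fst {y : Y} (hy : y ∈ c.total.source) (hy' : y ∈ c'.total.source)
    (u : BaseModel n × FibModel m) :
    (jac c.total c'.total y u).1 = FibredChart.baseJac c c' y u.1 := by
  have h1 := differentiableAt_transition c.total_mem c'.total_mem hy hy'
  have hb := differentiableAt_transition c.base_mem c'.base_mem (c.mapsTo y hy) (c'.mapsTo y hy')
  have h2 : (fun z => (c'.total (c.total.symm z)).1) =ᶠ[𝓝 (c.total y)]
      (fun z : BaseModel n × FibModel m => c'.base (c.base.symm z.1)) := by
    have : (c.total.symm ≫ₕ c'.total).source ∈ 𝓝 (c.total y) :=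
      (c.total.symm ≫ₕ c'.total).open_source.mem_nhds (by simp [hy, hy', c.total.map_source hy])
    filter_upwards [this] with z hz
    simp only [OpenPartialHomeomorph.trans_source, mem_inter_iff, mem_preimage,
      OpenPartialHomeomorph.symm_source] at hz
    have hs := c.total.map_target hz.1
    have e1 : c.base (π (c.total.symm z)) = z.1 := by
      rw [← c.fst_eq _ hs, c.total.right_inv hz.1]
    rw [c'.fst_eq _ hz.2, ← e1, c.base.left_inv (c.mapsTo _ hs)]
  rw [← c.fst_eq y hy] at hb
  have e1 := h1.hasFDerivAt.fst.congr_of_eventuallyEq h2.symm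
  have e2 : HasFDerivAt (fun z : BaseModel n × FibModel m => c'.base (c.base.symm z.1))
      ((fderiv ℝ (fun x => c'.base (c.base.symm x)) (c.total y).1).comp
        (ContinuousLinearMap.fst ℝ _ _)) (c.total y) :=
    hb.hasFDerivAt.comp (c.total y) hasFDerivAt_fst
  have := congrArg (fun A => A u) (e1.unique e2)
  simpa [jac, FibredChart.baseJac, c.fst_eq y hy] using this

section

variable (hπ c)

theorem contMDiffOn_canonicalChart :
    ContMDiffOn (legendreI n m) 𝓘(ℝ, LegendreModel n m) ∞ (canonicalChart hπ c)
      (canonicalChart hπ c).source := by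
  have : MemTrivializationAtlas ((legendreCore hπ).localTriv c) := ⟨⟨c, rfl⟩⟩
  have h1 := ((legendreCore hπ).localTriv c).contMDiffOn
    (IB := 𝓘(ℝ, BaseModel n × FibModel m)) (n := ∞)
  have h2 := contMDiffOn_of_mem_maximalAtlas c.total_mem
  have h3 : ContMDiffOn (legendreI n m) 𝓘(ℝ, BaseModel n × FibModel m) ∞
      (fun q : LegendreBundle hπ => c.total q.proj) (canonicalChart hπ c).source :=
    h2.comp (Bundle.contMDiff_proj _).contMDiffOn fun q hq => (mem_canonicalChart_source hπ c q).1 hq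
  have h4 : ContMDiffOn (legendreI n m) 𝓘(ℝ, MomModel n m) ∞
      (fun q : LegendreBundle hπ => ((legendreCore hπ).localTriv c q).2)
      (canonicalChart hπ c).source :=
    (contMDiff_snd.comp_contMDiffOn h1).mono fun q hq => (mem_canonicalChart_source hπ c q).1 hq
  exact h3.prodMk_space h4

theorem contMDiffOn_canonicalChart_symm :
    ContMDiffOn 𝓘(ℝ, LegendreModel n m) (legendreI n m) ∞ (canonicalChart hπ c).symm
      (canonicalChart hπ c).target := by
  have : MemTrivializationAtlas ((legendreCore hπ).localTriv c) := ⟨⟨c, rfl⟩⟩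
  have h1 := ((legendreCore hπ).localTriv c).contMDiffOn_symm
    (IB := 𝓘(ℝ, BaseModel n × FibModel m)) (n := ∞)
  have h2 := contMDiffOn_symm_of_mem_maximalAtlas c.total_mem
  have h3 : ContMDiffOn 𝓘(ℝ, LegendreModel n m) 𝓘(ℝ, BaseModel n × FibModel m) ∞
      (fun w : LegendreModel n m => c.total.symm w.1) (canonicalChart hπ c).target :=
    h2.comp contDiff_fst.contMDiff.contMDiffOn fun w hw => (mem_canonicalChart_target hπ c w).1 hw
  have h4 : ContMDiffOn 𝓘(ℝ, LegendreModel n m) (legendreI n m) ∞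
      (fun w : LegendreModel n m => (c.total.symm w.1, w.2)) (canonicalChart hπ c).target :=
    h3.prodMk (contDiff_snd.contMDiff.contMDiffOn)
  refine h1.comp h4 fun w hw => ?_
  rw [mem_preimage, VectorBundleCore.mem_localTriv_target]
  exact c.total.map_target ((mem_canonicalChart_target hπ c w).1 hw)

theorem mdifferentiable_canonicalChart :
    (canonicalChart hπ c).MDifferentiable (legendreI n m) 𝓘(ℝ, LegendreModel n m) :=
  ⟨(contMDiffOn_canonicalChart hπ c).mdifferentiableOn (by simp),
    (contMDiffOn_canonicalChart_symm hπ c).mdifferentiableOn (by simp)⟩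

end

variable (hπ c c') in
theorem contDiffOn_legendreTransition :
    ContDiffOn ℝ ∞ (transition hπ c c') (overlap hπ c c') := by
  rw [← contMDiffOn_iff_contDiffOn]
  exact (contMDiffOn_canonicalChart hπ c').comp
    ((contMDiffOn_canonicalChart_symm hπ c).mono inter_subset_left) fun w hw => hw.2

theorem contDiffAt_legendreTransition {w : LegendreModel n m} (hw : w ∈ overlap hπ c c') :
    ContDiffAt ℝ ∞ (transition hπ c c') w :=
  (contDiffOn_legendreTransition hπ c c').contDiffAt ((isOpen_overlap hπ c c').mem_nhds hw)

theorem hasFDerivAt_legendreTransition {w : LegendreModel n m} (hw : w ∈ overlap hπ c c') :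
    HasFDerivAt (transition hπ c c') (fderiv ℝ (transition hπ c c') w) w :=
  ((contDiffAt_legendreTransition hw).differentiableAt (by simp)).hasFDerivAt

theorem fderiv_transition_fst {w : LegendreModel n m} (hw : w ∈ overlap hπ c c')
    (u : LegendreModel n m) :
    (fderiv ℝ (transition hπ c c') w u).1 = jac c.total c'.total (c.total.symm w.1) u.1 := by
  obtain ⟨h1, h2, h3⟩ := mem_overlap hw
  have hd := differentiableAt_transition c.total_mem c'.total_mem h2 h3
  rw [c.total.right_inv h1] at hd
  have e1 : HasFDerivAt (fun w => (transition hπ c c' w).1)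
      ((ContinuousLinearMap.fst ℝ _ _).comp (fderiv ℝ (transition hπ c c') w)) w :=
    (hasFDerivAt_legendreTransition hw).fst
  have e2 : HasFDerivAt (fun w : LegendreModel n m => c'.total (c.total.symm w.1))
      ((fderiv ℝ (fun z => c'.total (c.total.symm z)) w.1).comp (ContinuousLinearMap.fst ℝ _ _)) w :=
    hd.hasFDerivAt.comp w hasFDerivAt_fst
  have := congrArg (fun A => A u) (e1.unique e2)
  simpa [jac, c.total.right_inv h1] using this

theorem fderiv_transition_base {w : LegendreModel n m} (hw : w ∈ overlap hπ c c')
    (u : LegendreModel n m) :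
    (fderiv ℝ (transition hπ c c') w u).1.1 =
      FibredChart.baseJac c c' (c.total.symm w.1) u.1.1 := by
  rw [fderiv_transition_fst hw, jac_total_fst (mem_overlap hw).2.1 (mem_overlap hw).2.2]

theorem fderiv_transition_fib {w : LegendreModel n m} (hw : w ∈ overlap hπ c c')
    {u : LegendreModel n m} (hu : u.1.1 = 0) :
    (fderiv ℝ (transition hπ c c') w u).1.2 =
      FibredChart.fibJac c' c (c.total.symm w.1) u.1.2 := by
  rw [fderiv_transition_fst hw]
  have : u.1 = (0, u.1.2) := Prod.ext hu rfl
  rw [this]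
  rfl

end CanonicalCharts

/-! ### Tangent maps of charts and transformation laws -/

section Charts

variable {E HM H M : Type*} [NormedAddCommGroup E] [NormedSpace ℝ E] [TopologicalSpace HM]
  {I : ModelWithCorners ℝ E HM} [NormedAddCommGroup H] [NormedSpace ℝ H]
  [TopologicalSpace M] [ChartedSpace HM M] {e e' : OpenPartialHomeomorph M H}

theorem fderiv_transition_eq (he : e.MDifferentiable I 𝓘(ℝ, H))
    (he' : e'.MDifferentiable I 𝓘(ℝ, H)) {z : H} (hz : z ∈ e.target) (hz' : e.symm z ∈ e'.source) :
    fderiv ℝ (fun z => e' (e.symm z)) z =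
      (mfderiv I 𝓘(ℝ, H) e' (e.symm z)).comp (mfderiv 𝓘(ℝ, H) I e.symm z) := by
  rw [← mfderiv_eq_fderiv]
  exact mfderiv_comp z (he'.mdifferentiableAt hz') (he.mdifferentiableAt_symm hz)

theorem mfderiv_symm_comp_mfderiv (he : e.MDifferentiable I 𝓘(ℝ, H)) {x : M} (hx : x ∈ e.source) :
    (mfderiv 𝓘(ℝ, H) I e.symm (e x)).comp (mfderiv I 𝓘(ℝ, H) e x) = ContinuousLinearMap.id ℝ E :=
  he.symm_comp_deriv hx

theorem mfderiv_comp_mfderiv_symm (he : e.MDifferentiable I 𝓘(ℝ, H)) {z : H} (hz : z ∈ e.target) :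
    (mfderiv I 𝓘(ℝ, H) e (e.symm z)).comp (mfderiv 𝓘(ℝ, H) I e.symm z) =
      ContinuousLinearMap.id ℝ H :=
  he.comp_symm_deriv hz

end Charts

section Transformation

variable {n m : ℕ} {X Y : Type*}
  [TopologicalSpace X] [ChartedSpace (BaseModel n) X]
  [TopologicalSpace Y] [ChartedSpace (BaseModel n × FibModel m) Y]
  {π : Y → X} {hπ : IsFibredManifold n m π} {c c' : FibredChart n m π}

theorem FibredChart.base_proj_symm (c : FibredChart n m π) {z : BaseModel n × FibModel m}
    (hz : z ∈ c.total.target) : c.base (π (c.total.symm z)) = z.1 := by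
  rw [← c.fst_eq _ (c.total.map_target hz), c.total.right_inv hz]

/-- The tangent map of the base coordinates of `c`. -/
def baseD (c : FibredChart n m π) (x : X) : BaseModel n →L[ℝ] BaseModel n :=
  mfderiv 𝓘(ℝ, BaseModel n) 𝓘(ℝ, BaseModel n) c.base x

/-- The tangent map of the inverse of the base coordinates of `c`. -/
def baseDSymm (c : FibredChart n m π) (x : BaseModel n) : BaseModel n →L[ℝ] BaseModel n :=
  mfderiv 𝓘(ℝ, BaseModel n) 𝓘(ℝ, BaseModel n) c.base.symm x

/-- The tangent map of the fibred coordinates of `c`. -/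
def totalD (c : FibredChart n m π) (y : Y) : BaseModel n × FibModel m →L[ℝ] BaseModel n × FibModel m :=
  mfderiv 𝓘(ℝ, BaseModel n × FibModel m) 𝓘(ℝ, BaseModel n × FibModel m) c.total y

/-- The tangent map of the inverse of the fibred coordinates of `c`. -/
def totalDSymm (c : FibredChart n m π) (z : BaseModel n × FibModel m) :
    BaseModel n × FibModel m →L[ℝ] BaseModel n × FibModel m :=
  mfderiv 𝓘(ℝ, BaseModel n × FibModel m) 𝓘(ℝ, BaseModel n × FibModel m) c.total.symm z

theorem baseD_comp_baseDSymm {x : BaseModel n} (hx : x ∈ c.base.target) :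
    (baseD c (c.base.symm x)).comp (baseDSymm c x) = ContinuousLinearMap.id ℝ _ :=
  mfderiv_comp_mfderiv_symm (mdifferentiable_of_mem_maximalAtlas c.base_mem) hx

theorem baseDSymm_comp_baseD {x : X} (hx : x ∈ c.base.source) :
    (baseDSymm c (c.base x)).comp (baseD c x) = ContinuousLinearMap.id ℝ _ :=
  mfderiv_symm_comp_mfderiv (mdifferentiable_of_mem_maximalAtlas c.base_mem) hx

theorem totalD_comp_totalDSymm {z : BaseModel n × FibModel m} (hz : z ∈ c.total.target) :
    (totalD c (c.total.symm z)).comp (totalDSymm c z) = ContinuousLinearMap.id ℝ _ :=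
  mfderiv_comp_mfderiv_symm (mdifferentiable_of_mem_maximalAtlas c.total_mem) hz

theorem totalDSymm_comp_totalD {y : Y} (hy : y ∈ c.total.source) :
    (totalDSymm c (c.total y)).comp (totalD c y) = ContinuousLinearMap.id ℝ _ :=
  mfderiv_symm_comp_mfderiv (mdifferentiable_of_mem_maximalAtlas c.total_mem) hy

theorem baseJac_eq {y : Y} (hy : y ∈ c.total.source) (hy' : y ∈ c'.total.source) :
    FibredChart.baseJac c c' y = (baseD c' (π y)).comp (baseDSymm c (c.base (π y))) := by
  have h := c.mapsTo y hy
  have h' : c.base.symm (c.base (π y)) ∈ c'.base.source := by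
    rw [c.base.left_inv h]; exact c'.mapsTo y hy'
  have h1 : FibredChart.baseJac c c' y =
      (baseD c' (c.base.symm (c.base (π y)))).comp (baseDSymm c (c.base (π y))) :=
    fderiv_transition_eq (mdifferentiable_of_mem_maximalAtlas c.base_mem)
      (mdifferentiable_of_mem_maximalAtlas c'.base_mem) (c.base.map_source h) h'
  rw [h1, c.base.left_inv h]

theorem jac_total_eq {y : Y} (hy : y ∈ c.total.source) (hy' : y ∈ c'.total.source) :
    jac c.total c'.total y = (totalD c' y).comp (totalDSymm c (c.total y)) := by
  have h' : c.total.symm (c.total y) ∈ c'.total.source := by rwa [c.total.left_inv hy]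
  have h1 : jac c.total c'.total y =
      (totalD c' (c.total.symm (c.total y))).comp (totalDSymm c (c.total y)) :=
    fderiv_transition_eq (mdifferentiable_of_mem_maximalAtlas c.total_mem)
      (mdifferentiable_of_mem_maximalAtlas c'.total_mem) (c.total.map_source hy) h'
  rw [h1, c.total.left_inv hy]

theorem baseDSymm_comp_baseJac {y : Y} (hy : y ∈ c.total.source) (hy' : y ∈ c'.total.source) :
    (baseDSymm c (c.base (π y))).comp (FibredChart.baseJac c' c y) =
      baseDSymm c' (c'.base (π y)) := by
  rw [baseJac_eq hy' hy, ← ContinuousLinearMap.comp_assoc, baseDSymm_comp_baseD (c.mapsTo y hy),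
    ContinuousLinearMap.id_comp]

/-- The tangent map of the canonical coordinates of `c`. -/
def chartD (hπ : IsFibredManifold n m π) (c : FibredChart n m π) (q : LegendreBundle hπ) :
    LegendreModel n m →L[ℝ] LegendreModel n m :=
  mfderiv (legendreI n m) 𝓘(ℝ, LegendreModel n m) (canonicalChart hπ c) q

/-- The tangent map of the inverse of the canonical coordinates of `c`. -/
def chartDSymm (hπ : IsFibredManifold n m π) (c : FibredChart n m π) (w : LegendreModel n m) :
    LegendreModel n m →L[ℝ] LegendreModel n m :=
  mfderiv 𝓘(ℝ, LegendreModel n m) (legendreI n m) (canonicalChart hπ c).symm w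

theorem chartD_comp_chartDSymm {w : LegendreModel n m} (hw : w ∈ (canonicalChart hπ c).target) :
    (chartD hπ c ((canonicalChart hπ c).symm w)).comp (chartDSymm hπ c w) =
      ContinuousLinearMap.id ℝ _ :=
  mfderiv_comp_mfderiv_symm (mdifferentiable_canonicalChart hπ c) hw

theorem chartDSymm_comp_chartD {q : LegendreBundle hπ} (hq : q ∈ (canonicalChart hπ c).source) :
    (chartDSymm hπ c (canonicalChart hπ c q)).comp (chartD hπ c q) = ContinuousLinearMap.id ℝ _ :=
  mfderiv_symm_comp_mfderiv (mdifferentiable_canonicalChart hπ c) hq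

theorem fderiv_transition_eq_comp {w : LegendreModel n m} (hw : w ∈ overlap hπ c c') :
    fderiv ℝ (transition hπ c c') w =
      (chartD hπ c' ((canonicalChart hπ c).symm w)).comp (chartDSymm hπ c w) :=
  fderiv_transition_eq (mdifferentiable_canonicalChart hπ c)
    (mdifferentiable_canonicalChart hπ c') hw.1 hw.2

theorem chartDSymm_comp_fderiv_transition {w : LegendreModel n m} (hw : w ∈ overlap hπ c c') :
    (chartDSymm hπ c' (transition hπ c c' w)).comp (fderiv ℝ (transition hπ c c') w) =
      chartDSymm hπ c w := by
  have h : (chartDSymm hπ c' (transition hπ c c' w)).comp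
      (chartD hπ c' ((canonicalChart hπ c).symm w)) = ContinuousLinearMap.id ℝ _ :=
    chartDSymm_comp_chartD hw.2
  rw [fderiv_transition_eq_comp hw, ← ContinuousLinearMap.comp_assoc, h,
    ContinuousLinearMap.id_comp]

/-- The value of a form at a point, in the model space. -/
def LegendreForm.val {r : ℕ} (H : LegendreForm hπ r) (q : LegendreBundle hπ) :
    LegendreModel n m [⋀^Fin r]→L[ℝ] ℝ := H q

theorem LegendreForm.rep_eq {r : ℕ} (H : LegendreForm hπ r) (c : FibredChart n m π)
    (w : LegendreModel n m) : LegendreForm.rep H c w =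
      (LegendreForm.val H ((canonicalChart hπ c).symm w)).compContinuousLinearMap
        (chartDSymm hπ c w) := rfl

theorem ContinuousAlternatingMap.comp_comp {E : Type*} [NormedAddCommGroup E] [NormedSpace ℝ E]
    {r : ℕ} (β : E [⋀^Fin r]→L[ℝ] ℝ) (L L' : E →L[ℝ] E) :
    (β.compContinuousLinearMap L).compContinuousLinearMap L' =
      β.compContinuousLinearMap (L.comp L') := rfl

/-- The transformation law of the coordinate expressions of a form. -/
theorem LegendreForm.rep_transition {r : ℕ} (H : LegendreForm hπ r) {w : LegendreModel n m}
    (hw : w ∈ overlap hπ c c') :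
    LegendreForm.rep H c w = (LegendreForm.rep H c' (transition hπ c c' w)).compContinuousLinearMap
      (fderiv ℝ (transition hπ c c') w) := by
  rw [LegendreForm.rep_eq, LegendreForm.rep_eq, transition_symm hw,
    ContinuousAlternatingMap.comp_comp, chartDSymm_comp_fderiv_transition hw]

/-- The value of a jet field at a point, in the model spaces. -/
def LegendreJet.val (γ : LegendreJet hπ) (q : LegendreBundle hπ) :
    BaseModel n →L[ℝ] LegendreModel n m := γ q

/-- The coordinate expression of a jet field as a linear map: it takes `e_λ` to `γ_λ`. -/
def LegendreJet.vecL (γ : LegendreJet hπ) (c : FibredChart n m π) (w : LegendreModel n m) :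
    BaseModel n →L[ℝ] LegendreModel n m :=
  (chartD hπ c ((canonicalChart hπ c).symm w)).comp
    ((LegendreJet.val γ ((canonicalChart hπ c).symm w)).comp (baseDSymm c w.1.1))

theorem LegendreJet.vec_eq (γ : LegendreJet hπ) (c : FibredChart n m π) (w : LegendreModel n m)
    (l : Fin (n + 1)) : LegendreJet.vec γ c w l = LegendreJet.vecL γ c w (baseVec l) := rfl

theorem comp_id_cancel {E₁ E₂ E₃ : Type*} [NormedAddCommGroup E₁] [NormedSpace ℝ E₁]
    [NormedAddCommGroup E₂] [NormedSpace ℝ E₂] [NormedAddCommGroup E₃] [NormedSpace ℝ E₃]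
    {A : E₂ →L[ℝ] E₁} {B : E₁ →L[ℝ] E₂} (h : A.comp B = ContinuousLinearMap.id ℝ E₁)
    (C : E₃ →L[ℝ] E₁) : A.comp (B.comp C) = C := by
  rw [← ContinuousLinearMap.comp_assoc, h, ContinuousLinearMap.id_comp]

/-- The transformation law of the components of a jet field. -/
theorem LegendreJet.vecL_transition (γ : LegendreJet hπ) {w : LegendreModel n m}
    (hw : w ∈ overlap hπ c c') :
    LegendreJet.vecL γ c' (transition hπ c c' w) =
      (fderiv ℝ (transition hπ c c') w).comp ((LegendreJet.vecL γ c w).comp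
        (FibredChart.baseJac c' c (c.total.symm w.1))) := by
  obtain ⟨h1, h2, h3⟩ := mem_overlap hw
  have e1 : w.1.1 = c.base (π (c.total.symm w.1)) := (c.base_proj_symm h1).symm
  have e2 : (transition hπ c c' w).1.1 = c'.base (π (c.total.symm w.1)) := by
    rw [transition_fst, c'.fst_eq _ h3]
  have e4 := chartDSymm_comp_chartD (c := c)
    (q := (canonicalChart hπ c).symm w) ((canonicalChart hπ c).map_target hw.1)
  rw [(canonicalChart hπ c).right_inv hw.1] at e4
  rw [fderiv_transition_eq_comp hw, LegendreJet.vecL, LegendreJet.vecL, e2, e1,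
    ← baseDSymm_comp_baseJac h2 h3, transition_symm hw]
  simp only [ContinuousLinearMap.comp_assoc]
  rw [comp_id_cancel e4]

/-- The value of a connection at a point, in the model spaces. -/
def ConnForm.val (Γ : ConnForm n m π) (y : Y) : BaseModel n →L[ℝ] BaseModel n × FibModel m := Γ y

/-- The horizontal lift of a connection on `Y → X` as a linear map: it takes `e_λ` to
`∂_λ + Γ^i_λ ∂_i`. -/
def ConnForm.liftL (Γ : ConnForm n m π) (c : FibredChart n m π) (z : BaseModel n × FibModel m) :
    BaseModel n →L[ℝ] BaseModel n × FibModel m :=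
  (totalD c (c.total.symm z)).comp ((ConnForm.val Γ (c.total.symm z)).comp (baseDSymm c z.1))

/-- The transformation law of the horizontal lift of a connection. -/
theorem ConnForm.liftL_transition (Γ : ConnForm n m π) {y : Y}
    (hy : y ∈ c.total.source) (hy' : y ∈ c'.total.source) :
    ConnForm.liftL Γ c' (c'.total y) = (jac c.total c'.total y).comp
      ((ConnForm.liftL Γ c (c.total y)).comp (FibredChart.baseJac c' c y)) := by
  have e4 := totalDSymm_comp_totalD hy
  rw [jac_total_eq hy hy', ConnForm.liftL, ConnForm.liftL, c.fst_eq y hy, c'.fst_eq y hy',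
    ← baseDSymm_comp_baseJac hy hy', c.total.left_inv hy, c'.total.left_inv hy']
  simp only [ContinuousLinearMap.comp_assoc]
  rw [comp_id_cancel e4]

/-- The tangent map of `π` is `(x, y) ↦ x` in fibred coordinates. -/
theorem fst_totalD {y : Y} (hy : y ∈ c.total.source)
    (A : BaseModel n × FibModel m →L[ℝ] BaseModel n)
    (hA : HasMFDerivAt 𝓘(ℝ, BaseModel n × FibModel m) 𝓘(ℝ, BaseModel n) π y A) :
    (ContinuousLinearMap.fst ℝ _ _).comp (totalD c y) = (baseD c (π y)).comp A := by
  have hb : HasMFDerivAt 𝓘(ℝ, BaseModel n) 𝓘(ℝ, BaseModel n) c.base (π y) (baseD c (π y)) :=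
    ((mdifferentiable_of_mem_maximalAtlas c.base_mem).mdifferentiableAt
      (c.mapsTo y hy)).hasMFDerivAt
  have ht : HasMFDerivAt 𝓘(ℝ, BaseModel n × FibModel m) 𝓘(ℝ, BaseModel n × FibModel m) c.total y
      (totalD c y) :=
    ((mdifferentiable_of_mem_maximalAtlas c.total_mem).mdifferentiableAt hy).hasMFDerivAt
  have h1 : HasMFDerivAt 𝓘(ℝ, BaseModel n × FibModel m) 𝓘(ℝ, BaseModel n)
      (fun y => (c.total y).1) y ((ContinuousLinearMap.fst ℝ _ _).comp (totalD c y)) :=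
    (hasFDerivAt_fst (𝕜 := ℝ) (p := c.total y)).hasMFDerivAt.comp y ht
  have h2 : HasMFDerivAt 𝓘(ℝ, BaseModel n × FibModel m) 𝓘(ℝ, BaseModel n)
      (fun y => c.base (π y)) y ((baseD c (π y)).comp A) := hb.comp y hA
  refine hasMFDerivAt_unique h1 (h2.congr_of_eventuallyEq ?_)
  filter_upwards [c.total.open_source.mem_nhds hy] with y' hy' using c.fst_eq y' hy'

end Transformation

/-! ### Projections in coordinates -/

section Invariance

variable {n m : ℕ} {X Y : Type*}
  [TopologicalSpace X] [ChartedSpace (BaseModel n) X]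
  [TopologicalSpace Y] [ChartedSpace (BaseModel n × FibModel m) Y]
  {π : Y → X} {hπ : IsFibredManifold n m π} {c c' : FibredChart n m π}

theorem IsFibredManifold.mdifferentiableAt (hπ : IsFibredManifold n m π) (y : Y) :
    MDifferentiableAt 𝓘(ℝ, BaseModel n × FibModel m) 𝓘(ℝ, BaseModel n) π y := by
  obtain ⟨c, hy⟩ := hπ.exists_fibredChart y
  have ht := (mdifferentiable_of_mem_maximalAtlas c.total_mem).mdifferentiableAt hy
  have hb : MDifferentiableAt 𝓘(ℝ, BaseModel n) 𝓘(ℝ, BaseModel n) c.base.symm (c.total y).1 :=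
    (mdifferentiable_of_mem_maximalAtlas c.base_mem).mdifferentiableAt_symm (by
      rw [c.fst_eq y hy]; exact c.base.map_source (c.mapsTo y hy))
  have h1 : MDifferentiableAt 𝓘(ℝ, BaseModel n × FibModel m) 𝓘(ℝ, BaseModel n)
      (fun y => (c.total y).1) y :=
    (differentiableAt_fst (𝕜 := ℝ) (p := c.total y)).mdifferentiableAt.comp y ht
  have h2 : MDifferentiableAt 𝓘(ℝ, BaseModel n × FibModel m) 𝓘(ℝ, BaseModel n)
      (fun y => c.base.symm (c.total y).1) y := hb.comp y h1
  refine h2.congr_of_eventuallyEq ?_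
  filter_upwards [c.total.open_source.mem_nhds hy] with y' hy'
  rw [c.fst_eq y' hy', c.base.left_inv (c.mapsTo y' hy')]

/-- The tangent map of `π`. -/
def projD (π : Y → X) (y : Y) : BaseModel n × FibModel m →L[ℝ] BaseModel n :=
  mfderiv 𝓘(ℝ, BaseModel n × FibModel m) 𝓘(ℝ, BaseModel n) π y

/-- The tangent map of `Π → Y`. -/
def bundleD (hπ : IsFibredManifold n m π) (q : LegendreBundle hπ) :
    LegendreModel n m →L[ℝ] BaseModel n × FibModel m :=
  mfderiv (legendreI n m) 𝓘(ℝ, BaseModel n × FibModel m) (fun q : LegendreBundle hπ => q.proj) q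

/-- The tangent map of `Π → X`. -/
def legendreProjD (hπ : IsFibredManifold n m π) (q : LegendreBundle hπ) :
    LegendreModel n m →L[ℝ] BaseModel n :=
  mfderiv (legendreI n m) 𝓘(ℝ, BaseModel n) (legendreProj hπ) q

theorem fst_comp_totalD (hπ : IsFibredManifold n m π) {y : Y} (hy : y ∈ c.total.source) :
    (ContinuousLinearMap.fst ℝ _ _).comp (totalD c y) = (baseD c (π y)).comp (projD π y) :=
  fst_totalD hy _ (hπ.mdifferentiableAt y).hasMFDerivAt

theorem mdifferentiableAt_bundleProj (q : LegendreBundle hπ) :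
    MDifferentiableAt (legendreI n m) 𝓘(ℝ, BaseModel n × FibModel m)
      (fun q : LegendreBundle hπ => q.proj) q :=
  ((Bundle.contMDiff_proj (n := ∞) (IB := 𝓘(ℝ, BaseModel n × FibModel m))
    (legendreCore hπ).Fiber) q).mdifferentiableAt (by simp)

theorem legendreProjD_eq (q : LegendreBundle hπ) :
    legendreProjD hπ q = (projD π q.proj).comp (bundleD hπ q) :=
  mfderiv_comp q (hπ.mdifferentiableAt q.proj) (mdifferentiableAt_bundleProj q)

theorem fst_comp_chartD {q : LegendreBundle hπ} (hq : q.proj ∈ c.total.source) :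
    (ContinuousLinearMap.fst ℝ _ _).comp (chartD hπ c q) =
      (totalD c q.proj).comp (bundleD hπ q) := by
  have hc : HasMFDerivAt (legendreI n m) 𝓘(ℝ, LegendreModel n m) (canonicalChart hπ c) q
      (chartD hπ c q) :=
    ((mdifferentiable_canonicalChart hπ c).mdifferentiableAt
      ((mem_canonicalChart_source hπ c q).2 hq)).hasMFDerivAt
  have ht : HasMFDerivAt 𝓘(ℝ, BaseModel n × FibModel m) 𝓘(ℝ, BaseModel n × FibModel m) c.total
      q.proj (totalD c q.proj) :=
    ((mdifferentiable_of_mem_maximalAtlas c.total_mem).mdifferentiableAt hq).hasMFDerivAt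
  have h1 : HasMFDerivAt (legendreI n m) 𝓘(ℝ, BaseModel n × FibModel m)
      (fun q => (canonicalChart hπ c q).1) q
      ((ContinuousLinearMap.fst ℝ _ _).comp (chartD hπ c q)) :=
    (hasFDerivAt_fst (𝕜 := ℝ) (p := canonicalChart hπ c q)).hasMFDerivAt.comp q hc
  have h2 : HasMFDerivAt (legendreI n m) 𝓘(ℝ, BaseModel n × FibModel m)
      (fun q : LegendreBundle hπ => c.total q.proj) q ((totalD c q.proj).comp (bundleD hπ q)) :=
    ht.comp q (mdifferentiableAt_bundleProj q).hasMFDerivAt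
  exact hasMFDerivAt_unique h1 h2

/-- The section property of a connection, in fibred coordinates. -/
theorem ConnForm.liftL_fst_iff (hπ : IsFibredManifold n m π) (Γ : ConnForm n m π) {y : Y}
    (hy : y ∈ c.total.source) :
    (ContinuousLinearMap.fst ℝ _ _).comp (ConnForm.liftL Γ c (c.total y)) =
        ContinuousLinearMap.id ℝ _ ↔
      (projD π y).comp (ConnForm.val Γ y) = ContinuousLinearMap.id ℝ _ := by
  have hb := c.mapsTo y hy
  have h1 : (ContinuousLinearMap.fst ℝ _ _).comp (ConnForm.liftL Γ c (c.total y)) =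
      (baseD c (π y)).comp (((projD π y).comp (ConnForm.val Γ y)).comp
        (baseDSymm c (c.base (π y)))) := by
    rw [ConnForm.liftL, ← ContinuousLinearMap.comp_assoc, c.total.left_inv hy,
      fst_comp_totalD hπ hy, c.fst_eq y hy]
    simp only [ContinuousLinearMap.comp_assoc]
  have h2 := baseDSymm_comp_baseD hb
  have h3 := baseD_comp_baseDSymm (c.base.map_source hb)
  rw [c.base.left_inv hb] at h3
  rw [h1]
  constructor
  · intro h
    have h4 := congrArg (fun A => (baseDSymm c (c.base (π y))).comp (A.comp (baseD c (π y)))) h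
    simp only [ContinuousLinearMap.comp_assoc, comp_id_cancel h2, h2, ContinuousLinearMap.comp_id,
      ContinuousLinearMap.id_comp] at h4
    exact h4
  · intro h
    rw [h, ContinuousLinearMap.id_comp, h3]

theorem IsConnection.liftL_fst (hπ : IsFibredManifold n m π) {Γ : ConnForm n m π}
    (hΓ : IsConnection Γ) {z : BaseModel n × FibModel m} (hz : z ∈ c.total.target)
    (v : BaseModel n) : (ConnForm.liftL Γ c z v).1 = v := by
  have h := (ConnForm.liftL_fst_iff (c := c) hπ Γ (c.total.map_target hz)).2 (hΓ.1 _)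
  rw [c.total.right_inv hz] at h
  exact congrArg (fun A : BaseModel n →L[ℝ] BaseModel n => A v) h

theorem IsConnection.liftL_eq (hπ : IsFibredManifold n m π) {Γ : ConnForm n m π}
    (hΓ : IsConnection Γ) {z : BaseModel n × FibModel m} (hz : z ∈ c.total.target)
    (v : BaseModel n) : ConnForm.liftL Γ c z v = (v, ConnForm.coeff Γ c z v) :=
  Prod.ext (hΓ.liftL_fst hπ hz v) rfl

theorem LegendreJet.fst_vecL (γ : LegendreJet hπ) {w : LegendreModel n m}
    (hw : w ∈ (canonicalChart hπ c).target) :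
    (ContinuousLinearMap.fst ℝ _ _).comp (LegendreJet.vecL γ c w) =
      (totalD c (c.total.symm w.1)).comp
        ((bundleD hπ ((canonicalChart hπ c).symm w)).comp
          ((LegendreJet.val γ ((canonicalChart hπ c).symm w)).comp (baseDSymm c w.1.1))) := by
  have hz := (mem_canonicalChart_target hπ c w).1 hw
  rw [LegendreJet.vecL, ← ContinuousLinearMap.comp_assoc,
    fst_comp_chartD (q := (canonicalChart hπ c).symm w) (c.total.map_target hz)]
  rfl

/-- The section property of a jet field, in canonical coordinates. -/
theorem LegendreJet.vecL_fst_iff (γ : LegendreJet hπ) {w : LegendreModel n m}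
    (hw : w ∈ (canonicalChart hπ c).target) :
    (∀ v, (LegendreJet.vecL γ c w v).1.1 = v) ↔
      (legendreProjD hπ ((canonicalChart hπ c).symm w)).comp
        (LegendreJet.val γ ((canonicalChart hπ c).symm w)) = ContinuousLinearMap.id ℝ _ := by
  have hz := (mem_canonicalChart_target hπ c w).1 hw
  have hy := c.total.map_target hz
  have hb := c.mapsTo _ hy
  have h1 : (ContinuousLinearMap.fst ℝ _ _).comp
      ((ContinuousLinearMap.fst ℝ _ _).comp (LegendreJet.vecL γ c w)) =
      (baseD c (π (c.total.symm w.1))).comp (((legendreProjD hπ ((canonicalChart hπ c).symm w)).comp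
        (LegendreJet.val γ ((canonicalChart hπ c).symm w))).comp
        (baseDSymm c (c.base (π (c.total.symm w.1))))) := by
    rw [LegendreJet.fst_vecL γ hw, ← ContinuousLinearMap.comp_assoc, fst_comp_totalD hπ hy,
      legendreProjD_eq, c.base_proj_symm hz]
    simp only [ContinuousLinearMap.comp_assoc]
    rfl
  have h2 := baseDSymm_comp_baseD hb
  have h3 := baseD_comp_baseDSymm (c.base.map_source hb)
  rw [c.base.left_inv hb] at h3
  have h0 : (∀ v, (LegendreJet.vecL γ c w v).1.1 = v) ↔ (ContinuousLinearMap.fst ℝ _ _).comp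
      ((ContinuousLinearMap.fst ℝ _ _).comp (LegendreJet.vecL γ c w)) =
        ContinuousLinearMap.id ℝ _ :=
    ⟨fun h => ContinuousLinearMap.ext h, fun h v => congrArg (fun A => A v) h⟩
  rw [h0, h1]
  constructor
  · intro h
    have h4 := congrArg (fun A => (baseDSymm c (c.base (π (c.total.symm w.1)))).comp
      (A.comp (baseD c (π (c.total.symm w.1))))) h
    simp only [ContinuousLinearMap.comp_assoc, comp_id_cancel h2, h2, ContinuousLinearMap.comp_id,
      ContinuousLinearMap.id_comp] at h4
    exact h4
  · intro h
    rw [h, ContinuousLinearMap.id_comp, h3]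

theorem IsJetFieldOn.vec_fst {U : Set (LegendreBundle hπ)} {γ : LegendreJet hπ}
    (hγ : IsJetFieldOn U γ) {w : LegendreModel n m} (hw : w ∈ coordDomain hπ c U)
    (l : Fin (n + 1)) : (LegendreJet.vec γ c w l).1.1 = baseVec l :=
  (LegendreJet.vecL_fst_iff γ hw.1).2 (hγ.1 _ hw.2) (baseVec l)

/-! ### Invariance of the contractions under changes of canonical coordinates -/

/-- The contraction of a vector-valued form with a tangent-valued form does not depend on the
basis. -/
theorem sum_curryLeft_change_basis {r : ℕ}
    (A : Fin (n + 1) → LegendreModel n m [⋀^Fin (r + 1)]→L[ℝ] ℝ)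
    {J J' : BaseModel n →L[ℝ] BaseModel n} (hJ : J'.comp J = ContinuousLinearMap.id ℝ _)
    (V : BaseModel n →L[ℝ] LegendreModel n m) :
    ∑ l, (∑ k, (J (baseVec k)) l • A k).curryLeft (V (J' (baseVec l))) =
      ∑ k, (A k).curryLeft (V (baseVec k)) := by
  have h1 : ∀ l, (∑ k, (J (baseVec k)) l • A k).curryLeft (V (J' (baseVec l))) =
      ∑ k, (A k).curryLeft ((J (baseVec k)) l • V (J' (baseVec l))) := fun l => by
    rw [map_finset_sum_curryLeft]
    refine Finset.sum_congr rfl fun k _ => ?_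
    rw [map_smul]
    rfl
  rw [Finset.sum_congr rfl fun l _ => h1 l, Finset.sum_comm]
  refine Finset.sum_congr rfl fun k _ => ?_
  rw [← map_sum]
  congr 1
  calc ∑ l, (J (baseVec k)) l • V (J' (baseVec l))
      = V (J' (∑ l, (J (baseVec k)) l • baseVec l)) := by simp only [map_sum, map_smul]
    _ = V (baseVec k) := by
      rw [euclidean_sum_single, ← ContinuousLinearMap.comp_apply J', hJ]
      rfl

theorem det_fderiv_transition_ne_zero {w : LegendreModel n m} (hw : w ∈ overlap hπ c c') :
    (FibredChart.baseJac c c' (c.total.symm w.1)).det ≠ 0 :=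
  FibredChart.det_baseJac_ne_zero c c' (mem_overlap hw).2.1 (mem_overlap hw).2.2

/-- The factor `det(∂x'/∂x)⁻¹` in the law of the momenta cancels the Jacobian of `ω`, so that `θ^λ`
transforms as the components of a vector on the base. -/
theorem thetaComp_transition {w : LegendreModel n m} (hw : w ∈ overlap hπ c c')
    (l : Fin (n + 1)) :
    (thetaComp (transition hπ c c' w).2 l).compContinuousLinearMap
        (fderiv ℝ (transition hπ c c') w) =
      ∑ k, (FibredChart.baseJac c c' (c.total.symm w.1) (baseVec k)) l • thetaComp w.2 k := by
  obtain ⟨h1, h2, h3⟩ := mem_overlap hw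
  rw [transition_snd hw, FibredChart.momChange_apply]
  refine thetaComp_compContinuousLinearMap (fderiv_transition_base hw)
    (fun u hu => fderiv_transition_fib hw hu) ?_ (det_fderiv_transition_ne_zero hw) w.2 l
  rw [FibredChart.fibJac_comp c c' c h2 h3 h2, FibredChart.fibJac_self c h2]

theorem overlap_base_eq {w : LegendreModel n m} (hw : w ∈ overlap hπ c c') :
    FibredChart.baseJac c c' (c.total.symm w.1) =
      fderiv ℝ (fun x => c'.base (c.base.symm x)) w.1.1 := by
  rw [FibredChart.baseJac, jac, c.base_proj_symm (mem_overlap hw).1]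

theorem overlap_base_mem {w : LegendreModel n m} (hw : w ∈ overlap hπ c c') :
    w.1.1 ∈ (c.base.symm ≫ₕ c'.base).source := by
  obtain ⟨h1, h2, h3⟩ := mem_overlap hw
  rw [← c.base_proj_symm h1]
  simp [c.base.map_source (c.mapsTo _ h2), c.base.left_inv (c.mapsTo _ h2), c'.mapsTo _ h3]

theorem contDiffOn_baseJac_overlap (c c' : FibredChart n m π) :
    ContDiffOn ℝ ∞ (fderiv ℝ (fun x => c'.base (c.base.symm x)))
      (c.base.symm ≫ₕ c'.base).source :=
  (contDiffOn_transition c.base_mem c'.base_mem).fderiv_of_isOpen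
    (c.base.symm ≫ₕ c'.base).open_source (by simp)

theorem minSmoothness_two_le_infty : minSmoothness ℝ 2 ≤ (∞ : WithTop ℕ∞) := by
  rw [minSmoothness_of_isRCLikeNormedField]
  exact WithTop.coe_le_coe.2 le_top

/-- `Ω^λ = -dθ^λ` obeys the same law as `θ^λ`: the derivatives of the Jacobian are multiples of the
`dx^μ`, and are annihilated by `ω`. -/
theorem multisymplecticComp_transition {w : LegendreModel n m} (hw : w ∈ overlap hπ c c')
    (l : Fin (n + 1)) :
    (multisymplecticComp l).compContinuousLinearMap (fderiv ℝ (transition hπ c c') w) =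
      ∑ k, (FibredChart.baseJac c c' (c.total.symm w.1) (baseVec k)) l •
        multisymplecticComp k := by
  let j : BaseModel n → BaseModel n →L[ℝ] BaseModel n :=
    fderiv ℝ (fun x => c'.base (c.base.symm x))
  have hj : DifferentiableAt ℝ j w.1.1 :=
    ((contDiffOn_baseJac_overlap c c').contDiffAt
      ((c.base.symm ≫ₕ c'.base).open_source.mem_nhds (overlap_base_mem hw))).differentiableAt
      (by simp)
  let g : Fin (n + 1) → LegendreModel n m → ℝ := fun k u => (j u.1.1 (baseVec k)) l
  have hg : ∀ k, ∃ a : BaseModel n →L[ℝ] ℝ, HasFDerivAt (g k)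
      (a.comp ((ContinuousLinearMap.fst ℝ (BaseModel n) (FibModel m)).comp
        (ContinuousLinearMap.fst ℝ (BaseModel n × FibModel m) (MomModel n m)))) w := fun k => by
    have h1 : DifferentiableAt ℝ (fun x => (j x (baseVec k)) l) w.1.1 :=
      (EuclideanSpace.proj l : BaseModel n →L[ℝ] ℝ).differentiableAt.comp w.1.1
        (hj.clm_apply (differentiableAt_const _))
    exact ⟨_, HasFDerivAt.comp (g := fun x => (j x (baseVec k)) l) w h1.hasFDerivAt
      ((ContinuousLinearMap.fst ℝ (BaseModel n) (FibModel m)).comp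
        (ContinuousLinearMap.fst ℝ (BaseModel n × FibModel m) (MomModel n m))).hasFDerivAt⟩
  have h1 : extDeriv (fun w => (thetaComp (transition hπ c c' w).2 l).compContinuousLinearMap
      (fderiv ℝ (transition hπ c c') w)) w =
      (-multisymplecticComp l).compContinuousLinearMap (fderiv ℝ (transition hπ c c') w) := by
    rw [← extDeriv_thetaComp l (transition hπ c c' w)]
    exact extDeriv_pullback (differentiableAt_thetaComp l _) (contDiffAt_legendreTransition hw)
      minSmoothness_two_le_infty
  have h2 : (fun w => (thetaComp (transition hπ c c' w).2 l).compContinuousLinearMap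
      (fderiv ℝ (transition hπ c c') w)) =ᶠ[𝓝 w] fun w => ∑ k, g k w • thetaComp w.2 k := by
    filter_upwards [(isOpen_overlap hπ c c').mem_nhds hw] with u hu
    rw [thetaComp_transition hu, overlap_base_eq hu]
  have h3 : ∀ k, extDeriv (fun w : LegendreModel n m => g k w • thetaComp w.2 k) w =
      -(g k w • multisymplecticComp k) := fun k => by
    obtain ⟨a, ha⟩ := hg k
    refine extDeriv_smul_thetaComp ha.differentiableAt (fun u hu => ?_) k
    rw [ha.fderiv]
    simp [hu]
  have h4 : ∀ k, DifferentiableAt ℝ (fun w : LegendreModel n m => g k w • thetaComp w.2 k) w :=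
    fun k => by
      obtain ⟨a, ha⟩ := hg k
      exact ha.differentiableAt.smul (differentiableAt_thetaComp k w)
  rw [h2.extDeriv_eq, extDeriv_fun_sum fun k _ => h4 k, Finset.sum_congr rfl fun k _ => h3 k,
    Finset.sum_neg_distrib] at h1
  rw [overlap_base_eq hw]
  exact (neg_injective h1).symm

theorem baseJac_comp_symm {w : LegendreModel n m} (hw : w ∈ overlap hπ c c') :
    (FibredChart.baseJac c' c (c.total.symm w.1)).comp
      (FibredChart.baseJac c c' (c.total.symm w.1)) = ContinuousLinearMap.id ℝ _ := by
  obtain ⟨h1, h2, h3⟩ := mem_overlap hw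
  rw [FibredChart.baseJac_comp c c' c h2 h3 h2, FibredChart.baseJac_self c h2]

/-- `γ ⌋ Ω` does not depend on the canonical coordinates. -/
theorem LegendreJet.contractOmega_transition (γ : LegendreJet hπ) {w : LegendreModel n m}
    (hw : w ∈ overlap hπ c c') :
    (LegendreJet.contractOmega γ c' (transition hπ c c' w)).compContinuousLinearMap
      (fderiv ℝ (transition hπ c c') w) = LegendreJet.contractOmega γ c w := by
  rw [LegendreJet.contractOmega, sum_compContinuousLinearMap]
  simp only [LegendreJet.vec_eq, LegendreJet.vecL_transition γ hw]
  have h1 : ∀ l : Fin (n + 1), ((multisymplecticComp l).curryLeft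
      (((fderiv ℝ (transition hπ c c') w).comp ((LegendreJet.vecL γ c w).comp
        (FibredChart.baseJac c' c (c.total.symm w.1)))) (baseVec l))).compContinuousLinearMap
      (fderiv ℝ (transition hπ c c') w) =
      (∑ k, (FibredChart.baseJac c c' (c.total.symm w.1) (baseVec k)) l •
        multisymplecticComp k).curryLeft (LegendreJet.vecL γ c w
          (FibredChart.baseJac c' c (c.total.symm w.1) (baseVec l))) := fun l => by
    rw [← multisymplecticComp_transition hw,
      ContinuousAlternatingMap.curryLeft_compContinuousLinearMap]
    rfl
  rw [Finset.sum_congr rfl fun l _ => h1 l,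
    sum_curryLeft_change_basis _ (baseJac_comp_symm hw) (LegendreJet.vecL γ c w)]
  rfl

theorem ConnForm.contractTheta_eq (hπ : IsFibredManifold n m π) {Γ : ConnForm n m π}
    (hΓ : IsConnection Γ) {w : LegendreModel n m} (hw : w.1 ∈ c.total.target) :
    ConnForm.contractTheta Γ c w = ∑ l, (thetaComp w.2 l).curryLeft
      (ContinuousLinearMap.inl ℝ (BaseModel n × FibModel m) (MomModel n m)
        (ConnForm.liftL Γ c w.1 (baseVec l))) := by
  rw [ConnForm.contractTheta]
  refine Finset.sum_congr rfl fun l _ => ?_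
  rw [hΓ.liftL_eq hπ hw]
  rfl

/-- `Γ̂ ⌋ θ` does not depend on the canonical coordinates. -/
theorem IsConnection.contractTheta_transition {Γ : ConnForm n m π} (hΓ : IsConnection Γ)
    {w : LegendreModel n m} (hw : w ∈ overlap hπ c c') :
    (ConnForm.contractTheta Γ c' (transition hπ c c' w)).compContinuousLinearMap
      (fderiv ℝ (transition hπ c c') w) = ConnForm.contractTheta Γ c w := by
  obtain ⟨h1, h2, h3⟩ := mem_overlap hw
  rw [ConnForm.contractTheta_eq hπ hΓ h1, ConnForm.contractTheta_eq hπ hΓ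
    (mem_overlap (transition_mem_overlap hw)).1, sum_compContinuousLinearMap]
  have hl := ConnForm.liftL_transition Γ h2 h3
  rw [c.total.right_inv h1] at hl
  have e1 : ∀ l : Fin (n + 1), ((thetaComp (transition hπ c c' w).2 l).curryLeft
      (ContinuousLinearMap.inl ℝ (BaseModel n × FibModel m) (MomModel n m)
        (ConnForm.liftL Γ c' (transition hπ c c' w).1 (baseVec l)))).compContinuousLinearMap
      (fderiv ℝ (transition hπ c c') w) =
      (∑ k, (FibredChart.baseJac c c' (c.total.symm w.1) (baseVec k)) l •
        thetaComp w.2 k).curryLeft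
        (((ContinuousLinearMap.inl ℝ (BaseModel n × FibModel m) (MomModel n m)).comp
          (ConnForm.liftL Γ c w.1))
          (FibredChart.baseJac c' c (c.total.symm w.1) (baseVec l))) := fun l => by
    rw [← thetaComp_transition hw]
    refine Eq.trans ?_
      (ContinuousAlternatingMap.curryLeft_compContinuousLinearMap _ _ _).symm
    congr 1
    refine curryLeft_thetaComp_congr _ _ ?_
    rw [fderiv_transition_fst hw, transition_fst, hl]
    rfl
  rw [Finset.sum_congr rfl fun l _ => e1 l,
    sum_curryLeft_change_basis _ (baseJac_comp_symm hw)
      ((ContinuousLinearMap.inl ℝ (BaseModel n × FibModel m) (MomModel n m)).comp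
          (ConnForm.liftL Γ c w.1))]
  rfl

/-- The exterior derivative of a form does not depend on the coordinates. -/
theorem LegendreForm.extDeriv_rep_transition {r : ℕ} (H : LegendreForm hπ r)
    {w : LegendreModel n m} (hw : w ∈ overlap hπ c c')
    (hH : DifferentiableAt ℝ (LegendreForm.rep H c') (transition hπ c c' w)) :
    extDeriv (LegendreForm.rep H c) w =
      (extDeriv (LegendreForm.rep H c') (transition hπ c c' w)).compContinuousLinearMap
        (fderiv ℝ (transition hπ c c') w) := by
  have h : LegendreForm.rep H c =ᶠ[𝓝 w] fun w =>
      (LegendreForm.rep H c' (transition hπ c c' w)).compContinuousLinearMap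
        (fderiv ℝ (transition hπ c c') w) := by
    filter_upwards [(isOpen_overlap hπ c c').mem_nhds hw] with u hu
    exact LegendreForm.rep_transition H hu
  rw [h.extDeriv_eq]
  exact extDeriv_pullback hH (contDiffAt_legendreTransition hw) minSmoothness_two_le_infty

end Invariance

/-! ### Coordinate domains -/

theorem ContDiffOn.sub_form {E : Type*} [NormedAddCommGroup E] [NormedSpace ℝ E] {r : ℕ}
    {s : Set E} {β β' : E → E [⋀^Fin r]→L[ℝ] ℝ} (h : ContDiffOn ℝ ∞ β s)
    (h' : ContDiffOn ℝ ∞ β' s) : ContDiffOn ℝ ∞ (fun w => β w - β' w) s :=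
  h.sub h'

theorem ContDiffOn.smul_form {E : Type*} [NormedAddCommGroup E] [NormedSpace ℝ E] {r : ℕ}
    {s : Set E} {g : E → ℝ} (h : ContDiffOn ℝ ∞ g s) (β : E [⋀^Fin r]→L[ℝ] ℝ) :
    ContDiffOn ℝ ∞ (fun w => g w • β) s :=
  h.smul contDiffOn_const

section HamiltonianForms

variable {n m : ℕ} {X Y : Type*}
  [TopologicalSpace X] [ChartedSpace (BaseModel n) X]
  [TopologicalSpace Y] [ChartedSpace (BaseModel n × FibModel m) Y]
  {π : Y → X} {hπ : IsFibredManifold n m π} {c c' : FibredChart n m π}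
  {U U' : Set (LegendreBundle hπ)}

theorem coordDomain_mono (h : U' ⊆ U) : coordDomain hπ c U' ⊆ coordDomain hπ c U :=
  fun _ hw => ⟨hw.1, h hw.2⟩

theorem coordDomain_subset_overlap (h : U ⊆ (canonicalChart hπ c).source) :
    coordDomain hπ c' U ⊆ overlap hπ c' c :=
  coordDomain_mono h

theorem coordDomain_univ : coordDomain hπ c univ = (canonicalChart hπ c).target := by
  simp [coordDomain]

theorem canonicalChart_mem_coordDomain {q : LegendreBundle hπ}
    (hq : q ∈ (canonicalChart hπ c).source) (hU : q ∈ U) :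
    canonicalChart hπ c q ∈ coordDomain hπ c U :=
  ⟨(canonicalChart hπ c).map_source hq, by
    rwa [mem_preimage, (canonicalChart hπ c).left_inv hq]⟩

theorem exists_canonicalChart (hπ : IsFibredManifold n m π) (q : LegendreBundle hπ) :
    ∃ c : FibredChart n m π, q ∈ (canonicalChart hπ c).source := by
  obtain ⟨c, hc⟩ := hπ.exists_fibredChart q.proj
  exact ⟨c, (mem_canonicalChart_source hπ c q).2 hc⟩

theorem transition_total_symm {w : LegendreModel n m} (hw : w ∈ overlap hπ c c') :
    c'.total.symm (transition hπ c c' w).1 = c.total.symm w.1 := by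
  rw [transition_fst, c'.total.left_inv (mem_overlap hw).2.2]

theorem contDiffOn_baseJac_comp (hπ : IsFibredManifold n m π) (c c' : FibredChart n m π) :
    ContDiffOn ℝ ∞ (fun w : LegendreModel n m => FibredChart.baseJac c c' (c.total.symm w.1))
      (overlap hπ c c') :=
  ((contDiffOn_baseJac_overlap c c').comp (contDiff_fst.fst.contDiffOn (s := overlap hπ c c'))
    fun _ hw => overlap_base_mem hw).congr fun _ hw => overlap_base_eq hw

theorem contDiffOn_fderiv_transition (hπ : IsFibredManifold n m π) (c c' : FibredChart n m π) :
    ContDiffOn ℝ ∞ (fderiv ℝ (transition hπ c c')) (overlap hπ c c') :=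
  (contDiffOn_legendreTransition hπ c c').fderiv_of_isOpen (isOpen_overlap hπ c c') (by simp)

/-! ### Jet fields and densities given in one canonical chart -/

/-- The jet field with components `V` in the canonical coordinates of `c`. -/
def jetOfChart (hπ : IsFibredManifold n m π) (c : FibredChart n m π)
    (V : LegendreModel n m → BaseModel n →L[ℝ] LegendreModel n m) : LegendreJet hπ := fun q =>
  (chartDSymm hπ c (canonicalChart hπ c q)).comp
    ((V (canonicalChart hπ c q)).comp (baseD c (π q.proj)))

theorem vecL_jetOfChart (V : LegendreModel n m → BaseModel n →L[ℝ] LegendreModel n m)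
    {w : LegendreModel n m} (hw : w ∈ (canonicalChart hπ c).target) :
    LegendreJet.vecL (jetOfChart hπ c V) c w = V w := by
  have hz := (mem_canonicalChart_target hπ c w).1 hw
  have h1 : LegendreJet.val (jetOfChart hπ c V) ((canonicalChart hπ c).symm w) =
      (chartDSymm hπ c w).comp ((V w).comp (baseD c (π (c.total.symm w.1)))) := by
    have : LegendreJet.val (jetOfChart hπ c V) ((canonicalChart hπ c).symm w) =
      (chartDSymm hπ c (canonicalChart hπ c ((canonicalChart hπ c).symm w))).comp
        ((V (canonicalChart hπ c ((canonicalChart hπ c).symm w))).comp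
          (baseD c (π (c.total.symm w.1)))) := rfl
    rw [this, (canonicalChart hπ c).right_inv hw]
  have hb := c.mapsTo _ (c.total.map_target hz)
  have h3 := baseD_comp_baseDSymm (c.base.map_source hb)
  rw [c.base.left_inv hb, c.base_proj_symm hz] at h3
  rw [LegendreJet.vecL, h1]
  simp only [ContinuousLinearMap.comp_assoc]
  rw [h3, ContinuousLinearMap.comp_id, comp_id_cancel (chartD_comp_chartDSymm hw)]

/-- The section property and the smoothness of a jet field can be checked in one canonical chart. -/
theorem isJetFieldOn_of_chart (hU : U ⊆ (canonicalChart hπ c).source) {γ : LegendreJet hπ}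
    (h1 : ∀ w ∈ coordDomain hπ c U, ∀ v, (LegendreJet.vecL γ c w v).1.1 = v)
    (h2 : ContDiffOn ℝ ∞ (LegendreJet.vecL γ c) (coordDomain hπ c U)) : IsJetFieldOn U γ := by
  refine ⟨fun q hq => ?_, fun c' l => ?_⟩
  · have h3 := (LegendreJet.vecL_fst_iff γ ((canonicalChart hπ c).map_source (hU hq))).1
      (h1 _ (canonicalChart_mem_coordDomain (hU hq) hq))
    rwa [(canonicalChart hπ c).left_inv (hU hq)] at h3
  · have hs : coordDomain hπ c' U ⊆ overlap hπ c' c := coordDomain_subset_overlap hU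
    have ht : ContDiffOn ℝ ∞ (transition hπ c' c) (coordDomain hπ c' U) :=
      (contDiffOn_legendreTransition hπ c' c).mono hs
    have e1 : ContDiffOn ℝ ∞ (fun w => fderiv ℝ (transition hπ c c') (transition hπ c' c w))
        (coordDomain hπ c' U) :=
      (contDiffOn_fderiv_transition hπ c c').comp ht fun w hw => transition_mem_overlap (hs hw)
    have e2 : ContDiffOn ℝ ∞ (fun w => LegendreJet.vecL γ c (transition hπ c' c w))
        (coordDomain hπ c' U) :=
      h2.comp ht fun w hw => (mem_coordDomain_iff (hs hw)).2 hw
    have e3 := (contDiffOn_baseJac_comp hπ c' c).mono hs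
    refine (e1.clm_apply (e2.clm_apply (e3.clm_apply
      (contDiffOn_const (c := baseVec l))))).congr fun w hw => ?_
    have h4 := LegendreJet.vecL_transition γ (transition_mem_overlap (hs hw))
    rw [transition_transition (hs hw), transition_total_symm (hs hw)] at h4
    rw [LegendreJet.vec_eq, h4]
    rfl

/-- The density `h ω` in the canonical coordinates of `c`. -/
def densityOfChart (hπ : IsFibredManifold n m π) (c : FibredChart n m π)
    (h : LegendreModel n m → ℝ) : LegendreForm hπ (n + 1) := fun q =>
  (h (canonicalChart hπ c q) • omegaX).compContinuousLinearMap (chartD hπ c q)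

theorem rep_densityOfChart (h : LegendreModel n m → ℝ) {w : LegendreModel n m}
    (hw : w ∈ (canonicalChart hπ c).target) :
    LegendreForm.rep (densityOfChart hπ c h) c w = h w • omegaX := by
  have h1 : LegendreForm.val (densityOfChart hπ c h) ((canonicalChart hπ c).symm w) =
      (h (canonicalChart hπ c ((canonicalChart hπ c).symm w)) • omegaX).compContinuousLinearMap
        (chartD hπ c ((canonicalChart hπ c).symm w)) := rfl
  rw [LegendreForm.rep_eq, h1, ContinuousAlternatingMap.comp_comp, chartD_comp_chartDSymm hw,
    (canonicalChart hπ c).right_inv hw]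
  rfl

theorem isHorizontalDensityOn_of_chart (hU : U ⊆ (canonicalChart hπ c).source)
    {D : LegendreForm hπ (n + 1)} {h : LegendreModel n m → ℝ}
    (hh : ContDiffOn ℝ ∞ h (coordDomain hπ c U))
    (hD : ∀ w ∈ coordDomain hπ c U, LegendreForm.rep D c w = h w • omegaX) :
    IsHorizontalDensityOn U D := by
  have key : ∀ c' : FibredChart n m π, ∀ w ∈ coordDomain hπ c' U, LegendreForm.rep D c' w =
      (h (transition hπ c' c w) * (FibredChart.baseJac c' c (c'.total.symm w.1)).det) •
        omegaX := fun c' w hw => by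
    have hw' := coordDomain_subset_overlap hU hw
    rw [LegendreForm.rep_transition D hw', hD _ ((mem_coordDomain_iff hw').2 hw), mul_smul,
      ← omegaX_compContinuousLinearMap (fderiv_transition_base hw')]
    rfl
  refine ⟨fun c' => ?_, fun c' => ⟨_, key c'⟩⟩
  have hs : coordDomain hπ c' U ⊆ overlap hπ c' c := coordDomain_subset_overlap hU
  refine ContDiffOn.congr ?_ (key c')
  refine ContDiffOn.smul_form (ContDiffOn.mul ?_ ?_) omegaX
  · exact hh.comp ((contDiffOn_legendreTransition hπ c' c).mono hs)
      fun w hw => (mem_coordDomain_iff (hs hw)).2 hw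
  · exact (contDiff_continuousLinearMap_det n).comp_contDiffOn
      ((contDiffOn_baseJac_comp hπ c' c).mono hs)

/-! ### Restriction and algebraic operations -/

theorem IsSmoothFormOn.mono {r : ℕ} {H : LegendreForm hπ r} (hH : IsSmoothFormOn U H)
    (h : U' ⊆ U) : IsSmoothFormOn U' H :=
  fun c => (hH c).mono (coordDomain_mono h)

theorem IsSmoothFormOn.contDiffAt {r : ℕ} {H : LegendreForm hπ r} (hH : IsSmoothFormOn U H)
    (hU : IsOpen U) {w : LegendreModel n m} (hw : w ∈ coordDomain hπ c U) :
    ContDiffAt ℝ ∞ (LegendreForm.rep H c) w :=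
  (hH c).contDiffAt ((isOpen_coordDomain hπ c hU).mem_nhds hw)

theorem IsSmoothFormOn.differentiableAt {r : ℕ} {H : LegendreForm hπ r} (hH : IsSmoothFormOn U H)
    (hU : IsOpen U) {w : LegendreModel n m} (hw : w ∈ coordDomain hπ c U) :
    DifferentiableAt ℝ (LegendreForm.rep H c) w :=
  (hH.contDiffAt hU hw).differentiableAt (by simp)

theorem LegendreForm.rep_sub {r : ℕ} (H H' : LegendreForm hπ r) (c : FibredChart n m π)
    (w : LegendreModel n m) :
    LegendreForm.rep (H - H') c w = LegendreForm.rep H c w - LegendreForm.rep H' c w := rfl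

theorem IsSmoothFormOn.sub {r : ℕ} {H H' : LegendreForm hπ r} (hH : IsSmoothFormOn U H)
    (hH' : IsSmoothFormOn U H') : IsSmoothFormOn U (H - H') :=
  fun c => (ContDiffOn.sub_form (hH c) (hH' c)).congr fun w _ => LegendreForm.rep_sub H H' c w

theorem LegendreForm.extDeriv_rep_sub {r : ℕ} {H H' : LegendreForm hπ r}
    (hH : IsSmoothFormOn U H) (hH' : IsSmoothFormOn U H') (hU : IsOpen U) {w : LegendreModel n m}
    (hw : w ∈ coordDomain hπ c U) : extDeriv (LegendreForm.rep (H - H') c) w =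
      extDeriv (LegendreForm.rep H c) w - extDeriv (LegendreForm.rep H' c) w := by
  rw [funext (LegendreForm.rep_sub H H' c)]
  exact extDeriv_fun_sub (hH.differentiableAt hU hw) (hH'.differentiableAt hU hw)

theorem IsSmoothFormOn.contDiffOn_omegaCoeff {D : LegendreForm hπ (n + 1)}
    (hD : IsSmoothFormOn U D) (c : FibredChart n m π) :
    ContDiffOn ℝ ∞ (LegendreForm.omegaCoeff D c) (coordDomain hπ c U) :=
  (ContinuousAlternatingMap.apply ℝ (LegendreModel n m) ℝ partialX).contDiff.comp_contDiffOn (hD c)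

theorem IsHorizontalDensityOn.rep_eq {D : LegendreForm hπ (n + 1)}
    (hD : IsHorizontalDensityOn U D) {w : LegendreModel n m} (hw : w ∈ coordDomain hπ c U) :
    LegendreForm.rep D c w = LegendreForm.omegaCoeff D c w • omegaX := by
  obtain ⟨h, hh⟩ := hD.2 c
  rw [LegendreForm.omegaCoeff, hh w hw, ContinuousAlternatingMap.smul_apply, omegaX_partialX,
    smul_eq_mul, mul_one]

theorem IsSplitFormOn.rep_eq {H : LegendreForm hπ (n + 1)}
    (hH : IsSplitFormOn U H) {w : LegendreModel n m} (hw : w ∈ coordDomain hπ c U) :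
    LegendreForm.rep H c w = momentumForm w.2 - (-LegendreForm.omegaCoeff H c w) • omegaX := by
  obtain ⟨h, hh⟩ := hH.2 c
  have h1 : LegendreForm.omegaCoeff H c w = -h w := by
    rw [LegendreForm.omegaCoeff, hh w hw, ContinuousAlternatingMap.sub_apply,
      ContinuousAlternatingMap.smul_apply, omegaX_partialX, momentumForm_partialX,
      smul_eq_mul, mul_one, zero_sub]
  rw [h1, neg_neg, hh w hw]

theorem IsHorizontalDensityOn.mono {D : LegendreForm hπ (n + 1)} (hD : IsHorizontalDensityOn U D)
    (h : U' ⊆ U) : IsHorizontalDensityOn U' D :=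
  ⟨hD.1.mono h, fun c => (hD.2 c).imp fun _ hh w hw => hh w (coordDomain_mono h hw)⟩

theorem IsSplitFormOn.mono {H : LegendreForm hπ (n + 1)} (hH : IsSplitFormOn U H)
    (h : U' ⊆ U) : IsSplitFormOn U' H :=
  ⟨hH.1.mono h, fun c => (hH.2 c).imp fun _ hh w hw => hh w (coordDomain_mono h hw)⟩

theorem IsSplitFormOn.sub_density {H D : LegendreForm hπ (n + 1)} (hH : IsSplitFormOn U H)
    (hD : IsHorizontalDensityOn U D) : IsSplitFormOn U (H - D) := by
  refine ⟨hH.1.sub hD.1, fun c => ⟨fun w =>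
    -LegendreForm.omegaCoeff H c w + LegendreForm.omegaCoeff D c w, fun w hw => ?_⟩⟩
  rw [LegendreForm.rep_sub, hH.rep_eq hw, hD.rep_eq hw, add_smul, sub_sub]

theorem IsSplitFormOn.sub {H H' : LegendreForm hπ (n + 1)} (hH : IsSplitFormOn U H)
    (hH' : IsSplitFormOn U H') : IsHorizontalDensityOn U (H - H') := by
  refine ⟨hH.1.sub hH'.1, fun c => ⟨fun w =>
    LegendreForm.omegaCoeff H c w - LegendreForm.omegaCoeff H' c w, fun w hw => ?_⟩⟩
  rw [LegendreForm.rep_sub, hH.rep_eq hw, hH'.rep_eq hw, sub_smul, neg_smul, neg_smul]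
  abel

/-! ### Hamiltonian forms and their differentials -/

/-- The condition `γ ⌋ Ω = dH` contains the Hamiltonian condition, because `d(dH) = 0`. -/
theorem isAssociatedJetFieldOn_of_eq (hU : IsOpen U) {γ : LegendreJet hπ}
    {H : LegendreForm hπ (n + 1)} (hγ : IsJetFieldOn U γ) (hH : IsSmoothFormOn U H)
    (h : ∀ c : FibredChart n m π, ∀ w ∈ coordDomain hπ c U,
      LegendreJet.contractOmega γ c w = extDeriv (LegendreForm.rep H c) w) :
    IsAssociatedJetFieldOn U γ H := by
  refine ⟨⟨hγ, fun c w hw => ?_⟩, h⟩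
  have h1 : LegendreJet.contractOmega γ c =ᶠ[𝓝 w] extDeriv (LegendreForm.rep H c) := by
    filter_upwards [(isOpen_coordDomain hπ c hU).mem_nhds hw] with u hu using h c u hu
  rw [h1.extDeriv_eq]
  exact extDeriv_extDeriv_apply (hH.contDiffAt hU hw) minSmoothness_two_le_infty

theorem isAssociatedJetFieldOn_of_chart (hUo : IsOpen U) (hU : U ⊆ (canonicalChart hπ c).source)
    {γ : LegendreJet hπ} {H : LegendreForm hπ (n + 1)} (hγ : IsJetFieldOn U γ)
    (hH : IsSmoothFormOn U H) (h : ∀ w ∈ coordDomain hπ c U,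
      LegendreJet.contractOmega γ c w = extDeriv (LegendreForm.rep H c) w) :
    IsAssociatedJetFieldOn U γ H := by
  refine isAssociatedJetFieldOn_of_eq hUo hγ hH fun c' w hw => ?_
  have hw' := coordDomain_subset_overlap hU hw
  have hw2 := (mem_coordDomain_iff (U := U) hw').2 hw
  rw [← LegendreJet.contractOmega_transition γ hw', h _ hw2,
    LegendreForm.extDeriv_rep_transition H hw' (hH.differentiableAt hUo hw2)]

/-- A jet field with `contractionOneForm` equal to `α` on vertical vectors: the trace
`γ^λ_{iλ}` is put into the component `λ = 0`. -/
def jetOfOneForm (α : LegendreModel n m →L[ℝ] ℝ) : BaseModel n →L[ℝ] LegendreModel n m :=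
  (ContinuousLinearMap.inl ℝ (BaseModel n × FibModel m) (MomModel n m)).comp
      (ContinuousLinearMap.inl ℝ (BaseModel n) (FibModel m)) +
    (∑ l, ∑ i, (-α (0, momVec l i)) • (EuclideanSpace.proj l : BaseModel n →L[ℝ] ℝ).smulRight
      (((0, fibVec i), 0) : LegendreModel n m)) +
    ∑ i, α ((0, fibVec i), 0) • (EuclideanSpace.proj 0 : BaseModel n →L[ℝ] ℝ).smulRight
      ((0, momVec 0 i) : LegendreModel n m)

theorem jetOfOneForm_apply (α : LegendreModel n m →L[ℝ] ℝ) (v : BaseModel n) :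
    jetOfOneForm α v = ((v, ∑ l, ∑ i, (-α (0, momVec l i) * v l) • fibVec i),
      ∑ i, (α ((0, fibVec i), 0) * v 0) • momVec 0 i) := by
  have hp : ∀ l, (EuclideanSpace.proj l : BaseModel n →L[ℝ] ℝ) v = v l := fun _ => rfl
  simp only [jetOfOneForm, add_apply, sum_apply, smul_apply, ContinuousLinearMap.comp_apply,
    ContinuousLinearMap.inl_apply, ContinuousLinearMap.smulRight_apply, smul_smul,
    hp]
  refine Prod.ext (Prod.ext ?_ ?_) ?_
  · simp [Prod.fst_sum]
  · simp [Prod.fst_sum, Prod.snd_sum]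
  · simp [Prod.snd_sum]

theorem contractionOneForm_jetOfOneForm (α : LegendreModel n m →L[ℝ] ℝ) {u : LegendreModel n m}
    (hu : u.1.1 = 0) : contractionOneForm (fun l => jetOfOneForm α (baseVec l)) u = α u := by
  refine eq_on_vertical (fun i => ?_) (fun l i => ?_) hu
  · rw [contractionOneForm_fib]
    simp only [jetOfOneForm_apply]
    have h : ∀ l : Fin (n + 1), momCoeff (∑ i', (α ((0, fibVec i'), 0) *
        (baseVec l : BaseModel n) 0) • momVec 0 i') l i =
          if l = 0 then α ((0, fibVec i), 0) else 0 := fun l => by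
      have h1 : ∀ p : MomModel n m, momCoeff p l i = (dP l i).comp
        (ContinuousLinearMap.inr ℝ (BaseModel n × FibModel m) (MomModel n m)) p := fun p => rfl
      have h2 : ∀ (a : ℝ) (p : MomModel n m), momCoeff (a • p) l i = a * momCoeff p l i :=
        fun _ _ => rfl
      rw [h1, map_sum]
      simp only [← h1]
      simp only [h2, momCoeff_momVec]
      by_cases hl : l = 0
      · simp [hl]
      · simp [hl]
    simp only [h]
    simp
  · rw [contractionOneForm_mom]
    simp only [jetOfOneForm_apply]
    simp [PiLp.single_apply, Pi.single_apply]

theorem contDiffOn_jetOfOneForm {s : Set (LegendreModel n m)}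
    {η : LegendreModel n m → LegendreModel n m →L[ℝ] ℝ} (hη : ContDiffOn ℝ ∞ η s) :
    ContDiffOn ℝ ∞ (fun w => jetOfOneForm (η w)) s := by
  refine ContDiffOn.add (ContDiffOn.add contDiffOn_const ?_) ?_
  · exact ContDiffOn.sum fun l _ => ContDiffOn.sum fun i _ =>
      (hη.clm_apply contDiffOn_const).neg.smul contDiffOn_const
  · exact ContDiffOn.sum fun i _ => (hη.clm_apply contDiffOn_const).smul contDiffOn_const

/-- A form whose differential is `dp^λ_i ∧ dy^i ∧ ω_λ + η ∧ ω` in one canonical chart has an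
associated jet field there. -/
theorem exists_isAssociatedJetFieldOn (hUo : IsOpen U)
    (hU : U ⊆ (canonicalChart hπ c).source) {H : LegendreForm hπ (n + 1)}
    (hH : IsSmoothFormOn U H) {η : LegendreModel n m → LegendreModel n m →L[ℝ] ℝ}
    (hη : ContDiffOn ℝ ∞ η (coordDomain hπ c U)) (h : ∀ w ∈ coordDomain hπ c U,
      extDeriv (LegendreForm.rep H c) w = canonicalTwoPart n m + wedge (η w) omegaX) :
    ∃ γ : LegendreJet hπ, IsAssociatedJetFieldOn U γ H := by
  let V : LegendreModel n m → BaseModel n →L[ℝ] LegendreModel n m := fun w => jetOfOneForm (η w)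
  have hV : ∀ w ∈ coordDomain hπ c U, LegendreJet.vecL (jetOfChart hπ c V) c w = V w :=
    fun w hw => vecL_jetOfChart V hw.1
  have hfst : ∀ w v, (V w v).1.1 = v := fun w v => by simp only [V, jetOfOneForm_apply]
  refine ⟨jetOfChart hπ c V, isAssociatedJetFieldOn_of_chart hUo hU
    (isJetFieldOn_of_chart hU (fun w hw v => by rw [hV w hw, hfst])
      ((contDiffOn_jetOfOneForm hη).congr hV)) hH fun w hw => ?_⟩
  have h1 : LegendreJet.contractOmega (jetOfChart hπ c V) c w =
      ∑ l, (multisymplecticComp l).curryLeft (V w (baseVec l)) := by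
    simp only [LegendreJet.contractOmega, LegendreJet.vec_eq, hV w hw]
  rw [h1, sum_curryLeft_multisymplecticComp _ fun l => hfst w _, h w hw]
  congr 1
  exact wedgeOne_omegaX_congr fun u hu => contractionOneForm_jetOfOneForm (η w) hu

/-- `dH = γ ⌋ Ω = dp^λ_i ∧ dy^i ∧ ω_λ + (γ^λ_{iλ} dy^i - γ^i_(λ) dp^λ_i) ∧ ω`. -/
theorem IsAssociatedJetFieldOn.extDeriv_eq {γ : LegendreJet hπ} {H : LegendreForm hπ (n + 1)}
    (hγ : IsAssociatedJetFieldOn U γ H) {w : LegendreModel n m} (hw : w ∈ coordDomain hπ c U) :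
    extDeriv (LegendreForm.rep H c) w =
      canonicalTwoPart n m + wedge (contractionOneForm (LegendreJet.vec γ c w)) omegaX := by
  rw [← hγ.2 c w hw, LegendreJet.contractOmega,
    sum_curryLeft_multisymplecticComp _ fun l => hγ.1.1.vec_fst hw l]

theorem IsJetFieldOn.contDiffOn_contractionOneForm {γ : LegendreJet hπ} (hγ : IsJetFieldOn U γ)
    (c : FibredChart n m π) : ContDiffOn ℝ ∞ (fun w => contractionOneForm (LegendreJet.vec γ c w))
      (coordDomain hπ c U) := by
  refine ContDiffOn.sum fun l _ => ContDiffOn.sum fun i _ => ContDiffOn.sub ?_ ?_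
  · exact ((dP l i).contDiff.comp_contDiffOn (hγ.2 c l)).smul contDiffOn_const
  · exact ((dY i).contDiff.comp_contDiffOn (hγ.2 c l)).smul contDiffOn_const

/-- The local shape of the differential of a Hamiltonian form. -/
theorem IsHamiltonianForm.exists_extDeriv_eq {H : LegendreForm hπ (n + 1)}
    (hH : IsHamiltonianForm H) (q : LegendreBundle hπ) :
    ∃ U : Set (LegendreBundle hπ), IsOpen U ∧ q ∈ U ∧ ∀ c : FibredChart n m π,
      ∃ η : LegendreModel n m → LegendreModel n m →L[ℝ] ℝ,
        ContDiffOn ℝ ∞ η (coordDomain hπ c U) ∧ ∀ w ∈ coordDomain hπ c U,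
          extDeriv (LegendreForm.rep H c) w = canonicalTwoPart n m + wedge (η w) omegaX := by
  obtain ⟨U, hU, hq, γ, hγ⟩ := hH.2 q
  exact ⟨U, hU, hq, fun c => ⟨_, hγ.1.1.contDiffOn_contractionOneForm c,
    fun w hw => hγ.extDeriv_eq hw⟩⟩

/-- The converse of `IsHamiltonianForm.exists_extDeriv_eq`: any such `η` comes from a jet field. -/
theorem isHamiltonianForm_of_extDeriv_eq {H : LegendreForm hπ (n + 1)}
    (hH : IsSmoothFormOn univ H)
    (h : ∀ q : LegendreBundle hπ, ∃ U : Set (LegendreBundle hπ), IsOpen U ∧ q ∈ U ∧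
      ∀ c : FibredChart n m π, ∃ η : LegendreModel n m → LegendreModel n m →L[ℝ] ℝ,
        ContDiffOn ℝ ∞ η (coordDomain hπ c U) ∧ ∀ w ∈ coordDomain hπ c U,
          extDeriv (LegendreForm.rep H c) w = canonicalTwoPart n m + wedge (η w) omegaX) :
    IsHamiltonianForm H := by
  refine ⟨hH, fun q => ?_⟩
  obtain ⟨U, hU, hq, h1⟩ := h q
  obtain ⟨c, hc⟩ := exists_canonicalChart hπ q
  obtain ⟨η, hη, h2⟩ := h1 c
  have hs : U ∩ (canonicalChart hπ c).source ⊆ U := inter_subset_left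
  have hUo : IsOpen (U ∩ (canonicalChart hπ c).source) := hU.inter (canonicalChart hπ c).open_source
  exact ⟨_, hUo, ⟨hq, hc⟩, exists_isAssociatedJetFieldOn hUo inter_subset_right
    (hH.mono (subset_univ _)) (hη.mono (coordDomain_mono hs))
    fun w hw => h2 w (coordDomain_mono hs hw)⟩

theorem IsHorizontalDensityOn.extDeriv_eq {D : LegendreForm hπ (n + 1)} (hU : IsOpen U)
    (hD : IsHorizontalDensityOn U D) {w : LegendreModel n m} (hw : w ∈ coordDomain hπ c U) :
    extDeriv (LegendreForm.rep D c) w =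
      wedge (fderiv ℝ (LegendreForm.omegaCoeff D c) w) omegaX := by
  have hn := (isOpen_coordDomain hπ c hU).mem_nhds hw
  have h1 : LegendreForm.rep D c =ᶠ[𝓝 w] fun w => LegendreForm.omegaCoeff D c w • omegaX := by
    filter_upwards [hn] with u hu using hD.rep_eq hu
  rw [h1.extDeriv_eq, extDeriv_smul_const]
  exact ((hD.1.contDiffOn_omegaCoeff c).contDiffAt hn).differentiableAt (by simp)

theorem IsSplitFormOn.extDeriv_eq {H : LegendreForm hπ (n + 1)} (hU : IsOpen U)
    (hH : IsSplitFormOn U H) {w : LegendreModel n m} (hw : w ∈ coordDomain hπ c U) :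
    extDeriv (LegendreForm.rep H c) w = canonicalTwoPart n m -
      wedge (fderiv ℝ (fun w => -LegendreForm.omegaCoeff H c w) w) omegaX := by
  have hn := (isOpen_coordDomain hπ c hU).mem_nhds hw
  have h1 : LegendreForm.rep H c =ᶠ[𝓝 w]
      fun w => momentumForm w.2 - (-LegendreForm.omegaCoeff H c w) • omegaX := by
    filter_upwards [hn] with u hu using hH.rep_eq hu
  rw [h1.extDeriv_eq, extDeriv_splitForm]
  exact (((hH.1.contDiffOn_omegaCoeff c).contDiffAt hn).differentiableAt (by simp)).neg

theorem IsHamiltonianForm.sub_density {H D : LegendreForm hπ (n + 1)} (hH : IsHamiltonianForm H)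
    (hD : IsHorizontalDensityOn univ D) : IsHamiltonianForm (H - D) := by
  refine isHamiltonianForm_of_extDeriv_eq (hH.1.sub hD.1) fun q => ?_
  obtain ⟨U, hU, hq, h1⟩ := hH.exists_extDeriv_eq q
  refine ⟨U, hU, hq, fun c => ?_⟩
  obtain ⟨η, hη, h2⟩ := h1 c
  have hDU := hD.mono (subset_univ U)
  refine ⟨fun w => η w - fderiv ℝ (LegendreForm.omegaCoeff D c) w,
    hη.sub ((hDU.1.contDiffOn_omegaCoeff c).fderiv_of_isOpen (isOpen_coordDomain hπ c hU)
      (by simp)), fun w hw => ?_⟩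
  rw [LegendreForm.extDeriv_rep_sub (hH.1.mono (subset_univ U)) hDU.1 hU hw, h2 w hw,
    hDU.extDeriv_eq hU hw, wedge_sub_left, add_sub_assoc]

theorem IsSplitFormOn.isHamiltonianForm {H : LegendreForm hπ (n + 1)}
    (hH : IsSplitFormOn univ H) : IsHamiltonianForm H := by
  refine isHamiltonianForm_of_extDeriv_eq hH.1 fun q => ⟨univ, isOpen_univ, mem_univ q, fun c =>
    ⟨fun w => -fderiv ℝ (fun w => -LegendreForm.omegaCoeff H c w) w,
      ((hH.1.contDiffOn_omegaCoeff c).neg.fderiv_of_isOpen (isOpen_coordDomain hπ c isOpen_univ)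
        (by simp)).neg, fun w hw => ?_⟩⟩
  rw [hH.extDeriv_eq isOpen_univ hw, sub_eq_add_neg, ← neg_one_smul ℝ (wedge _ _),
    ← wedge_smul_left, neg_one_smul]

/-! ### The Hamiltonian form of a connection -/

/-- The form `H_Γ`, which is defined by a preferred chart at each point, is `Γ̂ ⌋ θ` in every chart. -/
theorem rep_connHamiltonian {Γ : ConnForm n m π} (hΓ : IsConnection Γ) {w : LegendreModel n m}
    (hw : w ∈ (canonicalChart hπ c).target) :
    LegendreForm.rep (connHamiltonian hπ Γ) c w = ConnForm.contractTheta Γ c w := by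
  let c₀ := (legendreCore hπ).indexAt (c.total.symm w.1)
  have h0 : w ∈ overlap hπ c c₀ := ⟨hw, (mem_canonicalChart_source hπ c₀ _).2
    ((legendreCore hπ).mem_baseSet_at (c.total.symm w.1))⟩
  have h1 : LegendreForm.val (connHamiltonian hπ Γ) ((canonicalChart hπ c).symm w) =
      (ConnForm.contractTheta Γ c₀ (transition hπ c c₀ w)).compContinuousLinearMap
        (chartD hπ c₀ ((canonicalChart hπ c).symm w)) := rfl
  rw [LegendreForm.rep_eq, h1, ContinuousAlternatingMap.comp_comp, ← fderiv_transition_eq_comp h0,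
    hΓ.contractTheta_transition h0]

theorem IsConnection.contractTheta_eq {Γ : ConnForm n m π} (w : LegendreModel n m) :
    ConnForm.contractTheta Γ c w = momentumForm w.2 -
      (∑ l, ∑ i, momCoeff w.2 l i * (ConnForm.coeff Γ c w.1 (baseVec l)) i) • omegaX :=
  sum_curryLeft_thetaComp w.2 _ fun _ => rfl

theorem IsConnection.contDiffOn_coeff {Γ : ConnForm n m π} (hΓ : IsConnection Γ)
    (hπ : IsFibredManifold n m π) (l : Fin (n + 1)) (i : Fin m) :
    ContDiffOn ℝ ∞ (fun w : LegendreModel n m => (ConnForm.coeff Γ c w.1 (baseVec l)) i)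
      (canonicalChart hπ c).target := by
  have h1 : ContDiffOn ℝ ∞ (fun w : LegendreModel n m => ConnForm.coeff Γ c w.1)
      (canonicalChart hπ c).target :=
    (hΓ.2 c).comp contDiff_fst.contDiffOn fun w hw => (mem_canonicalChart_target hπ c w).1 hw
  exact (EuclideanSpace.proj i : FibModel m →L[ℝ] ℝ).contDiff.comp_contDiffOn
    (h1.clm_apply contDiffOn_const)

theorem IsConnection.isSplitFormOn {Γ : ConnForm n m π} (hΓ : IsConnection Γ)
    (hπ : IsFibredManifold n m π) : IsSplitFormOn univ (connHamiltonian hπ Γ) := by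
  have key : ∀ c : FibredChart n m π, ∀ w ∈ coordDomain hπ c univ,
      LegendreForm.rep (connHamiltonian hπ Γ) c w = momentumForm w.2 -
        (∑ l, ∑ i, momCoeff w.2 l i * (ConnForm.coeff Γ c w.1 (baseVec l)) i) • omegaX :=
    fun c w hw => by rw [rep_connHamiltonian hΓ hw.1, IsConnection.contractTheta_eq]
  refine ⟨fun c => ContDiffOn.congr ?_ (key c), fun c => ⟨_, key c⟩⟩
  rw [coordDomain_univ]
  refine ContDiffOn.sub_form contDiff_momentumForm.contDiffOn (ContDiffOn.smul_form ?_ omegaX)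
  exact ContDiffOn.sum fun l _ => ContDiffOn.sum fun i _ =>
    (contDiff_momCoeff l i).contDiffOn.mul (hΓ.contDiffOn_coeff hπ l i)

end HamiltonianForms

/-! ### Integrals depending on a parameter -/

theorem intervalIntegrable_param {E F : Type*} [TopologicalSpace E] [NormedAddCommGroup F]
    {W : Set (E × ℝ)} {g : E × ℝ → F} (hg : ContinuousOn g W) {x : E}
    (hx : ∀ t ∈ Icc (0 : ℝ) 1, (x, t) ∈ W) :
    IntervalIntegrable (fun t => g (x, t)) MeasureTheory.volume 0 1 := by
  refine ContinuousOn.intervalIntegrable ?_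
  rw [uIcc_of_le zero_le_one]
  exact hg.comp (by fun_prop) hx

section ParametricIntegral

universe u

variable {E F : Type u} [NormedAddCommGroup E] [NormedSpace ℝ E]
  [NormedAddCommGroup F] [NormedSpace ℝ F]

/-- Differentiation under the integral sign. The tube lemma bounds the derivative of the integrand
near the compact segment `{x} × [0, 1]`. -/
theorem hasFDerivAt_intervalIntegral_param {W : Set (E × ℝ)} (hW : IsOpen W) {S : Set E}
    (hS : IsOpen S) {g : E × ℝ → F} (hg : ContDiffOn ℝ ∞ g W)
    (hSW : ∀ x ∈ S, ∀ t ∈ Icc (0 : ℝ) 1, (x, t) ∈ W) {x : E} (hx : x ∈ S) :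
    HasFDerivAt (fun x => ∫ t in (0 : ℝ)..1, g (x, t))
      (∫ t in (0 : ℝ)..1, (fderiv ℝ g (x, t)).comp (ContinuousLinearMap.inl ℝ E ℝ)) x := by
  have hg' : ContinuousOn (fun p => (fderiv ℝ g p).comp (ContinuousLinearMap.inl ℝ E ℝ)) W :=
    (hg.continuousOn_fderiv_of_isOpen hW (by simp)).clm_comp continuousOn_const
  obtain ⟨C, hC⟩ := (isCompact_singleton (x := x)).prod (isCompact_Icc (a := (0 : ℝ)) (b := 1))
    |>.exists_bound_of_continuousOn (hg'.mono fun p hp => by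
      obtain ⟨h1, h2⟩ := hp
      rw [mem_singleton_iff] at h1
      have := hSW x hx _ h2
      rw [← h1] at this
      exact this)
  have hV : IsOpen (W ∩ (fun p => ‖(fderiv ℝ g p).comp (ContinuousLinearMap.inl ℝ E ℝ)‖) ⁻¹'
      Iio (C + 1)) := hg'.norm.isOpen_inter_preimage hW isOpen_Iio
  obtain ⟨u, v, hu, -, hxu, hv, huv⟩ := generalized_tube_lemma (isCompact_singleton (x := x))
    (isCompact_Icc (a := (0 : ℝ)) (b := 1)) hV (fun p hp => by
      refine ⟨?_, lt_of_le_of_lt (hC p hp) (lt_add_one C)⟩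
      obtain ⟨h1, h2⟩ := hp
      rw [mem_singleton_iff] at h1
      have := hSW x hx _ h2
      rw [← h1] at this
      exact this)
  have hI : ∀ t, t ∈ uIoc (0 : ℝ) 1 → t ∈ Icc (0 : ℝ) 1 := fun t ht => by
    rw [uIoc_of_le zero_le_one] at ht
    exact Ioc_subset_Icc_self ht
  refine intervalIntegral.hasFDerivAt_integral_of_dominated_of_fderiv_le (𝕜 := ℝ)
    (bound := fun _ => C + 1) (F' := fun x t =>
      (fderiv ℝ g (x, t)).comp (ContinuousLinearMap.inl ℝ E ℝ))
    (hu.mem_nhds (hxu rfl)) ?_ (intervalIntegrable_param hg.continuousOn (hSW x hx)) ?_ ?_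
    intervalIntegrable_const ?_
  · filter_upwards [hS.mem_nhds hx] with y hy
    exact (intervalIntegrable_param hg.continuousOn (hSW y hy)).def'.aestronglyMeasurable
  · exact (intervalIntegrable_param hg' (hSW x hx)).def'.aestronglyMeasurable
  · refine Filter.Eventually.of_forall fun t ht y hy => ?_
    exact (huv ⟨hy, hv (hI t ht)⟩ : (y, t) ∈ _).2.le
  · refine Filter.Eventually.of_forall fun t ht y hy => ?_
    have h1 : HasFDerivAt g (fderiv ℝ g (y, t)) (y, t) :=
      ((hg.contDiffAt (hW.mem_nhds (huv ⟨hy, hv (hI t ht)⟩ : (y, t) ∈ _).1)).differentiableAt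
        (by simp)).hasFDerivAt
    exact h1.comp y (hasFDerivAt_prodMk_left y t)

/-- An integral of a smooth function over `[0, 1]` is a smooth function of the parameter. The spaces
share a universe because the induction on the order replaces `F` by `E →L[ℝ] F`. -/
theorem contDiffOn_intervalIntegral_param {W : Set (E × ℝ)} (hW : IsOpen W) {S : Set E}
    (hS : IsOpen S) {g : E × ℝ → F} (hg : ContDiffOn ℝ ∞ g W)
    (hSW : ∀ x ∈ S, ∀ t ∈ Icc (0 : ℝ) 1, (x, t) ∈ W) :
    ContDiffOn ℝ ∞ (fun x => ∫ t in (0 : ℝ)..1, g (x, t)) S := by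
  rw [contDiffOn_infty]
  intro k
  induction k generalizing F with
  | zero =>
    exact contDiffOn_zero.2 fun x hx =>
      (hasFDerivAt_intervalIntegral_param hW hS hg hSW hx).continuousAt.continuousWithinAt
  | succ k ih =>
    have hg' : ContDiffOn ℝ ∞
        (fun p => (fderiv ℝ g p).comp (ContinuousLinearMap.inl ℝ E ℝ)) W :=
      (hg.fderiv_of_isOpen hW (by simp)).clm_comp contDiffOn_const
    have h := fun x hx => hasFDerivAt_intervalIntegral_param hW hS hg hSW (x := x) hx
    push_cast
    rw [contDiffOn_succ_iff_fderiv_of_isOpen hS]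
    refine ⟨fun x hx => (h x hx).differentiableAt.differentiableWithinAt, by simp, ?_⟩
    exact (ih hg').congr fun x hx => (h x hx).fderiv

end ParametricIntegral

/-! ### The fibrewise Poincaré lemma -/

section Poincare

variable {E : Type} [NormedAddCommGroup E] [NormedSpace ℝ E]

/-- A 1-form which is closed on the vectors fixed by a projection `P` ("vertical vectors") has a
potential with respect to the vertical directions, and the potential is smooth in all directions.
It is obtained by integrating along the vertical segments which start on the section through
`w₀`. -/
theorem exists_vertical_potential (P : E →L[ℝ] E) (hP : ∀ u, P (P u) = P u) {S : Set E}
    (hS : IsOpen S) (w₀ : E)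
    (hstar : ∀ w ∈ S, ∀ t ∈ Icc (0 : ℝ) 1, w - (1 - t) • P (w - w₀) ∈ S)
    {η : E → E →L[ℝ] ℝ} (hη : ContDiffOn ℝ ∞ η S)
    (hsymm : ∀ w ∈ S, ∀ u v, P u = u → P v = v → fderiv ℝ η w u v = fderiv ℝ η w v u) :
    ∃ f : E → ℝ, ContDiffOn ℝ ∞ f S ∧ ∀ w ∈ S, ∀ v, P v = v → fderiv ℝ f w v = η w v := by
  let r : E × ℝ → E := fun p => p.1 - (1 - p.2) • P (p.1 - w₀)
  have hr : ContDiff ℝ ∞ r := by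
    refine contDiff_fst.sub ((contDiff_const.sub contDiff_snd).smul ?_)
    exact P.contDiff.comp (contDiff_fst.sub contDiff_const)
  let W : Set (E × ℝ) := r ⁻¹' S
  have hW : IsOpen W := hS.preimage hr.continuous
  let g : E × ℝ → ℝ := fun p => η (r p) (P (p.1 - w₀))
  have hg : ContDiffOn ℝ ∞ g W := by
    refine (hη.comp hr.contDiffOn fun p hp => hp).clm_apply ?_
    exact (P.contDiff.comp (contDiff_fst.sub contDiff_const)).contDiffOn
  have hSW : ∀ x ∈ S, ∀ t ∈ Icc (0 : ℝ) 1, (x, t) ∈ W := hstar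
  refine ⟨_, contDiffOn_intervalIntegral_param hW hS hg hSW, fun w hw v hv => ?_⟩
  have hg' : ContinuousOn (fun p => (fderiv ℝ g p).comp (ContinuousLinearMap.inl ℝ E ℝ)) W :=
    (hg.continuousOn_fderiv_of_isOpen hW (by simp)).clm_comp continuousOn_const
  have hdη : ∀ t ∈ Icc (0 : ℝ) 1, HasFDerivAt η (fderiv ℝ η (r (w, t))) (r (w, t)) :=
    fun t ht => ((hη.contDiffAt (hS.mem_nhds (hstar w hw t ht))).differentiableAt
      (by simp)).hasFDerivAt
  let a : E := P (w - w₀)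
  have ha : P a = a := hP _
  -- the derivative of the integrand in a vertical direction
  have h1 : ∀ t ∈ Icc (0 : ℝ) 1, fderiv ℝ g (w, t) (v, 0) =
      t * fderiv ℝ η (r (w, t)) a v + η (r (w, t)) v := fun t ht => by
    have e1 : HasDerivAt (fun s : ℝ => w + s • v) v 0 := by
      simpa using ((hasDerivAt_id (0 : ℝ)).smul_const v).const_add w
    have e2 : HasDerivAt (fun s : ℝ => r (w + s • v, t)) (t • v) 0 := by
      have : HasDerivAt (fun s : ℝ => (w + s • v) - (1 - t) • P (w + s • v - w₀))
          (v - (1 - t) • P v) 0 :=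
        e1.sub ((P.hasFDerivAt.comp_hasDerivAt (0 : ℝ) (e1.sub_const w₀)).const_smul (1 - t))
      rw [hv] at this
      convert this using 1
      rw [sub_smul, one_smul, sub_sub_cancel]
    have e3 : HasDerivAt (fun s : ℝ => η (r (w + s • v, t))) (fderiv ℝ η (r (w, t)) (t • v)) 0 := by
      refine HasFDerivAt.comp_hasDerivAt (0 : ℝ) ?_ e2
      simpa using hdη t ht
    have e4 : HasDerivAt (fun s : ℝ => P (w + s • v - w₀)) v 0 := by
      have := P.hasFDerivAt.comp_hasDerivAt (0 : ℝ) (e1.sub_const w₀)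
      rwa [hv] at this
    have e5 : HasDerivAt (fun s : ℝ => g (w + s • v, t))
        (fderiv ℝ η (r (w, t)) (t • v) a + η (r (w, t)) v) 0 := by
      have := e3.clm_apply e4
      simp only [zero_smul, add_zero] at this
      exact this
    have e6 : HasDerivAt (fun s : ℝ => g (w + s • v, t)) (fderiv ℝ g (w, t) (v, 0)) 0 := by
      have h2 : HasFDerivAt g (fderiv ℝ g (w, t)) (w + (0 : ℝ) • v, t) := by
        rw [zero_smul, add_zero]
        exact ((hg.contDiffAt (hW.mem_nhds (hSW w hw t ht))).differentiableAt
          (by simp)).hasFDerivAt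
      exact HasFDerivAt.comp_hasDerivAt (0 : ℝ) h2 (e1.prodMk (hasDerivAt_const (0 : ℝ) t))
    rw [e6.unique e5, map_smul, smul_apply, smul_eq_mul,
      hsymm _ (hstar w hw t ht) v a hv ha]
  -- the integrand is a total derivative
  have h2 : ∀ t ∈ Icc (0 : ℝ) 1, HasDerivAt (fun t => t * η (r (w, t)) v)
      (fderiv ℝ g (w, t) (v, 0)) t := fun t ht => by
    have e1 : HasDerivAt (fun t : ℝ => r (w, t)) a t := by
      have : HasDerivAt (fun t : ℝ => w - (1 - t) • a) (-(-1 : ℝ) • a) t := by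
        simpa using (((hasDerivAt_id t).const_sub 1).smul_const a).const_sub w
      simpa using this
    have e2 : HasDerivAt (fun t : ℝ => η (r (w, t)) v) (fderiv ℝ η (r (w, t)) a v) t := by
      have e0 : HasDerivAt (fun t : ℝ => η (r (w, t))) (fderiv ℝ η (r (w, t)) a) t :=
        HasFDerivAt.comp_hasDerivAt (l := η) (f := fun t : ℝ => r (w, t)) t (hdη t ht) e1
      exact (ContinuousLinearMap.apply ℝ ℝ v).hasFDerivAt.comp_hasDerivAt t e0
    have e3 := (hasDerivAt_id t).mul e2
    rw [one_mul, add_comm] at e3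
    rw [h1 t ht]
    exact e3
  have hint : IntervalIntegrable (fun t => fderiv ℝ g (w, t) (v, 0)) MeasureTheory.volume 0 1 :=
    intervalIntegrable_param (g := fun p => fderiv ℝ g p (v, 0))
      (hg'.clm_apply continuousOn_const (g := fun _ => v)) (hSW w hw)
  rw [(hasFDerivAt_intervalIntegral_param hW hS hg hSW hw).fderiv,
    ContinuousLinearMap.intervalIntegral_apply (intervalIntegrable_param hg' (hSW w hw))]
  have h3 := intervalIntegral.integral_eq_sub_of_hasDerivAt (a := 0) (b := 1)
    (fun t ht => h2 t (by rwa [uIcc_of_le zero_le_one] at ht)) hint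
  refine h3.trans ?_
  simp [r]

end Poincare

/-! ### Forms whose differentials differ by `η ∧ ω` -/

section WedgeDerivative

variable {E : Type*} [NormedAddCommGroup E] [NormedSpace ℝ E] {r : ℕ}

open ContinuousAlternatingMap in
/-- The contraction of `d(η ∧ β)` with a vector annihilated by `β` measures the failure of `dη` to
vanish on this vector. -/
theorem curryLeft_extDeriv_wedge_const {η : E → E →L[ℝ] ℝ} {w : E} (hη : DifferentiableAt ℝ η w)
    {β : E [⋀^Fin (r + 1)]→L[ℝ] ℝ} {u : E} (hu : β.curryLeft u = 0) :
    (extDeriv (fun w => wedge (η w) β) w).curryLeft u =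
      wedge (fderiv ℝ η w u) β - wedge ((fderiv ℝ η w).flip u) β := by
  have h1 : extDeriv (fun w => wedge (η w) β) w =
      alternatizeUncurryFin (((wedgeL E (r + 1)).flip β).comp (fderiv ℝ η w)) := by
    have h2 : HasFDerivAt (fun w => wedge (η w) β)
        (((wedgeL E (r + 1)).flip β).comp (fderiv ℝ η w)) w :=
      ((wedgeL E (r + 1)).flip β).hasFDerivAt.comp w hη.hasFDerivAt
    rw [extDeriv, h2.fderiv]
  have h2 : ∀ v, (wedge (fderiv ℝ η w v) β).curryLeft u = fderiv ℝ η w v u • β := fun v => by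
    rw [curryLeft_wedge, hu, wedge_zero_right, sub_zero]
  have h3 : ∀ v (z : Fin (r + 1) → E), wedge (fderiv ℝ η w v) β (Matrix.vecCons u z) =
      fderiv ℝ η w v u * β z := fun v z => by
    have := congrArg (fun f => f z) (h2 v)
    simpa using this
  rw [h1]
  ext v
  rw [curryLeft_apply_apply, alternatizeUncurryFin_apply, Fin.sum_univ_succ, sub_eq_add_neg,
    ContinuousAlternatingMap.add_apply, ContinuousAlternatingMap.neg_apply,
    wedge_apply ((fderiv ℝ η w).flip u) β v,
    ← Finset.sum_neg_distrib]
  congr 1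
  · simp [Matrix.vecCons, Fin.removeNth_zero, wedgeL_eq]
  · refine Finset.sum_congr rfl fun k _ => ?_
    have h : k.succ.removeNth (Matrix.vecCons u v) = Matrix.vecCons u (k.removeNth v) := by
      funext j
      refine Fin.cases ?_ (fun j => ?_) j
      · simp [Fin.removeNth]
      · simp [Fin.removeNth]
    have h4 : (((wedgeL E (r + 1)).flip β).comp (fderiv ℝ η w)) (Matrix.vecCons u v k.succ) =
        wedge (fderiv ℝ η w (v k)) β := rfl
    rw [h, h4, h3]
    simp [pow_succ]

end WedgeDerivative

section LocalDifference

variable {n m : ℕ}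

/-- The projection to the vertical directions of the coordinate space of `Π → X`. -/
def verticalProj (n m : ℕ) : LegendreModel n m →L[ℝ] LegendreModel n m :=
  ((0 : BaseModel n →L[ℝ] BaseModel n).prodMap (ContinuousLinearMap.id ℝ (FibModel m))).prodMap
    (ContinuousLinearMap.id ℝ (MomModel n m))

theorem verticalProj_apply (u : LegendreModel n m) : verticalProj n m u = ((0, u.1.2), u.2) := rfl

theorem verticalProj_eq_iff (u : LegendreModel n m) : verticalProj n m u = u ↔ u.1.1 = 0 := by
  rw [verticalProj_apply]
  exact ⟨fun h => by rw [← h], fun h => Prod.ext (Prod.ext h.symm rfl) rfl⟩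

/-- The norm of the coordinate space is a maximum over its factors, so a ball contains the vertical
segment from each of its points to the section through its centre. -/
theorem ball_vertically_starConvex (w₀ : LegendreModel n m) (r : ℝ) {w : LegendreModel n m}
    (hw : w ∈ Metric.ball w₀ r) {t : ℝ} (ht : t ∈ Icc (0 : ℝ) 1) :
    w - (1 - t) • verticalProj n m (w - w₀) ∈ Metric.ball w₀ r := by
  rw [mem_ball_iff_norm] at hw ⊢
  refine lt_of_le_of_lt ?_ hw
  have h1 : w - (1 - t) • verticalProj n m (w - w₀) - w₀ =
      (((w - w₀).1.1, t • (w - w₀).1.2), t • (w - w₀).2) := by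
    rw [sub_right_comm, verticalProj_apply]
    generalize w - w₀ = z
    refine Prod.ext (Prod.ext ?_ ?_) ?_
    · simp
    · simp [sub_smul]
    · simp [sub_smul]
  rw [h1]
  generalize w - w₀ = z
  have ht' : ∀ {F : Type} [NormedAddCommGroup F] [NormedSpace ℝ F] (v : F), ‖t • v‖ ≤ ‖v‖ :=
    fun v => by
      rw [norm_smul, Real.norm_eq_abs, abs_of_nonneg ht.1]
      exact mul_le_of_le_one_left (norm_nonneg v) ht.2
  refine norm_prod_le_iff.2 ⟨norm_prod_le_iff.2 ⟨?_, ?_⟩, ?_⟩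
  · exact (norm_fst_le z.1).trans (norm_fst_le z)
  · exact (ht' _).trans ((norm_snd_le z.1).trans (norm_fst_le z))
  · exact (ht' _).trans (norm_snd_le z)

/-- If `η ∧ ω` is closed then `η` is closed on vertical vectors. -/
theorem fderiv_symm_of_extDeriv_wedge_omegaX {η : LegendreModel n m → LegendreModel n m →L[ℝ] ℝ}
    {w : LegendreModel n m} (hη : DifferentiableAt ℝ η w)
    (h : extDeriv (fun w => wedge (η w) omegaX) w = 0) {u v : LegendreModel n m}
    (hu : u.1.1 = 0) (hv : v.1.1 = 0) : fderiv ℝ η w u v = fderiv ℝ η w v u := by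
  have h1 := curryLeft_extDeriv_wedge_const hη (curryLeft_omegaX_of_vertical hu)
  have h2 : (0 : LegendreModel n m [⋀^Fin (n + 3)]→L[ℝ] ℝ).curryLeft u = 0 := rfl
  rw [h, h2, eq_comm, sub_eq_zero] at h1
  exact eq_of_wedgeOne_omegaX_eq h1 hv

/-- A form with differential `η ∧ ω` is a density modulo closed forms. -/
theorem exists_density_coeff {β : LegendreModel n m → LegendreModel n m [⋀^Fin (n + 1)]→L[ℝ] ℝ}
    {η : LegendreModel n m → LegendreModel n m →L[ℝ] ℝ} (w₀ : LegendreModel n m) (r : ℝ)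
    (hβ : ContDiffOn ℝ ∞ β (Metric.ball w₀ r)) (hη : ContDiffOn ℝ ∞ η (Metric.ball w₀ r))
    (hd : ∀ w ∈ Metric.ball w₀ r, extDeriv β w = wedge (η w) omegaX) :
    ∃ f : LegendreModel n m → ℝ, ContDiffOn ℝ ∞ f (Metric.ball w₀ r) ∧
      ∀ w ∈ Metric.ball w₀ r, wedge (fderiv ℝ f w) omegaX = extDeriv β w := by
  have hS : IsOpen (Metric.ball w₀ r) := Metric.isOpen_ball
  have hdd : ∀ w ∈ Metric.ball w₀ r, extDeriv (fun w => wedge (η w) omegaX) w = 0 :=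
    fun w hw => by
      have h3 : (fun w => wedge (η w) omegaX) =ᶠ[𝓝 w] extDeriv β := by
        filter_upwards [hS.mem_nhds hw] with u hu using (hd u hu).symm
      rw [h3.extDeriv_eq]
      exact extDeriv_extDeriv_apply (hβ.contDiffAt (hS.mem_nhds hw)) minSmoothness_two_le_infty
  have hdiff : ∀ w ∈ Metric.ball w₀ r, DifferentiableAt ℝ η w := fun w hw =>
    (hη.contDiffAt (hS.mem_nhds hw)).differentiableAt (by simp)
  obtain ⟨f, hf, hfη⟩ := exists_vertical_potential (verticalProj n m) (fun _ => rfl) hS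
    w₀ (fun w hw t ht => ball_vertically_starConvex _ r hw ht) hη
    fun w hw u v hu hv => fderiv_symm_of_extDeriv_wedge_omegaX (hdiff w hw) (hdd w hw)
      ((verticalProj_eq_iff u).1 hu) ((verticalProj_eq_iff v).1 hv)
  refine ⟨f, hf, fun w hw => ?_⟩
  rw [hd w hw]
  exact wedgeOne_omegaX_congr fun u hu => hfη w hw u ((verticalProj_eq_iff u).2 hu)

variable {X Y : Type*}
  [TopologicalSpace X] [ChartedSpace (BaseModel n) X]
  [TopologicalSpace Y] [ChartedSpace (BaseModel n × FibModel m) Y]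
  {π : Y → X} {hπ : IsFibredManifold n m π} {c : FibredChart n m π}
  {U : Set (LegendreBundle hπ)}

theorem isClosedFormOn_of_chart {r : ℕ} {H : LegendreForm hπ r} (hUo : IsOpen U)
    (hU : U ⊆ (canonicalChart hπ c).source) (hH : IsSmoothFormOn U H)
    (h : ∀ w ∈ coordDomain hπ c U, extDeriv (LegendreForm.rep H c) w = 0) :
    IsClosedFormOn U H := by
  intro c' w hw
  have hw' := coordDomain_subset_overlap hU hw
  have hw2 := (mem_coordDomain_iff (U := U) hw').2 hw
  rw [LegendreForm.extDeriv_rep_transition H hw' (hH.differentiableAt hUo hw2), h _ hw2]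
  rfl

/-- A form whose differential is `η ∧ ω` around `q` is a density modulo closed forms there. -/
theorem exists_density_of_extDeriv_eq {H : LegendreForm hπ (n + 1)} {q : LegendreBundle hπ}
    (hUo : IsOpen U) (hH : IsSmoothFormOn U H) (hq : q ∈ U)
    (hc : q ∈ (canonicalChart hπ c).source) {η : LegendreModel n m → LegendreModel n m →L[ℝ] ℝ}
    (hη : ContDiffOn ℝ ∞ η (coordDomain hπ c U))
    (hd : ∀ w ∈ coordDomain hπ c U, extDeriv (LegendreForm.rep H c) w = wedge (η w) omegaX) :
    ∃ U : Set (LegendreBundle hπ), IsOpen U ∧ q ∈ U ∧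
      ∃ D : LegendreForm hπ (n + 1), IsHorizontalDensityOn U D ∧ IsClosedFormOn U (H - D) := by
  obtain ⟨r, hr, hball⟩ := Metric.isOpen_iff.1 (isOpen_coordDomain hπ c hUo) _
    (canonicalChart_mem_coordDomain hc hq)
  obtain ⟨f, hf, hfd⟩ := exists_density_coeff (canonicalChart hπ c q) r ((hH c).mono hball)
    (hη.mono hball) fun w hw => hd w (hball hw)
  let V := U ∩ ((canonicalChart hπ c).source ∩
    canonicalChart hπ c ⁻¹' Metric.ball (canonicalChart hπ c q) r)
  have hVo : IsOpen V :=
    hUo.inter ((canonicalChart hπ c).isOpen_inter_preimage Metric.isOpen_ball)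
  have hVs : V ⊆ (canonicalChart hπ c).source := fun x hx => hx.2.1
  have hVb : coordDomain hπ c V ⊆ Metric.ball (canonicalChart hπ c q) r := fun w hw => by
    have h3 : canonicalChart hπ c ((canonicalChart hπ c).symm w) ∈
      Metric.ball (canonicalChart hπ c q) r := hw.2.2.2
    rwa [(canonicalChart hπ c).right_inv hw.1] at h3
  have hD : IsHorizontalDensityOn V (densityOfChart hπ c f) :=
    isHorizontalDensityOn_of_chart hVs (hf.mono hVb) fun w hw => rep_densityOfChart f hw.1
  have hHV : IsSmoothFormOn V H := hH.mono inter_subset_left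
  refine ⟨V, hVo, ⟨hq, hc, Metric.mem_ball_self hr⟩, _, hD,
    isClosedFormOn_of_chart hVo hVs (hHV.sub hD.1) fun w hw => ?_⟩
  have h4 : LegendreForm.rep (densityOfChart hπ c f) c =ᶠ[𝓝 w] fun w => f w • omegaX := by
    filter_upwards [(isOpen_coordDomain hπ c hVo).mem_nhds hw] with u hu
      using rep_densityOfChart f hu.1
  have hfw : DifferentiableAt ℝ f w :=
    (hf.contDiffAt (Metric.isOpen_ball.mem_nhds (hVb hw))).differentiableAt (by simp)
  rw [LegendreForm.extDeriv_rep_sub hHV hD.1 hVo hw, h4.extDeriv_eq, extDeriv_smul_const hfw,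
    hfd w (hVb hw), sub_self]

/-- Locally modulo closed forms, Hamiltonian forms differ by horizontal densities. -/
theorem IsHamiltonianForm.exists_density {H H' : LegendreForm hπ (n + 1)}
    (hH : IsHamiltonianForm H) (hH' : IsHamiltonianForm H') (q : LegendreBundle hπ) :
    ∃ U : Set (LegendreBundle hπ), IsOpen U ∧ q ∈ U ∧
      ∃ D : LegendreForm hπ (n + 1), IsHorizontalDensityOn U D ∧
        IsClosedFormOn U (H - H' - D) := by
  obtain ⟨U₁, hU₁, hq₁, h₁⟩ := hH.exists_extDeriv_eq q
  obtain ⟨U₂, hU₂, hq₂, h₂⟩ := hH'.exists_extDeriv_eq q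
  obtain ⟨c, hc⟩ := exists_canonicalChart hπ q
  obtain ⟨η₁, hη₁, h₁⟩ := h₁ c
  obtain ⟨η₂, hη₂, h₂⟩ := h₂ c
  have hs₁ : coordDomain hπ c (U₁ ∩ U₂) ⊆ coordDomain hπ c U₁ := coordDomain_mono inter_subset_left
  have hs₂ : coordDomain hπ c (U₁ ∩ U₂) ⊆ coordDomain hπ c U₂ :=
    coordDomain_mono inter_subset_right
  have hU : IsOpen (U₁ ∩ U₂) := hU₁.inter hU₂
  have hHU := hH.1.mono (subset_univ (U₁ ∩ U₂))
  have hHU' := hH'.1.mono (subset_univ (U₁ ∩ U₂))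
  refine exists_density_of_extDeriv_eq hU (hHU.sub hHU') ⟨hq₁, hq₂⟩ hc
    (η := fun w => η₁ w - η₂ w) ((hη₁.mono hs₁).sub (hη₂.mono hs₂)) fun w hw => ?_
  rw [LegendreForm.extDeriv_rep_sub hHU hHU' hU hw, h₁ w (hs₁ hw), h₂ w (hs₂ hw),
    wedge_sub_left, add_sub_add_left_eq_sub]

/-- Locally modulo closed forms, a Hamiltonian form splits with respect to any connection. -/
theorem IsHamiltonianForm.exists_splitting {H : LegendreForm hπ (n + 1)}
    (hH : IsHamiltonianForm H) {Γ : ConnForm n m π} (hΓ : IsConnection Γ)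
    (q : LegendreBundle hπ) :
    ∃ U : Set (LegendreBundle hπ), IsOpen U ∧ q ∈ U ∧
      ∃ D : LegendreForm hπ (n + 1), IsHorizontalDensityOn U D ∧
        IsSplitFormOn U (connHamiltonian hπ Γ - D) ∧
        IsClosedFormOn U (H - (connHamiltonian hπ Γ - D)) := by
  have hs := hΓ.isSplitFormOn hπ
  obtain ⟨U, hU, hq, D, hD, hcl⟩ := hs.isHamiltonianForm.exists_density hH q
  have hsU := hs.mono (subset_univ U)
  have hHU := hH.1.mono (subset_univ U)
  refine ⟨U, hU, hq, D, hD, hsU.sub_density hD, fun c w hw => ?_⟩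
  have h1 := hcl c w hw
  rw [LegendreForm.extDeriv_rep_sub (hsU.1.sub hHU) hD.1 hU hw,
    LegendreForm.extDeriv_rep_sub hsU.1 hHU hU hw] at h1
  rw [LegendreForm.extDeriv_rep_sub hHU (hsU.1.sub hD.1) hU hw,
    LegendreForm.extDeriv_rep_sub hsU.1 hD.1 hU hw, ← neg_eq_zero, ← h1]
  abel

end LocalDifference

/-! ### Existence of connections -/

section Existence

variable {n m : ℕ} {X Y : Type*}
  [TopologicalSpace X] [ChartedSpace (BaseModel n) X]
  [TopologicalSpace Y] [ChartedSpace (BaseModel n × FibModel m) Y]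
  {π : Y → X} {c c' : FibredChart n m π}

/-- The flat connection of a fibred chart. -/
def chartConnection (c : FibredChart n m π) (y : Y) : BaseModel n →L[ℝ] BaseModel n × FibModel m :=
  (totalDSymm c (c.total y)).comp
    ((ContinuousLinearMap.inl ℝ (BaseModel n) (FibModel m)).comp (baseD c (π y)))

theorem liftL_chartConnection {y : Y} (hy : y ∈ c.total.source) :
    ConnForm.liftL (chartConnection c) c (c.total y) =
      ContinuousLinearMap.inl ℝ (BaseModel n) (FibModel m) := by
  have hb := c.mapsTo y hy
  have h1 : ConnForm.liftL (chartConnection c) c (c.total y) =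
      (totalD c (c.total.symm (c.total y))).comp
        ((chartConnection c (c.total.symm (c.total y))).comp (baseDSymm c (c.total y).1)) := rfl
  have h2 := totalD_comp_totalDSymm (c := c) (c.total.map_source hy)
  have h3 := baseD_comp_baseDSymm (c := c) (c.base.map_source hb)
  rw [c.total.left_inv hy] at h2
  rw [c.base.left_inv hb] at h3
  rw [h1, c.total.left_inv hy, c.fst_eq y hy, chartConnection]
  simp only [ContinuousLinearMap.comp_assoc]
  rw [h3, ContinuousLinearMap.comp_id, comp_id_cancel h2]

theorem projD_chartConnection (hπ : IsFibredManifold n m π) {y : Y} (hy : y ∈ c.total.source) :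
    (projD π y).comp (chartConnection c y) = ContinuousLinearMap.id ℝ _ := by
  refine (ConnForm.liftL_fst_iff (c := c) hπ (chartConnection c) hy).1 ?_
  rw [liftL_chartConnection hy]
  rfl

/-- Passing to the coefficients in the coordinates of `c` is linear. -/
def coeffL (c : FibredChart n m π) (y : Y) :
    (BaseModel n →L[ℝ] BaseModel n × FibModel m) →L[ℝ] (BaseModel n →L[ℝ] FibModel m) :=
  (ContinuousLinearMap.compL ℝ _ _ _ ((ContinuousLinearMap.snd ℝ (BaseModel n) (FibModel m)).comp
    (totalD c y))).comp ((ContinuousLinearMap.compL ℝ _ _ _).flip (baseDSymm c (c.total y).1))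

theorem coeff_eq_coeffL (Γ : ConnForm n m π) (c : FibredChart n m π)
    {z : BaseModel n × FibModel m} (hz : z ∈ c.total.target) :
    ConnForm.coeff Γ c z = coeffL c (c.total.symm z) (ConnForm.val Γ (c.total.symm z)) := by
  have h : coeffL c (c.total.symm z) (ConnForm.val Γ (c.total.symm z)) =
      ((ContinuousLinearMap.snd ℝ (BaseModel n) (FibModel m)).comp
        (totalD c (c.total.symm z))).comp ((ConnForm.val Γ (c.total.symm z)).comp
          (baseDSymm c (c.total (c.total.symm z)).1)) := rfl
  rw [h, c.total.right_inv hz]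
  rfl

theorem contMDiffOn_baseJac (c c' : FibredChart n m π) :
    ContMDiffOn 𝓘(ℝ, BaseModel n × FibModel m) 𝓘(ℝ, BaseModel n →L[ℝ] BaseModel n) ∞
      (FibredChart.baseJac c c') (c.total.source ∩ c'.total.source) := by
  have h2 : ContMDiffOn 𝓘(ℝ, BaseModel n × FibModel m) 𝓘(ℝ, BaseModel n) ∞
      (fun y => (c.total y).1) (c.total.source ∩ c'.total.source) :=
    (contDiff_fst.contMDiff).comp_contMDiffOn
      ((contMDiffOn_of_mem_maximalAtlas c.total_mem).mono inter_subset_left)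
  refine ((contDiffOn_baseJac_overlap c c').contMDiffOn.comp h2 ?_).congr ?_
  · intro y hy
    have := c.mapsTo y hy.1
    simp [c.fst_eq y hy.1, this, c'.mapsTo y hy.2, c.base.map_source this]
  · intro y hy
    simp [FibredChart.baseJac, jac, c.fst_eq y hy.1]

/-- The flat connection of a chart has smooth coefficients in every other fibred chart. -/
theorem contMDiffOn_coeff_chartConnection (c c' : FibredChart n m π) :
    ContMDiffOn 𝓘(ℝ, BaseModel n × FibModel m) 𝓘(ℝ, BaseModel n →L[ℝ] FibModel m) ∞
      (fun y => coeffL c y (chartConnection c' y)) (c'.total.source ∩ c.total.source) := by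
  have h1 := contDiffOn_jac c'.total_mem c.total_mem
  have h2 := contMDiffOn_baseJac c c'
  rw [inter_comm] at h2
  have h3 : ContMDiffOn 𝓘(ℝ, BaseModel n × FibModel m)
      𝓘(ℝ, (BaseModel n × FibModel m) →L[ℝ] FibModel m) ∞
      (fun y => (ContinuousLinearMap.snd ℝ (BaseModel n) (FibModel m)).comp
        (jac c'.total c.total y)) (c'.total.source ∩ c.total.source) :=
    contMDiffOn_const.clm_comp h1
  have h4 : ContMDiffOn 𝓘(ℝ, BaseModel n × FibModel m)
      𝓘(ℝ, BaseModel n →L[ℝ] BaseModel n × FibModel m) ∞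
      (fun y => (ContinuousLinearMap.inl ℝ (BaseModel n) (FibModel m)).comp
        (FibredChart.baseJac c c' y)) (c'.total.source ∩ c.total.source) :=
    contMDiffOn_const.clm_comp h2
  refine (h3.clm_comp h4).congr fun y hy => ?_
  have h5 := ConnForm.liftL_transition (c := c') (c' := c) (chartConnection c') hy.1 hy.2
  rw [liftL_chartConnection hy.1] at h5
  have h6 := coeff_eq_coeffL (chartConnection c') c (c.total.map_source hy.2)
  rw [c.total.left_inv hy.2] at h6
  refine h6.symm.trans ?_
  exact congrArg (fun A => (ContinuousLinearMap.snd ℝ (BaseModel n) (FibModel m)).comp A) h5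

/-- Connections exist: glue the flat connections of fibred charts by a partition of unity. -/
theorem exists_isConnection [T2Space Y] [SecondCountableTopology Y]
    [IsManifold 𝓘(ℝ, BaseModel n × FibModel m) ∞ Y] (hπ : IsFibredManifold n m π) :
    ∃ Γ : ConnForm n m π, IsConnection Γ := by
  have : LocallyCompactSpace Y := ChartedSpace.locallyCompactSpace (BaseModel n × FibModel m) Y
  obtain ⟨ρ, hρ⟩ := SmoothPartitionOfUnity.exists_isSubordinate
    𝓘(ℝ, BaseModel n × FibModel m) isClosed_univ
    (fun c : FibredChart n m π => c.total.source) (fun c => c.total.open_source) fun y _ => by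
      obtain ⟨c, hc⟩ := hπ.exists_fibredChart y
      exact mem_iUnion_of_mem c hc
  let Γ : Y → BaseModel n →L[ℝ] BaseModel n × FibModel m :=
    fun y => ∑ c ∈ ρ.finsupport y, ρ c y • chartConnection c y
  have hs : ∀ y, ∀ c ∈ ρ.finsupport y, y ∈ c.total.source := fun y c hc =>
    hρ c (subset_tsupport _ ((ρ.mem_finsupport y).1 hc))
  refine ⟨Γ, fun y => ?_, fun c => ?_⟩
  · have h1 : (projD π y).comp (Γ y) = ContinuousLinearMap.id ℝ (BaseModel n) := by
      refine ContinuousLinearMap.ext fun v => ?_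
      have h2 : ∀ c ∈ ρ.finsupport y, ρ c y • projD π y (chartConnection c y v) = ρ c y • v :=
        fun c hc => by
          congr 1
          exact congrArg (fun A => A v) (projD_chartConnection hπ (hs y c hc))
      simp only [Γ, ContinuousLinearMap.comp_apply, sum_apply, map_sum, smul_apply, map_smul]
      rw [Finset.sum_congr rfl h2, ← Finset.sum_smul, ρ.sum_finsupport y (mem_univ y), one_smul]
      rfl
    exact h1
  · have h1 : ContMDiffOn 𝓘(ℝ, BaseModel n × FibModel m) 𝓘(ℝ, BaseModel n →L[ℝ] FibModel m) ∞
        (fun y => coeffL c y (Γ y)) c.total.source := fun y hy => by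
      have h2 : (fun y => coeffL c y (Γ y)) =
          fun y => ∑ᶠ i, ρ i y • coeffL c y (chartConnection i y) := by
        funext y
        rw [← ρ.sum_finsupport_smul_eq_finsum y (fun i y => coeffL c y (chartConnection i y))]
        simp only [Γ, map_sum, map_smul]
      rw [h2]
      refine (ρ.contMDiffAt_finsum fun i hi => ?_).contMDiffWithinAt
      exact (contMDiffOn_coeff_chartConnection c i).contMDiffAt
        ((i.total.open_source.inter c.total.open_source).mem_nhds ⟨hρ i hi, hy⟩)
    rw [← contMDiffOn_iff_contDiffOn]
    exact (h1.comp (contMDiffOn_symm_of_mem_maximalAtlas c.total_mem)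
      fun z hz => c.total.map_target hz).congr fun z hz => coeff_eq_coeffL Γ c hz

end Existence

/-! ### The connection induced by a Hamiltonian form -/

section FormSmoothness

variable {E : Type*} [NormedAddCommGroup E] [NormedSpace ℝ E] {r : ℕ}
  {s : Set E} {β β' : E → E [⋀^Fin r]→L[ℝ] ℝ}

theorem ContDiffOn.add_form (h : ContDiffOn ℝ ∞ β s) (h' : ContDiffOn ℝ ∞ β' s) :
    ContDiffOn ℝ ∞ (fun w => β w + β' w) s :=
  h.add h'

theorem ContDiffOn.const_smul_form (h : ContDiffOn ℝ ∞ β s) (a : ℝ) :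
    ContDiffOn ℝ ∞ (fun w => a • β w) s :=
  ContDiffOn.smul (f := fun _ => a) contDiffOn_const h

theorem contDiffOn_zero_form : ContDiffOn ℝ ∞ (fun _ : E => (0 : E [⋀^Fin r]→L[ℝ] ℝ)) s :=
  contDiffOn_const

end FormSmoothness

section InducedConnection

variable {n m : ℕ} {X Y : Type*}
  [TopologicalSpace X] [ChartedSpace (BaseModel n) X]
  [TopologicalSpace Y] [ChartedSpace (BaseModel n × FibModel m) Y]
  {π : Y → X} {hπ : IsFibredManifold n m π} {c c' : FibredChart n m π}
  {U U' : Set (LegendreBundle hπ)}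

/-- The projection `J¹Π → J¹Y` of a jet field, at the point `q`. -/
def LegendreJet.bundleVal (γ : LegendreJet hπ) (q : LegendreBundle hπ) :
    BaseModel n →L[ℝ] BaseModel n × FibModel m :=
  (bundleD hπ q).comp (LegendreJet.val γ q)

/-- The projection `J¹Π → J¹Y` forgets the momentum components `γ^μ_{iλ}`. -/
theorem LegendreJet.bundleVal_eq (γ : LegendreJet hπ) {q : LegendreBundle hπ}
    (hq : q ∈ (canonicalChart hπ c).source) :
    LegendreJet.bundleVal γ q = (totalDSymm c (c.total q.proj)).comp
      (((ContinuousLinearMap.fst ℝ _ _).comp (LegendreJet.vecL γ c (canonicalChart hπ c q))).comp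
        (baseD c (π q.proj))) := by
  have hy := (mem_canonicalChart_source hπ c q).1 hq
  have h1 := LegendreJet.fst_vecL γ ((canonicalChart hπ c).map_source hq)
  rw [(canonicalChart hπ c).left_inv hq, canonicalChart_apply_fst, c.total.left_inv hy,
    c.fst_eq _ hy] at h1
  rw [h1]
  simp only [ContinuousLinearMap.comp_assoc]
  rw [comp_id_cancel (totalDSymm_comp_totalD hy), baseDSymm_comp_baseD (c.mapsTo _ hy),
    ContinuousLinearMap.comp_id]
  rfl

theorem baseModel_clm_ext {F : Type*} [NormedAddCommGroup F] [NormedSpace ℝ F]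
    {A B : BaseModel n →L[ℝ] F} (h : ∀ l, A (baseVec l) = B (baseVec l)) : A = B := by
  refine ContinuousLinearMap.ext fun v => ?_
  rw [← euclidean_sum_single v, map_sum, map_sum]
  exact Finset.sum_congr rfl fun l _ => by rw [map_smul, map_smul, h l]

/-- The components `γ^i_(λ)` of a jet field are determined by the form with which it is
associated. -/
theorem IsAssociatedJetFieldOn.bundleVal_eq_bundleVal {γ γ' : LegendreJet hπ}
    {H : LegendreForm hπ (n + 1)} (hγ : IsAssociatedJetFieldOn U γ H)
    (hγ' : IsAssociatedJetFieldOn U' γ' H) {q : LegendreBundle hπ} (hq : q ∈ U) (hq' : q ∈ U') :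
    LegendreJet.bundleVal γ q = LegendreJet.bundleVal γ' q := by
  obtain ⟨c, hc⟩ := exists_canonicalChart hπ q
  have hw := canonicalChart_mem_coordDomain hc hq
  have hw' := canonicalChart_mem_coordDomain hc hq'
  rw [LegendreJet.bundleVal_eq γ hc, LegendreJet.bundleVal_eq γ' hc]
  congr 2
  refine baseModel_clm_ext fun l => ?_
  have h1 := (hγ.extDeriv_eq hw).symm.trans (hγ'.extDeriv_eq hw')
  have h2 : ∀ i, (LegendreJet.vec γ c (canonicalChart hπ c q) l).1.2 i =
      (LegendreJet.vec γ' c (canonicalChart hπ c q) l).1.2 i := fun i => by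
    rw [← neg_inj, ← contractionOneForm_mom, ← contractionOneForm_mom]
    exact eq_of_wedgeOne_omegaX_eq (add_left_cancel h1) rfl
  exact Prod.ext ((hγ.1.1.vec_fst hw l).trans (hγ'.1.1.vec_fst hw' l).symm)
    (PiLp.ext h2)

theorem coeff_eq_of_bundleVal {Γ : ConnForm n m π} {γ : LegendreJet hπ}
    {z : BaseModel n × FibModel m} (hz : z ∈ c.total.target)
    (h : ConnForm.val Γ (c.total.symm z) =
      LegendreJet.bundleVal γ (legendreZero hπ (c.total.symm z))) (v : BaseModel n) :
    ConnForm.coeff Γ c z v = (LegendreJet.vecL γ c (z, 0) v).1.2 := by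
  have h1 := LegendreJet.fst_vecL γ ((mem_canonicalChart_target hπ c (z, 0)).2 hz)
  have h2 : ConnForm.liftL Γ c z = (ContinuousLinearMap.fst ℝ _ _).comp
      (LegendreJet.vecL γ c (z, 0)) := by
    rw [h1, ConnForm.liftL, h, LegendreJet.bundleVal, canonicalChart_symm_zero]
    rfl
  exact congrArg (fun A : BaseModel n →L[ℝ] BaseModel n × FibModel m => (A v).2) h2

/-- A section of `J¹Y` which is locally the projection of jet fields associated with `H`, along the
zero section, is the connection induced by `H`. -/
theorem isInducedConnection_of_local {H : LegendreForm hπ (n + 1)} {Γ : ConnForm n m π}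
    (hΓ : ∀ y : Y, ∃ (U : Set (LegendreBundle hπ)) (γ : LegendreJet hπ), IsOpen U ∧
      IsAssociatedJetFieldOn U γ H ∧ legendreZero hπ y ∈ U ∧
        ConnForm.val Γ y = LegendreJet.bundleVal γ (legendreZero hπ y)) :
    IsInducedConnection H Γ := by
  have huniq : ∀ (U : Set (LegendreBundle hπ)) (γ : LegendreJet hπ), IsOpen U →
      IsAssociatedJetFieldOn U γ H → ∀ y : Y, legendreZero hπ y ∈ U →
        ConnForm.val Γ y = LegendreJet.bundleVal γ (legendreZero hπ y) := fun U γ _ hγ y hy => by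
    obtain ⟨U', γ', -, hγ', hy', h1⟩ := hΓ y
    rw [h1, hγ'.bundleVal_eq_bundleVal hγ hy' hy]
  refine ⟨⟨fun y => ?_, fun c z₀ hz₀ => ?_⟩, huniq⟩
  · obtain ⟨U, γ, -, hγ, hy, h1⟩ := hΓ y
    have h2 : (legendreProjD hπ (legendreZero hπ y)).comp
        (LegendreJet.val γ (legendreZero hπ y)) = ContinuousLinearMap.id ℝ (BaseModel n) :=
      hγ.1.1.1 _ hy
    have h3 : (projD π y).comp (ConnForm.val Γ y) = ContinuousLinearMap.id ℝ (BaseModel n) := by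
      rw [h1, ← h2, legendreProjD_eq]
      rfl
    exact h3
  · obtain ⟨U, γ, hU, hγ, hy, -⟩ := hΓ (c.total.symm z₀)
    have hw₀ : (z₀, (0 : MomModel n m)) ∈ coordDomain hπ c U :=
      ⟨(mem_canonicalChart_target hπ c _).2 hz₀, by
        rw [mem_preimage, canonicalChart_symm_zero]; exact hy⟩
    have hi : ContDiff ℝ ∞ (fun z : BaseModel n × FibModel m => (z, (0 : MomModel n m))) :=
      contDiff_id.prodMk contDiff_const
    have hN : (fun z : BaseModel n × FibModel m => (z, (0 : MomModel n m))) ⁻¹'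
        coordDomain hπ c U ∈ 𝓝 z₀ :=
      ((isOpen_coordDomain hπ c hU).preimage hi.continuous).mem_nhds hw₀
    have h1 : ContDiffOn ℝ ∞ (fun z : BaseModel n × FibModel m => ∑ l,
        (EuclideanSpace.proj l : BaseModel n →L[ℝ] ℝ).smulRight
          (LegendreJet.vec γ c (z, 0) l).1.2)
        ((fun z : BaseModel n × FibModel m => (z, (0 : MomModel n m))) ⁻¹'
          coordDomain hπ c U) := by
      refine ContDiffOn.sum fun l _ => ?_
      have h2 := (hγ.1.1.2 c l).comp hi.contDiffOn fun z hz => hz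
      exact (ContinuousLinearMap.smulRightL ℝ (BaseModel n) (FibModel m)
        (EuclideanSpace.proj l)).contDiff.comp_contDiffOn h2.fst.snd
    refine ((h1.contDiffAt hN).congr_of_eventuallyEq ?_).contDiffWithinAt
    filter_upwards [hN] with z hz
    have hz' : z ∈ c.total.target := (mem_canonicalChart_target hπ c (z, 0)).1 hz.1
    have hzU : legendreZero hπ (c.total.symm z) ∈ U := by
      rw [← canonicalChart_symm_zero]; exact hz.2
    refine baseModel_clm_ext fun k => ?_
    rw [coeff_eq_of_bundleVal hz' (huniq U γ hU hγ _ hzU), sum_apply, Finset.sum_eq_single k]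
    · simp [LegendreJet.vec_eq]
    · intro l _ hl
      simp [hl]
    · simp

/-- The components `γ^i_(λ)` of the local jet fields associated with `H` agree, hence glue along the
zero section to a connection. -/
theorem IsHamiltonianForm.exists_isInducedConnection {H : LegendreForm hπ (n + 1)}
    (hH : IsHamiltonianForm H) : ∃ Γ : ConnForm n m π, IsInducedConnection H Γ := by
  choose U hU hq γ hγ using hH.2
  let Γ : Y → BaseModel n →L[ℝ] BaseModel n × FibModel m :=
    fun y => LegendreJet.bundleVal (γ (legendreZero hπ y)) (legendreZero hπ y)
  exact ⟨Γ, isInducedConnection_of_local fun y => ⟨_, _, hU (legendreZero hπ y),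
    hγ (legendreZero hπ y), hq (legendreZero hπ y), rfl⟩⟩

theorem IsInducedConnection.unique {H : LegendreForm hπ (n + 1)} (hH : IsHamiltonianForm H)
    {Γ Γ' : ConnForm n m π} (hΓ : IsInducedConnection H Γ) (hΓ' : IsInducedConnection H Γ') :
    Γ = Γ' := by
  funext y
  obtain ⟨U, hU, hq, γ, hγ⟩ := hH.2 (legendreZero hπ y)
  rw [hΓ.2 U γ hU hγ y hq, hΓ'.2 U γ hU hγ y hq]

/-- The coefficients of the induced connection are read off from `dH`. -/
theorem IsInducedConnection.coeff_eq {H : LegendreForm hπ (n + 1)} (hH : IsHamiltonianForm H)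
    {Γ : ConnForm n m π} (hΓ : IsInducedConnection H Γ) {z : BaseModel n × FibModel m}
    (hz : z ∈ c.total.target) {η : LegendreModel n m →L[ℝ] ℝ}
    (hη : extDeriv (LegendreForm.rep H c) (z, 0) = canonicalTwoPart n m + wedge η omegaX)
    (l : Fin (n + 1)) (i : Fin m) :
    (ConnForm.coeff Γ c z (baseVec l)) i = -η (0, momVec l i) := by
  obtain ⟨U, hU, hq, γ, hγ⟩ := hH.2 (legendreZero hπ (c.total.symm z))
  have hw : (z, (0 : MomModel n m)) ∈ coordDomain hπ c U :=
    ⟨(mem_canonicalChart_target hπ c _).2 hz, by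
      rw [mem_preimage, canonicalChart_symm_zero]; exact hq⟩
  rw [coeff_eq_of_bundleVal hz (hΓ.2 U γ hU hγ _ hq), ← LegendreJet.vec_eq]
  have h1 := add_left_cancel ((hγ.extDeriv_eq hw).symm.trans hη)
  rw [← eq_of_wedgeOne_omegaX_eq (u := (0, momVec l i)) h1 rfl, contractionOneForm_mom, neg_neg]

/-- The momentum derivatives of the coefficient `p^λ_i Γ^i_λ` of `H_Γ`. -/
theorem fderiv_omegaCoeff_connHamiltonian {Γ : ConnForm n m π} (hΓ : IsConnection Γ)
    {w : LegendreModel n m} (hw : w ∈ (canonicalChart hπ c).target) (l : Fin (n + 1))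
    (i : Fin m) :
    fderiv ℝ (fun w => -LegendreForm.omegaCoeff (connHamiltonian hπ Γ) c w) w (0, momVec l i) =
      (ConnForm.coeff Γ c w.1 (baseVec l)) i := by
  let h : LegendreModel n m → ℝ := fun w =>
    ∑ l, ∑ i, momCoeff w.2 l i * (ConnForm.coeff Γ c w.1 (baseVec l)) i
  have h0 : (fun w => -LegendreForm.omegaCoeff (connHamiltonian hπ Γ) c w) =ᶠ[𝓝 w] h := by
    filter_upwards [(canonicalChart hπ c).open_target.mem_nhds hw] with u hu
    rw [LegendreForm.omegaCoeff, rep_connHamiltonian hΓ hu, IsConnection.contractTheta_eq,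
      ContinuousAlternatingMap.sub_apply, ContinuousAlternatingMap.smul_apply, omegaX_partialX,
      momentumForm_partialX, smul_eq_mul, mul_one, zero_sub, neg_neg]
  have hd : DifferentiableAt ℝ h w := by
    refine DifferentiableAt.fun_sum (𝕜 := ℝ) fun l _ =>
      DifferentiableAt.fun_sum (𝕜 := ℝ) (F := ℝ) fun i _ => ?_
    have e1 : DifferentiableAt ℝ
        (fun w : LegendreModel n m => (ConnForm.coeff Γ c w.1 (baseVec l)) i) w :=
      ((hΓ.contDiffOn_coeff hπ l i).contDiffAt
        ((canonicalChart hπ c).open_target.mem_nhds hw)).differentiableAt (by simp)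
    exact (hasFDerivAt_momCoeff l i w).differentiableAt.fun_mul e1
  rw [h0.fderiv_eq]
  let u : LegendreModel n m := (0, momVec l i)
  have h1 : HasDerivAt (fun s : ℝ => h (w + s • u)) (fderiv ℝ h w u) 0 := by
    have e1 : HasDerivAt (fun s : ℝ => w + s • u) u 0 := by
      simpa using ((hasDerivAt_id (0 : ℝ)).smul_const u).const_add w
    have e2 : HasFDerivAt h (fderiv ℝ h w) (w + (0 : ℝ) • u) := by
      rw [zero_smul, add_zero]
      exact hd.hasFDerivAt
    exact HasFDerivAt.comp_hasDerivAt (0 : ℝ) e2 e1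
  have h2 : (fun s : ℝ => h (w + s • u)) =
      fun s => h w + s * (ConnForm.coeff Γ c w.1 (baseVec l)) i := by
    funext s
    have e1 : (w + s • u).1 = w.1 := by simp [u]
    have e2 : ∀ k j, momCoeff (w + s • u).2 k j =
        momCoeff w.2 k j + s * (if k = l ∧ j = i then 1 else 0) := fun k j => by
      rw [← momCoeff_momVec]
      rfl
    simp only [h, e1, e2, add_mul, Finset.sum_add_distrib]
    congr 1
    rw [Finset.sum_eq_single l, Finset.sum_eq_single i] <;> simp +contextual
  have h3 : HasDerivAt (fun s : ℝ => h (w + s • u))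
      ((ConnForm.coeff Γ c w.1 (baseVec l)) i) 0 := by
    rw [h2]
    simpa using ((hasDerivAt_id (0 : ℝ)).mul_const
      ((ConnForm.coeff Γ c w.1 (baseVec l)) i)).const_add (h w)
  exact h1.unique h3

/-- A Hamiltonian form splits with respect to the connection which it induces, with a density that
is critical along the zero section. -/
theorem IsInducedConnection.exists_critical_splitting {H : LegendreForm hπ (n + 1)}
    (hH : IsHamiltonianForm H) {Γ : ConnForm n m π} (hΓ : IsInducedConnection H Γ)
    (q : LegendreBundle hπ) :
    ∃ U : Set (LegendreBundle hπ), IsOpen U ∧ q ∈ U ∧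
      ∃ D : LegendreForm hπ (n + 1), IsHorizontalDensityOn U D ∧ HasCriticalZeroSectionOn U D ∧
        IsClosedFormOn U (H - (connHamiltonian hπ Γ - D)) := by
  obtain ⟨U, hU, hq, D, hD, -, hcl⟩ := hH.exists_splitting hΓ.1 q
  refine ⟨U, hU, hq, D, hD, fun c z hz l i => ?_, hcl⟩
  have hs := (hΓ.1.isSplitFormOn hπ).mono (subset_univ U)
  have h1 := hcl c _ hz
  have hz' : z ∈ c.total.target := (mem_canonicalChart_target hπ c (z, 0)).1 hz.1
  rw [LegendreForm.extDeriv_rep_sub (hH.1.mono (subset_univ U)) (hs.1.sub hD.1) hU hz,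
    LegendreForm.extDeriv_rep_sub hs.1 hD.1 hU hz, hs.extDeriv_eq hU hz, hD.extDeriv_eq hU hz,
    sub_eq_zero, sub_sub, sub_eq_add_neg] at h1
  have h2 : extDeriv (LegendreForm.rep H c) (z, 0) = canonicalTwoPart n m +
      wedge ((-1 : ℝ) • (fderiv ℝ (fun w => -LegendreForm.omegaCoeff
        (connHamiltonian hπ Γ) c w) (z, 0)) - fderiv ℝ (LegendreForm.omegaCoeff D c) (z, 0))
          omegaX := by
    rw [h1, wedge_sub_left, wedge_smul_left, neg_one_smul, neg_add, sub_eq_add_neg]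
  have h3 := hΓ.coeff_eq hH hz' h2 l i
  rw [sub_apply, smul_apply, fderiv_omegaCoeff_connHamiltonian hΓ.1 hz.1, smul_eq_mul] at h3
  linarith

/-! ### Global splittings -/

/-- For a split form `-𝓗` is its coefficient of `ω`, whence `Γ^i_λ = ∂^i_λ 𝓗` along the zero section. -/
theorem IsInducedConnection.coeff_eq_fderiv {H : LegendreForm hπ (n + 1)}
    (hH : IsSplitFormOn univ H) {Γ : ConnForm n m π} (hΓ : IsInducedConnection H Γ)
    {z : BaseModel n × FibModel m} (hz : z ∈ c.total.target) (l : Fin (n + 1)) (i : Fin m) :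
    (ConnForm.coeff Γ c z (baseVec l)) i =
      fderiv ℝ (fun w => -LegendreForm.omegaCoeff H c w) (z, 0) (0, momVec l i) := by
  have hw : (z, (0 : MomModel n m)) ∈ coordDomain hπ c univ :=
    ⟨(mem_canonicalChart_target hπ c _).2 hz, mem_univ _⟩
  have h1 := hH.extDeriv_eq isOpen_univ hw
  rw [sub_eq_add_neg, ← neg_one_smul ℝ (wedge _ _), ← wedge_smul_left] at h1
  rw [hΓ.coeff_eq hH.isHamiltonianForm hz h1, smul_apply, neg_one_smul, neg_neg]

theorem IsInducedConnection.hasCriticalZeroSectionOn_sub {H : LegendreForm hπ (n + 1)}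
    (hH : IsSplitFormOn univ H) {Γ : ConnForm n m π} (hΓ : IsInducedConnection H Γ) :
    HasCriticalZeroSectionOn univ (connHamiltonian hπ Γ - H) := by
  intro c z hz l i
  have hz' : z ∈ c.total.target := (mem_canonicalChart_target hπ c (z, 0)).1 hz.1
  have hn := (isOpen_coordDomain hπ c isOpen_univ).mem_nhds hz
  have hs := hΓ.1.isSplitFormOn hπ
  have d1 : DifferentiableAt ℝ (fun w => -LegendreForm.omegaCoeff H c w) (z, 0) :=
    (((hH.1.contDiffOn_omegaCoeff c).contDiffAt hn).differentiableAt (by simp)).neg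
  have d2 : DifferentiableAt ℝ (fun w => -LegendreForm.omegaCoeff (connHamiltonian hπ Γ) c w)
      (z, 0) := (((hs.1.contDiffOn_omegaCoeff c).contDiffAt hn).differentiableAt (by simp)).neg
  have h1 : LegendreForm.omegaCoeff (connHamiltonian hπ Γ - H) c = fun w =>
      -LegendreForm.omegaCoeff H c w - -LegendreForm.omegaCoeff (connHamiltonian hπ Γ) c w := by
    funext w
    rw [LegendreForm.omegaCoeff, LegendreForm.rep_sub, ContinuousAlternatingMap.sub_apply]
    simp only [LegendreForm.omegaCoeff]
    ring
  rw [h1, fderiv_fun_sub d1 d2, sub_apply, fderiv_omegaCoeff_connHamiltonian hΓ.1 hz.1,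
    ← hΓ.coeff_eq_fderiv hH hz', sub_self]

variable (hπ) in
/-- The vector space of all horizontal densities on `Π → X`. -/
def horizontalDensities : Submodule ℝ (LegendreForm hπ (n + 1)) where
  carrier := {D | IsHorizontalDensityOn univ D}
  zero_mem' := ⟨fun _ => contDiffOn_zero_form, fun _ => ⟨0, fun _ _ => (zero_smul ℝ _).symm⟩⟩
  add_mem' {D D'} hD hD' := by
    refine ⟨fun c => ContDiffOn.add_form (hD.1 c) (hD'.1 c), fun c => ⟨fun w =>
      LegendreForm.omegaCoeff D c w + LegendreForm.omegaCoeff D' c w, fun w hw => ?_⟩⟩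
    rw [add_smul, ← hD.rep_eq hw, ← hD'.rep_eq hw]
    rfl
  smul_mem' a D hD := by
    refine ⟨fun c => ContDiffOn.const_smul_form (hD.1 c) a, fun c => ⟨fun w =>
      a • LegendreForm.omegaCoeff D c w, fun w hw => ?_⟩⟩
    rw [smul_assoc, ← hD.rep_eq hw]
    rfl

end InducedConnection

/-! ### Coordinate vector fields and Christoffel symbols -/

section Christoffel

open VectorField

variable {H M : Type*} [NormedAddCommGroup H] [NormedSpace ℝ H]
  [TopologicalSpace M] [ChartedSpace H M] {b : OpenPartialHomeomorph M H}

/-- The vector field with constant value `v`. -/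
def constField (v : H) (x : H) : TangentSpace 𝓘(ℝ, H) x := v

/-- The coordinate vector field of the chart `b` in the direction `v`. -/
def coordField (b : OpenPartialHomeomorph M H) (v : H) (x : M) : TangentSpace 𝓘(ℝ, H) x :=
  mfderiv 𝓘(ℝ, H) 𝓘(ℝ, H) b.symm (b x) v

theorem isInvertible_mfderiv (hb : b ∈ IsManifold.maximalAtlas 𝓘(ℝ, H) ∞ M) {x : M}
    (hx : x ∈ b.source) : (mfderiv 𝓘(ℝ, H) 𝓘(ℝ, H) b x).IsInvertible :=
  ⟨(mdifferentiable_of_mem_maximalAtlas hb).mfderiv hx, rfl⟩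

theorem coordField_eq_mpullback (hb : b ∈ IsManifold.maximalAtlas 𝓘(ℝ, H) ∞ M) {x : M}
    (hx : x ∈ b.source) (v : H) :
    coordField b v x = mpullback 𝓘(ℝ, H) 𝓘(ℝ, H) b (constField v) x := by
  have h := mdifferentiable_of_mem_maximalAtlas hb
  have h1 := h.symm_comp_deriv hx
  have h2 := h.comp_symm_deriv (b.map_source hx)
  rw [b.left_inv hx] at h2
  have h3 : (mfderiv 𝓘(ℝ, H) 𝓘(ℝ, H) b x).inverse = mfderiv 𝓘(ℝ, H) 𝓘(ℝ, H) b.symm (b x) :=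
    ContinuousLinearMap.inverse_eq h2 h1
  exact (congrArg (fun A : H →L[ℝ] H => A v) h3).symm

theorem coordField_eventuallyEq (hb : b ∈ IsManifold.maximalAtlas 𝓘(ℝ, H) ∞ M) {x : M}
    (hx : x ∈ b.source) (v : H) :
    coordField b v =ᶠ[𝓝 x] mpullback 𝓘(ℝ, H) 𝓘(ℝ, H) b (constField v) := by
  filter_upwards [b.open_source.mem_nhds hx] with x' hx' using coordField_eq_mpullback hb hx' v

theorem mdifferentiableAt_constField (v x : H) : MDiffAt (T% (constField v)) x :=
  (contMDiffAt_vectorSpace_iff_contDiffAt.2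
    (contDiffAt_const (c := v) (n := 1))).mdifferentiableAt one_ne_zero

variable [CompleteSpace H] [IsManifold 𝓘(ℝ, H) ∞ M]

theorem mdifferentiableAt_coordField (hb : b ∈ IsManifold.maximalAtlas 𝓘(ℝ, H) ∞ M) {x : M}
    (hx : x ∈ b.source) (v : H) : MDiffAt (T% (coordField b v)) x := by
  have : IsManifold 𝓘(ℝ, H) 2 M := IsManifold.of_le (n := ∞) (WithTop.coe_le_coe.2 le_top)
  have h1 : MDiffAt (T% (mpullback 𝓘(ℝ, H) 𝓘(ℝ, H) b (constField v))) x :=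
    MDifferentiableAt.mpullback_vectorField (n := ∞) (mdifferentiableAt_constField v _)
      ((contMDiffOn_of_mem_maximalAtlas hb).contMDiffAt (b.open_source.mem_nhds hx))
      (isInvertible_mfderiv hb hx) (WithTop.coe_le_coe.2 le_top)
  refine h1.congr_of_eventuallyEq ?_
  filter_upwards [coordField_eventuallyEq hb hx v] with x' hx'
  rw [hx']

/-- Coordinate vector fields commute. -/
theorem mlieBracket_coordField (hb : b ∈ IsManifold.maximalAtlas 𝓘(ℝ, H) ∞ M) {x : M}
    (hx : x ∈ b.source) (v v' : H) :
    mlieBracket 𝓘(ℝ, H) (coordField b v) (coordField b v') x = 0 := by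
  have : IsManifold 𝓘(ℝ, H) (minSmoothness ℝ 2) M := IsManifold.of_le minSmoothness_two_le_infty
  have h0 : mlieBracket 𝓘(ℝ, H) (constField v) (constField v') = 0 := by
    have h1 : lieBracket ℝ (fun _ : H => v) (fun _ : H => v') = 0 := by
      rw [lieBracket_eq]
      funext y
      simp
    rw [← mlieBracketWithin_univ]
    exact mlieBracketWithin_eq_lieBracketWithin.trans (lieBracketWithin_univ.trans h1)
  rw [(coordField_eventuallyEq hb hx v).mlieBracket_vectorField_eq
    (coordField_eventuallyEq hb hx v'), ← mpullback_mlieBracket (n := ∞)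
      (mdifferentiableAt_constField v _) (mdifferentiableAt_constField v' _)
      ((contMDiffOn_of_mem_maximalAtlas hb).contMDiffAt (b.open_source.mem_nhds hx))
      minSmoothness_two_le_infty, h0, mpullback_zero]
  rfl

/-- The coefficients of a symmetric linear connection are symmetric in their lower indices. -/
theorem christoffel_symm {n : ℕ} {X : Type*} [TopologicalSpace X] [ChartedSpace (BaseModel n) X]
    [IsManifold 𝓘(ℝ, BaseModel n) ∞ X]
    {K : CovariantDerivative 𝓘(ℝ, BaseModel n) (BaseModel n)
      (fun x : X => TangentSpace 𝓘(ℝ, BaseModel n) x)} (hK : ∀ x, K.torsion x = 0)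
    {b : OpenPartialHomeomorph X (BaseModel n)}
    (hb : b ∈ IsManifold.maximalAtlas 𝓘(ℝ, BaseModel n) ∞ X) {x : BaseModel n}
    (hx : x ∈ b.target) (α ν l : Fin (n + 1)) :
    christoffel K b x α ν l = christoffel K b x α l ν := by
  have hs := b.map_target hx
  have h1 := K.torsion_apply (mdifferentiableAt_coordField hb hs (baseVec ν))
    (mdifferentiableAt_coordField hb hs (baseVec l))
  rw [mlieBracket_coordField hb hs, hK, sub_zero] at h1
  have h2 : K (coordField b (baseVec l)) (b.symm x) (coordField b (baseVec ν) (b.symm x)) =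
      K (coordField b (baseVec ν)) (b.symm x) (coordField b (baseVec l) (b.symm x)) :=
    sub_eq_zero.1 h1.symm
  have h3 : ∀ v : BaseModel n, coordField b v (b.symm x) =
      mfderiv 𝓘(ℝ, BaseModel n) 𝓘(ℝ, BaseModel n) b.symm x v := fun v => by
    rw [coordField, b.right_inv hx]
  rw [h3, h3] at h2
  let A : BaseModel n →L[ℝ] BaseModel n :=
    mfderiv 𝓘(ℝ, BaseModel n) 𝓘(ℝ, BaseModel n) b (b.symm x)
  exact congrArg (fun u : BaseModel n => (A u) α) h2.symm

end Christoffel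

/-! ### Lifts of connections to the Legendre bundle -/

section Lift

variable {n m : ℕ} {X Y : Type*}
  [TopologicalSpace X] [ChartedSpace (BaseModel n) X]
  [TopologicalSpace Y] [ChartedSpace (BaseModel n × FibModel m) Y]
  {π : Y → X} {hπ : IsFibredManifold n m π} {c : FibredChart n m π}

/-- The fibre derivatives of the coefficient `p^λ_i Γ^i_λ` of `H_Γ`. -/
theorem fderiv_omegaCoeff_connHamiltonian_fib {Γ : ConnForm n m π} (hΓ : IsConnection Γ)
    {w : LegendreModel n m} (hw : w ∈ (canonicalChart hπ c).target) (j : Fin m) :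
    fderiv ℝ (fun w => -LegendreForm.omegaCoeff (connHamiltonian hπ Γ) c w) w
        ((0, fibVec j), 0) =
      ∑ l, ∑ i, (fderiv ℝ (ConnForm.coeff Γ c) w.1 (0, fibVec j) (baseVec l)) i *
        momCoeff w.2 l i := by
  have hz := (mem_canonicalChart_target hπ c w).1 hw
  let h : BaseModel n × FibModel m → ℝ := fun z =>
    ∑ l, ∑ i, momCoeff w.2 l i * (ConnForm.coeff Γ c z (baseVec l)) i
  have hd : HasFDerivAt (ConnForm.coeff Γ c) (fderiv ℝ (ConnForm.coeff Γ c) w.1) w.1 :=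
    (((hΓ.2 c).contDiffAt (c.total.open_target.mem_nhds hz)).differentiableAt
      (by simp)).hasFDerivAt
  have hs := hΓ.isSplitFormOn hπ
  have hwU : w ∈ coordDomain hπ c univ := ⟨hw, mem_univ _⟩
  have hD : DifferentiableAt ℝ
      (fun w => -LegendreForm.omegaCoeff (connHamiltonian hπ Γ) c w) w :=
    (((hs.1.contDiffOn_omegaCoeff c).contDiffAt
      ((isOpen_coordDomain hπ c isOpen_univ).mem_nhds hwU)).differentiableAt (by simp)).neg
  have e1 : HasDerivAt (fun s : ℝ => w.1 + s • ((0, fibVec j) : BaseModel n × FibModel m))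
      (0, fibVec j) 0 := by
    simpa using ((hasDerivAt_id (0 : ℝ)).smul_const
      ((0, fibVec j) : BaseModel n × FibModel m)).const_add w.1
  have e2 : HasDerivAt (fun s : ℝ => (w.1 + s • ((0, fibVec j) : BaseModel n × FibModel m), w.2))
      ((0, fibVec j), 0) 0 := e1.prodMk (hasDerivAt_const (0 : ℝ) w.2)
  have e3 : HasDerivAt (fun s : ℝ => -LegendreForm.omegaCoeff (connHamiltonian hπ Γ) c
      (w.1 + s • ((0, fibVec j) : BaseModel n × FibModel m), w.2))
      (fderiv ℝ (fun w => -LegendreForm.omegaCoeff (connHamiltonian hπ Γ) c w) w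
        ((0, fibVec j), 0)) 0 := by
    have h1 : HasFDerivAt (fun w => -LegendreForm.omegaCoeff (connHamiltonian hπ Γ) c w)
        (fderiv ℝ (fun w => -LegendreForm.omegaCoeff (connHamiltonian hπ Γ) c w) w)
        (w.1 + (0 : ℝ) • ((0, fibVec j) : BaseModel n × FibModel m), w.2) := by
      rw [zero_smul, add_zero]
      exact hD.hasFDerivAt
    exact HasFDerivAt.comp_hasDerivAt (0 : ℝ) h1 e2
  have e4 : HasDerivAt (fun s : ℝ => ConnForm.coeff Γ c
      (w.1 + s • ((0, fibVec j) : BaseModel n × FibModel m)))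
      (fderiv ℝ (ConnForm.coeff Γ c) w.1 (0, fibVec j)) 0 := by
    have h1 : HasFDerivAt (ConnForm.coeff Γ c) (fderiv ℝ (ConnForm.coeff Γ c) w.1)
        (w.1 + (0 : ℝ) • ((0, fibVec j) : BaseModel n × FibModel m)) := by
      rw [zero_smul, add_zero]
      exact hd
    exact HasFDerivAt.comp_hasDerivAt (0 : ℝ) h1 e1
  have e5 : HasDerivAt (fun s : ℝ => h (w.1 + s • ((0, fibVec j) : BaseModel n × FibModel m)))
      (∑ l, ∑ i, momCoeff w.2 l i *
        (fderiv ℝ (ConnForm.coeff Γ c) w.1 (0, fibVec j) (baseVec l)) i) 0 := by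
    refine HasDerivAt.fun_sum fun l _ => HasDerivAt.fun_sum fun i _ => ?_
    have h1 : HasDerivAt (fun s : ℝ => (EuclideanSpace.proj i).comp
        (ContinuousLinearMap.apply ℝ (FibModel m) (baseVec l : BaseModel n))
        (ConnForm.coeff Γ c (w.1 + s • ((0, fibVec j) : BaseModel n × FibModel m)))) _ 0 :=
      ((EuclideanSpace.proj i : FibModel m →L[ℝ] ℝ).comp
        (ContinuousLinearMap.apply ℝ (FibModel m)
          (baseVec l : BaseModel n))).hasFDerivAt.comp_hasDerivAt (0 : ℝ) e4
    exact h1.const_mul _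
  have e6 : (fun s : ℝ => -LegendreForm.omegaCoeff (connHamiltonian hπ Γ) c
      (w.1 + s • ((0, fibVec j) : BaseModel n × FibModel m), w.2)) =ᶠ[𝓝 0]
      fun s : ℝ => h (w.1 + s • ((0, fibVec j) : BaseModel n × FibModel m)) := by
    have hc : Continuous fun s : ℝ => ((w.1 + s • ((0, fibVec j) : BaseModel n × FibModel m), w.2) :
      LegendreModel n m) := by fun_prop
    have h0 : ((w.1 + (0 : ℝ) • ((0, fibVec j) : BaseModel n × FibModel m), w.2) :
      LegendreModel n m) ∈ (canonicalChart hπ c).target := by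
      rw [zero_smul, add_zero]; exact hw
    filter_upwards [((canonicalChart hπ c).open_target.preimage hc).mem_nhds h0] with s hs'
    rw [LegendreForm.omegaCoeff, rep_connHamiltonian hΓ hs', IsConnection.contractTheta_eq,
      ContinuousAlternatingMap.sub_apply, ContinuousAlternatingMap.smul_apply, omegaX_partialX,
      momentumForm_partialX, smul_eq_mul, mul_one, zero_sub, neg_neg]
  rw [e3.unique (e5.congr_of_eventuallyEq e6)]
  simp only [mul_comm]

variable [IsManifold 𝓘(ℝ, BaseModel n) ∞ X]

/-- The lift of a connection by a symmetric linear connection is associated with `H_Γ`: the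
terms with `K` cancel in the trace `γ^λ_{iλ}`. -/
theorem IsConnectionLift.isAssociatedJetFieldOn {Γ : ConnForm n m π} (hΓ : IsConnection Γ)
    {K : CovariantDerivative 𝓘(ℝ, BaseModel n) (BaseModel n)
      (fun x : X => TangentSpace 𝓘(ℝ, BaseModel n) x)} (hK : ∀ x, K.torsion x = 0)
    {γ : LegendreJet hπ} (hγ : IsConnectionLift Γ K γ) :
    IsAssociatedJetFieldOn univ γ (connHamiltonian hπ Γ) := by
  have hs := hΓ.isSplitFormOn hπ
  refine isAssociatedJetFieldOn_of_eq isOpen_univ hγ.1 hs.1 fun c w hw => ?_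
  rw [hs.extDeriv_eq isOpen_univ hw, LegendreJet.contractOmega,
    sum_curryLeft_multisymplecticComp _ fun l => hγ.1.vec_fst hw l, sub_eq_add_neg,
    ← neg_one_smul ℝ (wedge _ _), ← wedge_smul_left]
  congr 1
  have hx : w.1.1 ∈ c.base.target := by
    have hz := (mem_canonicalChart_target hπ c w).1 hw.1
    rw [← c.base_proj_symm hz]
    exact c.base.map_source (c.mapsTo _ (c.total.map_target hz))
  refine wedgeOne_omegaX_congr fun u hu => eq_on_vertical (fun j => ?_) (fun l i => ?_) hu
  · rw [contractionOneForm_fib, smul_apply, fderiv_omegaCoeff_connHamiltonian_fib hΓ hw.1,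
      neg_one_smul]
    have h1 : ∀ l, momCoeff (LegendreJet.vec γ c w l).2 l j =
        -(∑ i, (fderiv ℝ (ConnForm.coeff Γ c) w.1 (0, fibVec j) (baseVec l)) i *
              momCoeff w.2 l i)
            - (∑ ν, christoffel K c.base w.1.1 l ν l * momCoeff w.2 ν j)
            + (∑ α, christoffel K c.base w.1.1 α α l) * momCoeff w.2 l j := fun l => by
      rw [hγ.2 c w hw l, momCoeff_sum_momVec]
    have h2 : ∑ l, ∑ ν, christoffel K c.base w.1.1 l ν l * momCoeff w.2 ν j =
        ∑ l, (∑ α, christoffel K c.base w.1.1 α α l) * momCoeff w.2 l j := by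
      rw [Finset.sum_comm]
      refine Finset.sum_congr rfl fun ν _ => ?_
      rw [Finset.sum_mul]
      exact Finset.sum_congr rfl fun l _ => by rw [christoffel_symm hK c.base_mem hx]
    simp only [h1, Finset.sum_add_distrib, Finset.sum_sub_distrib, Finset.sum_neg_distrib, h2]
    ring
  · rw [contractionOneForm_mom, smul_apply, fderiv_omegaCoeff_connHamiltonian hΓ hw.1,
      hγ.2 c w hw l, neg_one_smul]

end Lift

end

theorem proposition13p2 (n m : ℕ) {X Y : Type*}
    [TopologicalSpace X] [T2Space X] [SecondCountableTopology X]
    [ChartedSpace (BaseModel n) X] [IsManifold 𝓘(ℝ, BaseModel n) ∞ X]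
    [TopologicalSpace Y] [T2Space Y] [SecondCountableTopology Y]
    [ChartedSpace (BaseModel n × FibModel m) Y]
    [IsManifold 𝓘(ℝ, BaseModel n × FibModel m) ∞ Y]
    (π : Y → X) (hπ : IsFibredManifold n m π) :
    -- subtracting a horizontal density from a Hamiltonian form gives a Hamiltonian form
    (∀ H D : LegendreForm hπ (n + 1), IsHamiltonianForm H → IsHorizontalDensityOn univ D →
      IsHamiltonianForm (H - D)) ∧
    -- locally modulo closed forms, Hamiltonian forms differ by horizontal densities
    (∀ H H' : LegendreForm hπ (n + 1), IsHamiltonianForm H → IsHamiltonianForm H' →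
      ∀ q : LegendreBundle hπ, ∃ U : Set (LegendreBundle hπ), IsOpen U ∧ q ∈ U ∧
        ∃ D : LegendreForm hπ (n + 1), IsHorizontalDensityOn U D ∧
          IsClosedFormOn U (H - H' - D)) ∧
    -- there are connections on `Y → X`
    (∃ Γ : ConnForm n m π, IsConnection Γ) ∧
    -- `H_Γ = Γ̂ ⌋ θ = p^λ_i dy^i ∧ ω_λ - p^λ_i Γ^i_λ ω` is a Hamiltonian form, and every lift of `Γ`
    -- by a symmetric linear connection on `X` is a Hamiltonian connection for it
    (∀ Γ : ConnForm n m π, IsConnection Γ →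
      IsHamiltonianForm (connHamiltonian hπ Γ) ∧
      (∀ c : FibredChart n m π, ∀ w ∈ (canonicalChart hπ c).target,
        LegendreForm.rep (connHamiltonian hπ Γ) c w = ConnForm.contractTheta Γ c w ∧
        LegendreForm.rep (connHamiltonian hπ Γ) c w = momentumForm w.2 -
          (∑ l, ∑ i, momCoeff w.2 l i * (ConnForm.coeff Γ c w.1 (baseVec l)) i) • omegaX) ∧
      (∀ K : CovariantDerivative 𝓘(ℝ, BaseModel n) (BaseModel n)
          (fun x : X => TangentSpace 𝓘(ℝ, BaseModel n) x),
        (∀ x, K.torsion x = 0) → ∀ γ : LegendreJet hπ, IsConnectionLift Γ K γ →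
          IsAssociatedJetFieldOn univ γ (connHamiltonian hπ Γ))) ∧
    -- locally modulo closed forms, every Hamiltonian form splits with respect to any connection
    (∀ H : LegendreForm hπ (n + 1), IsHamiltonianForm H →
      ∀ Γ : ConnForm n m π, IsConnection Γ →
      ∀ q : LegendreBundle hπ, ∃ U : Set (LegendreBundle hπ), IsOpen U ∧ q ∈ U ∧
        ∃ D : LegendreForm hπ (n + 1), IsHorizontalDensityOn U D ∧
          IsSplitFormOn U (connHamiltonian hπ Γ - D) ∧
          IsClosedFormOn U (H - (connHamiltonian hπ Γ - D))) ∧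
    -- every Hamiltonian form determines a connection, and splits canonically
    (∀ H : LegendreForm hπ (n + 1), IsHamiltonianForm H →
      ∃! Γ : ConnForm n m π, IsInducedConnection H Γ ∧
        ∀ q : LegendreBundle hπ, ∃ U : Set (LegendreBundle hπ), IsOpen U ∧ q ∈ U ∧
          ∃ D : LegendreForm hπ (n + 1), IsHorizontalDensityOn U D ∧
            HasCriticalZeroSectionOn U D ∧
            IsClosedFormOn U (H - (connHamiltonian hπ Γ - D))) ∧
    -- the forms `p^λ_i dy^i ∧ ω_λ - 𝓗 ω` are Hamiltonian, and form a non-empty affine space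
    -- modelled on the horizontal densities, with no closed forms involved
    (∀ H : LegendreForm hπ (n + 1), IsSplitFormOn univ H → IsHamiltonianForm H) ∧
    (∃ A : AffineSubspace ℝ (LegendreForm hπ (n + 1)),
      (A : Set (LegendreForm hπ (n + 1))).Nonempty ∧
      (A : Set (LegendreForm hπ (n + 1))) = {H | IsSplitFormOn univ H} ∧
      (A.direction : Set (LegendreForm hπ (n + 1))) = {D | IsHorizontalDensityOn univ D}) ∧
    -- they split globally with respect to any connection on `Y → X`
    (∀ H : LegendreForm hπ (n + 1), IsSplitFormOn univ H →
      ∀ Γ : ConnForm n m π, IsConnection Γ →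
        ∃! D : LegendreForm hπ (n + 1), IsHorizontalDensityOn univ D ∧
          H = connHamiltonian hπ Γ - D) ∧
    -- and they split globally with respect to the connection `Γ_H`, `(Γ_H)^i_λ = ∂^i_λ 𝓗 ∘ 0̂`
    (∀ H : LegendreForm hπ (n + 1), IsSplitFormOn univ H →
      ∃! Γ : ConnForm n m π, IsInducedConnection H Γ ∧
        (∀ c : FibredChart n m π, ∀ z ∈ c.total.target, ∀ (l : Fin (n + 1)) (i : Fin m),
          (ConnForm.coeff Γ c z (baseVec l)) i =
            fderiv ℝ (fun w => -LegendreForm.omegaCoeff H c w) (z, 0) (0, momVec l i)) ∧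
        ∃ D : LegendreForm hπ (n + 1), IsHorizontalDensityOn univ D ∧
          HasCriticalZeroSectionOn univ D ∧ H = connHamiltonian hπ Γ - D) := by
  refine ⟨fun H D hH hD => hH.sub_density hD, fun H H' hH hH' q => hH.exists_density hH' q,
    exists_isConnection hπ, fun Γ hΓ => ⟨(hΓ.isSplitFormOn hπ).isHamiltonianForm,
      fun c w hw => ⟨rep_connHamiltonian hΓ hw,
        (rep_connHamiltonian hΓ hw).trans (IsConnection.contractTheta_eq w)⟩,
      fun K hK γ hγ => hγ.isAssociatedJetFieldOn hΓ hK⟩,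
    fun H hH Γ hΓ q => hH.exists_splitting hΓ q, fun H hH => ?_,
    fun H hH => hH.isHamiltonianForm, ?_, fun H hH Γ hΓ => ?_, fun H hH => ?_⟩
  · obtain ⟨Γ, hΓ⟩ := hH.exists_isInducedConnection
    exact ⟨Γ, ⟨hΓ, fun q => hΓ.exists_critical_splitting hH q⟩,
      fun Γ' hΓ' => IsInducedConnection.unique hH hΓ'.1 hΓ⟩
  · obtain ⟨Γ, hΓ⟩ := exists_isConnection hπ
    have hs := hΓ.isSplitFormOn hπ
    refine ⟨AffineSubspace.mk' (connHamiltonian hπ Γ) (horizontalDensities hπ),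
      AffineSubspace.mk'_nonempty _ _, ?_, ?_⟩
    · ext H
      rw [SetLike.mem_coe, AffineSubspace.mem_mk', vsub_eq_sub]
      refine ⟨fun hH => ?_, fun hH => hH.sub hs⟩
      have h1 : IsSplitFormOn univ (connHamiltonian hπ Γ - -(H - connHamiltonian hπ Γ)) :=
        hs.sub_density ((horizontalDensities hπ).neg_mem hH)
      rwa [sub_neg_eq_add, add_sub_cancel] at h1
    · rw [AffineSubspace.direction_mk']
      rfl
  · refine ⟨connHamiltonian hπ Γ - H, ⟨(hΓ.isSplitFormOn hπ).sub hH, (sub_sub_cancel _ _).symm⟩,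
      fun D hD => ?_⟩
    rw [hD.2, sub_sub_cancel]
  · obtain ⟨Γ, hΓ⟩ := hH.isHamiltonianForm.exists_isInducedConnection
    exact ⟨Γ, ⟨hΓ, fun c z hz l i => hΓ.coeff_eq_fderiv hH hz l i,
      connHamiltonian hπ Γ - H, (hΓ.1.isSplitFormOn hπ).sub hH, hΓ.hasCriticalZeroSectionOn_sub hH,
      (sub_sub_cancel _ _).symm⟩,
      fun Γ' hΓ' => IsInducedConnection.unique hH.isHamiltonianForm hΓ'.1 hΓ⟩
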